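/- Consider the minimum-length rooted capacitated Steiner tree problem (ML-CAP-STEINER-TREE). An instance consists of a finite graph $G=(V,E)$, directed or undirected (loops and parallel edges allowed), a root $r\in V$, a set $T=\{t_1,\dots,t_K\}\subseteq V\setminus\{r\}$ of $K\ge 2$ distinct terminals, a length function $\ell:E\to\mathbb{Q}_{\ge 0}$ and a capacity function $c:E\to\{1,2,\dots\}$; it is assumed that $G$ is connected if it is undirected, and that $G$ contains a directed path from $r$ to every vertex if it is directed. A feasible solution is a directed tree $S$ in $G$ rooted at $r$ (in an undirected graph, every arc of $S$ is an edge of $G$ with one of its two orientations) that spans all terminals and such that, for every arc $e=(u,v)$ of $S$, the subtree of $S$ rooted at $v$ contains at most $c(e)$ terminals. The task is to find a feasible solution of minimum total length $\ell(S)=\sum_{e\in S}\ell(e)$, or to report that there is no feasible solution. **Theorem.** Restricted to the instances with unit capacities ($c(e)=1$ for all $e\in E$), ML-CAP-STEINER-TREE is solvable in polynomial time: there are a program for a random access machine with logarithmic cost and a polynomial $q$ such that, on every such instance, the program halts with a correct answer (an optimal solution, or the information that no feasible solution exists) after a computation of cost at most $q(N)$, where $N$ is the total bit length of the instance (rational lengths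 are given by numerator and denominator). Moreover, the following hold for every instance with unit capacities. 1. Every feasible solution $S$ contains $K$ internally vertex-disjoint paths, one from $r$ to each terminal (two of these paths have only $r$ in common); if $S$ is inclusion-wise minimal among feasible solutions, it is the union of these paths. 2. Conversely, the union of any $K$ internally vertex-disjoint paths, one from $r$ to each terminal, is a feasible solution, and its length is the sum of the lengths of the paths. 3. Let $H$ be the network with source $r$ and a new sink $s$ in which every vertex $v\neq r$ of $G$ is replaced by an arc $(v',v'')$ of cost $0$; every arc $(u,v)$ of $G$ becomes an arc $(u'',v')$ with cost equal to its length (where $r'=r''=r$; an undirected edge is first replaced by two opposite arcs of the same length); there is an arc $(t_k'',s)$ of cost $0$ for $k=1,\dots,K$; and all capacities are $1$. Then a feasible solution exists if and only if $H$ admits an integral flow of $K$ units from $r$ to $s$; and for every minimum-cost integral flow of $K$ units from $r$ to $s$ in $H$, the set of arcs of $G$ that carry a positive flow contains an optimal solution, whose length equals the cost of the flow. -/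

import Mathlib

namespace CapSteiner

/-! ## A random access machine with logarithmic cost

Programs are structured (assignment, sequencing, branching, `while`) and work on finitely many
integer arrays. Evaluating an expression costs, at each of its nodes, one plus the bit length of
the value computed at that node (so also of every operand, result and address). -/

/-- The cost of handling one integer: one plus its bit length. -/
def bits (z : ℤ) : ℕ := z.natAbs.size + 1

/-- The memory: for each array name, its integer cells. -/
abbrev Mem := ℕ → ℤ → ℤ

/-- Arithmetic expressions; `get a i` reads the cell of array `a` whose address is the value
of `i` (indirect addressing). -/
inductive Expr where
  | const (z : ℤ)
  | get (a : ℕ) (i : Expr)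
  | add (x y : Expr)
  | sub (x y : Expr)
  | mul (x y : Expr)

/-- The value of an expression. -/
def Expr.eval (σ : Mem) : Expr → ℤ
  | .const z => z
  | .get a i => σ a (i.eval σ)
  | .add x y => x.eval σ + y.eval σ
  | .sub x y => x.eval σ - y.eval σ
  | .mul x y => x.eval σ * y.eval σ

/-- The logarithmic cost of evaluating an expression. -/
def Expr.cost (σ : Mem) : Expr → ℕ
  | .const z => bits z
  | .get a i => i.cost σ + bits (σ a (i.eval σ))
  | .add x y => x.cost σ + y.cost σ + bits (x.eval σ + y.eval σ)
  | .sub x y => x.cost σ + y.cost σ + bits (x.eval σ - y.eval σ)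
  | .mul x y => x.cost σ + y.cost σ + bits (x.eval σ * y.eval σ)

/-- Programs. `set a i e` is the assignment `a[i] := e`; the tests of `cond` and `loop` ask
whether the value of the expression is positive. -/
inductive Prog where
  | skip
  | set (a : ℕ) (i e : Expr)
  | seq (p q : Prog)
  | cond (e : Expr) (p q : Prog)
  | loop (e : Expr) (p : Prog)

/-- The memory after storing `z` in the cell with address `i` of array `a`. -/
def Mem.store (σ : Mem) (a : ℕ) (i z : ℤ) : Mem :=
  Function.update σ a (Function.update (σ a) i z)

/-- `Exec p σ t τ`: started in memory `σ`, the program `p` halts in memory `τ` at total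
cost `t`. -/
inductive Exec : Prog → Mem → ℕ → Mem → Prop where
  | skip (σ : Mem) : Exec .skip σ 1 σ
  | set (σ : Mem) (a : ℕ) (i e : Expr) :
      Exec (.set a i e) σ (i.cost σ + e.cost σ + 1) (σ.store a (i.eval σ) (e.eval σ))
  | seq {p q : Prog} {σ τ ρ : Mem} {s t : ℕ} (hp : Exec p σ s τ) (hq : Exec q τ t ρ) :
      Exec (.seq p q) σ (s + t + 1) ρ
  | cond_pos {e : Expr} {p q : Prog} {σ τ : Mem} {t : ℕ} (he : 0 < e.eval σ)
      (hp : Exec p σ t τ) : Exec (.cond e p q) σ (e.cost σ + t + 1) τ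
  | cond_neg {e : Expr} {p q : Prog} {σ τ : Mem} {t : ℕ} (he : ¬ 0 < e.eval σ)
      (hq : Exec q σ t τ) : Exec (.cond e p q) σ (e.cost σ + t + 1) τ
  | loop_stop {e : Expr} {p : Prog} {σ : Mem} (he : ¬ 0 < e.eval σ) :
      Exec (.loop e p) σ (e.cost σ + 1) σ
  | loop_step {e : Expr} {p : Prog} {σ τ ρ : Mem} {s t : ℕ} (he : 0 < e.eval σ)
      (hp : Exec p σ s τ) (hl : Exec (.loop e p) τ t ρ) :
      Exec (.loop e p) σ (e.cost σ + s + t + 1) ρ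

/-- The size of a word of integers: its total bit length (plus one for each entry). -/
def wordSize (w : List ℤ) : ℕ := (w.map bits).sum

/-- The initial memory on input `w`: cell `0` of array `0` holds the length of `w`, cells
`1, 2, …` of array `0` hold the entries of `w`; everything else is `0`. -/
def initMem (w : List ℤ) : Mem := fun a i =>
  if a = 0 then
    if i = 0 then (w.length : ℤ) else if 0 < i then w.getD (i.toNat - 1) 0 else 0
  else 0

/-- The output in a memory is `w`: cell `0` of array `1` holds the length of `w`, and the next
cells of array `1` hold the entries of `w`. -/
def HasOutput (σ : Mem) (w : List ℤ) : Prop :=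
  σ 1 0 = w.length ∧ ∀ (j : ℕ) (hj : j < w.length), σ 1 ((j : ℤ) + 1) = w[j]

/-- The search problem `R` (given `x`, find some `y` with `R x y`), restricted to the inputs in
`D`, is solvable in polynomial time: a single program finds, for every such input `x`, a correct
answer within a cost that is polynomial in the bit length of the encoding of `x`. -/
def PolyTimeSolvable {α : Type} {β : α → Type} (encIn : α → List ℤ)
    (encOut : (x : α) → β x → List ℤ) (D : α → Prop) (R : (x : α) → β x → Prop) : Prop :=
  ∃ (p : Prog) (q : Polynomial ℕ), ∀ x : α, D x →
    ∃ (t : ℕ) (τ : Mem) (y : β x),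
      Exec p (initMem (encIn x)) t τ ∧ t ≤ q.eval (wordSize (encIn x)) ∧
        HasOutput τ (encOut x y) ∧ R x y

/-! ## The minimum-length capacitated Steiner tree problem -/

/-- A directed or undirected finite graph (loops and parallel edges are allowed) with root,
terminals, edge lengths and edge capacities, before any condition is imposed. An edge `e` joins
`fst e` and `snd e`; if the graph is directed, it goes from `fst e` to `snd e`. -/
structure PreInst where
  directed : Bool
  n : ℕ
  m : ℕ
  K : ℕ
  fst : Fin m → Fin n
  snd : Fin m → Fin n
  root : Fin n
  terminal : Fin K → Fin n
  len : Fin m → ℚ≥0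
  cap : Fin m → ℕ

namespace PreInst

variable (I : PreInst)

/-- An edge together with a direction of traversal: `(e, true)` runs from `fst e` to `snd e`,
and `(e, false)` from `snd e` to `fst e`. -/
abbrev Arc := Fin I.m × Bool

/-- In an undirected graph every edge may be traversed both ways, in a directed graph only
forwards. -/
def IsArc (a : I.Arc) : Prop := I.directed = true → a.2 = true

/-- The start vertex of an arc. -/
def src (a : I.Arc) : Fin I.n := if a.2 then I.fst a.1 else I.snd a.1

/-- The end vertex of an arc. -/
def tgt (a : I.Arc) : Fin I.n := if a.2 then I.snd a.1 else I.fst a.1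

/-- `v` is reachable from `u` by a directed path all of whose arcs lie in `A`. -/
def Reach (A : Set I.Arc) (u v : Fin I.n) : Prop :=
  Relation.ReflTransGen (fun x y => ∃ a ∈ A, I.src a = x ∧ I.tgt a = y) u v

end PreInst

/-- An instance of the problem. By the last condition, an undirected graph is connected, and in
a directed graph there is a path from the root to every vertex. -/
structure Inst extends PreInst where
  two_le_K : 2 ≤ K
  terminal_injective : Function.Injective terminal
  root_ne_terminal : ∀ k, terminal k ≠ root
  cap_pos : ∀ e, 0 < cap e
  reach_root : ∀ v, toPreInst.Reach {a | toPreInst.IsArc a} root v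

namespace Inst

variable (I : Inst)

/-- The arcs of `A` form a directed tree in the graph, rooted at the root: no arc enters the
root, at most one arc enters any vertex, and all arcs start at vertices that are reachable from
the root inside `A`. -/
def IsTree (A : Finset I.Arc) : Prop :=
  (∀ a ∈ A, I.IsArc a) ∧
  (∀ a ∈ A, I.tgt a ≠ I.root) ∧
  (∀ a ∈ A, ∀ b ∈ A, I.tgt a = I.tgt b → a = b) ∧
  (∀ a ∈ A, I.Reach A I.root (I.src a))

/-- Feasible solutions: rooted trees that span all terminals and such that, for every arc
`(u, v)`, the subtree rooted at `v` contains at most as many terminals as the capacity of the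
arc allows. -/
def IsFeasible (A : Finset I.Arc) : Prop :=
  I.IsTree A ∧
  (∀ k, I.Reach A I.root (I.terminal k)) ∧
  (∀ a ∈ A, Set.ncard {k | I.Reach A (I.tgt a) (I.terminal k)} ≤ I.cap a.1)

/-- The total length of a set of arcs. -/
def length (A : Finset I.Arc) : ℚ≥0 := ∑ a ∈ A, I.len a.1

/-- Feasible solutions of minimum total length. -/
def IsOptimal (A : Finset I.Arc) : Prop :=
  I.IsFeasible A ∧ ∀ B : Finset I.Arc, I.IsFeasible B → I.length A ≤ I.length B

/-- All capacities are equal to one. -/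
def UnitCapacities : Prop := ∀ e, I.cap e = 1

/-- A correct answer: an optimal solution, or the information that there is no feasible
solution. -/
def IsAnswer : Option (Finset I.Arc) → Prop
  | none => ∀ A : Finset I.Arc, ¬ I.IsFeasible A
  | some A => I.IsOptimal A

/-- The encoding of an instance as a word of integers: the type of the graph, the numbers of
vertices, edges and terminals, the root, the terminals, and for each edge its ends, the numerator
and denominator of its length, and its capacity. -/
def encode : List ℤ :=
  [if I.directed then 1 else 0, (I.n : ℤ), (I.m : ℤ), (I.K : ℤ), ((I.root : ℕ) : ℤ)] ++
  (List.finRange I.K).map (fun k => ((I.terminal k : ℕ) : ℤ)) ++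
  (List.finRange I.m).flatMap (fun e =>
    [((I.fst e : ℕ) : ℤ), ((I.snd e : ℕ) : ℤ), ((I.len e).num : ℤ), ((I.len e).den : ℤ),
      (I.cap e : ℤ)])

/-- The encoding of an answer: `0` if there is no solution, and otherwise `1` followed by the
indicator vector of the set of arcs. -/
def encodeAnswer : Option (Finset I.Arc) → List ℤ
  | none => [0]
  | some A => 1 :: (List.finRange I.m).flatMap (fun e =>
      [if (e, true) ∈ A then 1 else 0, if (e, false) ∈ A then 1 else 0])

/-! ### Internally vertex-disjoint paths -/

/-- The list `L` of arcs of the graph is a walk from `u` to `v`. -/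
def IsWalk (u v : Fin I.n) : List I.Arc → Prop
  | [] => u = v
  | a :: L => I.IsArc a ∧ I.src a = u ∧ IsWalk (I.tgt a) v L

/-- The vertices of a walk that starts at the root. -/
def verts (L : List I.Arc) : List (Fin I.n) := I.root :: L.map I.tgt

/-- `P k` is a path (no repeated vertex) from the root to the `k`-th terminal, for each `k`, and
these paths are internally vertex-disjoint: an inner vertex of one of them lies on no other.
As the terminals are distinct, this says that two of them have only the root in common. -/
def IsDisjointPaths (P : Fin I.K → List I.Arc) : Prop :=
  (∀ k, I.IsWalk I.root (I.terminal k) (P k) ∧ (I.verts (P k)).Nodup) ∧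
  (∀ j k, j ≠ k → ∀ v, v ∈ I.verts (P j) → v ∈ I.verts (P k) → v = I.root)

/-- The set of all arcs of a family of paths. -/
def arcsOf (P : Fin I.K → List I.Arc) : Finset I.Arc :=
  Finset.univ.biUnion fun k => (P k).toFinset

end Inst

/-! ### Flows -/

/-- A network: a finite directed graph with source, sink, costs and capacities. -/
structure Network where
  Node : Type
  Edge : Type
  [fintypeEdge : Fintype Edge]
  tail : Edge → Node
  head : Edge → Node
  source : Node
  sink : Node
  cost : Edge → ℚ≥0
  cap : Edge → ℕ

attribute [instance] Network.fintypeEdge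

namespace Network

open Classical in
/-- The flow out of a node. -/
noncomputable def outflow (H : Network) (f : H.Edge → ℕ) (x : H.Node) : ℕ :=
  ∑ e with H.tail e = x, f e

open Classical in
/-- The flow into a node. -/
noncomputable def inflow (H : Network) (f : H.Edge → ℕ) (x : H.Node) : ℕ :=
  ∑ e with H.head e = x, f e

/-- `f` is an (integral) flow of `N` units from the source to the sink. -/
def IsFlow (H : Network) (N : ℕ) (f : H.Edge → ℕ) : Prop :=
  (∀ e, f e ≤ H.cap e) ∧
  (∀ x, x ≠ H.source → x ≠ H.sink → H.inflow f x = H.outflow f x) ∧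
  H.outflow f H.source = H.inflow f H.source + N ∧
  H.inflow f H.sink = H.outflow f H.sink + N

/-- The cost of a flow. -/
def flowCost (H : Network) (f : H.Edge → ℕ) : ℚ≥0 := ∑ e, (f e : ℚ≥0) * H.cost e

/-- `f` is a flow of `N` units of minimum cost. -/
def IsMinCostFlow (H : Network) (N : ℕ) (f : H.Edge → ℕ) : Prop :=
  H.IsFlow N f ∧ ∀ g : H.Edge → ℕ, H.IsFlow N g → H.flowCost f ≤ H.flowCost g

end Network

namespace Inst

variable (I : Inst)

/-- The nodes of the split network: the root `r`, a new sink `s`, and two copies `v'` and `v''` of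
every other vertex `v`. -/
inductive SplitNode where
  | root
  | sink
  | inCopy (v : {v : Fin I.n // v ≠ I.root})
  | outCopy (v : {v : Fin I.n // v ≠ I.root})

/-- The node at which an arc with end vertex `v` enters the split network. -/
def enter (v : Fin I.n) : I.SplitNode := if h : v = I.root then .root else .inCopy ⟨v, h⟩

/-- The node at which an arc with start vertex `v` leaves. -/
def leave (v : Fin I.n) : I.SplitNode := if h : v = I.root then .root else .outCopy ⟨v, h⟩

/-- The arcs of the split network: the arcs of the graph, an arc `(v', v'')` for each vertex `v`
other than the root, and an arc from `t''` to the sink for each terminal `t`. -/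
abbrev SplitEdge :=
  {a : I.Arc // I.IsArc a} ⊕ {v : Fin I.n // v ≠ I.root} ⊕ Fin I.K

open Classical in
/-- The split network. All capacities are one; the arcs of the graph keep their lengths as costs,
and all other costs are zero. -/
noncomputable def splitNetwork : Network where
  Node := I.SplitNode
  Edge := I.SplitEdge
  tail
    | .inl a => I.leave (I.src a.1)
    | .inr (.inl v) => .inCopy v
    | .inr (.inr k) => I.leave (I.terminal k)
  head
    | .inl a => I.enter (I.tgt a.1)
    | .inr (.inl v) => .outCopy v
    | .inr (.inr _) => .sink
  source := .root
  sink := .sink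
  cost
    | .inl a => I.len a.1.1
    | .inr _ => 0
  cap := fun _ => 1

/-- The set of arcs of the graph that carry a positive flow. -/
def flowSupport (f : I.splitNetwork.Edge → ℕ) : Set I.Arc :=
  {a | ∃ h : I.IsArc a, 0 < f (.inl ⟨a, h⟩ : I.SplitEdge)}

end Inst

end CapSteiner

/-!
With unit capacities, the paths of a feasible solution to two different terminals have no arc in
common; as only one arc of a tree enters any vertex, they meet in the root only. So feasible
solutions are, up to superfluous arcs, the same as families of internally disjoint paths from the
root to the terminals (`IsFeasible.exists_disjointPaths`, `IsDisjointPaths.isFeasible`). The arc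
sets of such families are described locally by `IsLinkage`. Conversely,
`IsTraceable.exists_disjointPaths` finds disjoint paths inside any arc set that satisfies weaker
local conditions, by going backwards from the terminals: a vertex other than the root is left at
most once, so this never returns to an earlier vertex, and cycles in the arc set are not touched.
Both the support of a flow in the split network and a perfect matching, below, are traceable, and
both arise from every linkage. As lengths are nonnegative, the cycles that are lost do no harm,
and this gives the claims on flows.

The algorithm does not work on the split network but on an equivalent assignment problem. A column
stands for the copy `v'` and a row for the copy `v''` of a vertex `v`; terminals have no row, the
root has no column, and the row of the root may be used any number of times. An arc `(u, v)` joins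
the row `u` to the column `v`, and every vertex `v` that is neither the root nor a terminal has an
edge of cost `0` between its two copies, which is used if no path passes through `v`. All columns
have to be assigned. The program starts with the edges of cost `0`, and then assigns an edge to
one terminal after the other by the Hungarian method: it grows an alternating tree of tight edges
from the column of the terminal (`Prog.growStep`), adjusting the potentials, until the tree
contains the root (`Prog.augment`) or cannot grow. In the latter case no perfect assignment
exists, by counting (`Assignment.IsTree.not_isPerfect`). In the end, weak duality proves
optimality (`Assignment.IsMatching.sum_len_le`). Rational lengths are multiplied by the product of
all denominators beforehand.

The cost is bounded separately from the correctness. The predicate `wp X p σ Q` says that `p`,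
started in `σ`, reaches a memory with property `Q` and that every loop on the way makes at most
`X` iterations. The program is `tame`: it never writes to the input array, and in every product
that it stores one factor is an input cell. So each step lengthens the numbers in the memory by at
most a constant times the length of the longest input number, the number of steps is a polynomial
in `X` given by the shape of the program, and `exec_of_wp` concludes that the logarithmic cost is
polynomial.
-/

namespace CapSteiner

/-! ### Bit lengths and the cost of expressions -/

theorem one_le_bits (z : ℤ) : 1 ≤ bits z := by simp [bits]

theorem bits_le_iff {z : ℤ} {k : ℕ} : bits z ≤ k + 1 ↔ z.natAbs < 2 ^ k := by
  simp [bits, Nat.size_le]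

theorem natAbs_lt_two_pow_bits (z : ℤ) : z.natAbs < 2 ^ (bits z - 1) := by
  simpa [bits] using Nat.lt_size_self z.natAbs

theorem bits_add_le (x y : ℤ) : bits (x + y) ≤ max (bits x) (bits y) + 1 := by
  have hx := natAbs_lt_two_pow_bits x
  have hy := natAbs_lt_two_pow_bits y
  obtain ⟨k, hk⟩ : ∃ k, max (bits x) (bits y) = k + 1 :=
    ⟨max (bits x) (bits y) - 1, by have := one_le_bits x; omega⟩
  rw [hk, bits_le_iff]
  have hx' : x.natAbs < 2 ^ k := hx.trans_le (Nat.pow_le_pow_right (by omega) (by omega))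
  have hy' : y.natAbs < 2 ^ k := hy.trans_le (Nat.pow_le_pow_right (by omega) (by omega))
  have := Int.natAbs_add_le x y
  rw [pow_succ]
  omega

theorem bits_neg (x : ℤ) : bits (-x) = bits x := by simp [bits]

theorem bits_sub_le (x y : ℤ) : bits (x - y) ≤ max (bits x) (bits y) + 1 := by
  simpa [sub_eq_add_neg, bits_neg] using bits_add_le x (-y)

theorem bits_mul_le (x y : ℤ) : bits (x * y) ≤ bits x + bits y := by
  have hx := natAbs_lt_two_pow_bits x
  have hy := natAbs_lt_two_pow_bits y
  have h1 := one_le_bits x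
  have h2 := one_le_bits y
  have : bits (x * y) ≤ (bits x - 1 + (bits y - 1)) + 1 := by
    rw [bits_le_iff, Int.natAbs_mul, pow_add]
    exact Nat.mul_lt_mul'' hx hy
  omega

namespace Expr

/-- The weight of an expression: the number of its inner nodes plus the bit lengths of its
constants. -/
def weight : Expr → ℕ
  | .const z => bits z
  | .get _ i => i.weight + 1
  | .add x y => x.weight + y.weight + 1
  | .sub x y => x.weight + y.weight + 1
  | .mul x y => x.weight + y.weight + 1

/-- The expressions in which one factor of every product is a cell of the array `0`. As long as
that array is not written to, storing the value of such an expression lengthens the numbers in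
the memory by a bounded amount only. -/
def linear : Expr → Bool
  | .const _ => true
  | .get _ _ => true
  | .add x y => x.linear && y.linear
  | .sub x y => x.linear && y.linear
  | .mul x (.get 0 _) => x.linear
  | .mul _ _ => false

variable {σ : Mem} {M : ℕ}

theorem bits_eval_le (hM : ∀ a i, bits (σ a i) ≤ M) (e : Expr) :
    bits (e.eval σ) ≤ e.weight * M := by
  have hM1 : 1 ≤ M := (one_le_bits _).trans (hM 0 0)
  have comb : ∀ {a b c : ℕ}, c ≤ a * M + b * M → c ≤ (a + b + 1) * M := fun h => by nlinarith
  induction e with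
  | const z => exact Nat.le_mul_of_pos_right _ hM1
  | get a i ih => exact (hM _ _).trans (Nat.le_mul_of_pos_left _ (Nat.succ_pos _))
  | add x y hx hy =>
    have h1 := one_le_bits (x.eval σ)
    have h2 := one_le_bits (y.eval σ)
    have := bits_add_le (x.eval σ) (y.eval σ)
    exact comb (this.trans (by omega))
  | sub x y hx hy =>
    have h1 := one_le_bits (x.eval σ)
    have h2 := one_le_bits (y.eval σ)
    have := bits_sub_le (x.eval σ) (y.eval σ)
    exact comb (this.trans (by omega))
  | mul x y hx hy => exact comb ((bits_mul_le _ _).trans (by omega))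

theorem cost_le (hM : ∀ a i, bits (σ a i) ≤ M) (e : Expr) :
    e.cost σ ≤ e.weight ^ 2 * M := by
  have hM1 : 1 ≤ M := (one_le_bits _).trans (hM 0 0)
  have comb : ∀ {a b p q r : ℕ}, p ≤ a ^ 2 * M → q ≤ b ^ 2 * M → r ≤ (a + b + 1) * M →
      p + q + r ≤ (a + b + 1) ^ 2 * M := fun {a b p q r} hp hq hr => by
    have : (a ^ 2 + b ^ 2 + (a + b + 1)) * M ≤ (a + b + 1) ^ 2 * M :=
      Nat.mul_le_mul_right _ (by nlinarith)
    nlinarith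
  induction e with
  | const z =>
    have := one_le_bits z
    simp only [cost, weight]
    nlinarith [Nat.mul_le_mul (Nat.mul_le_mul this le_rfl : 1 * bits z ≤ bits z * bits z) hM1]
  | get a i ih =>
    have := hM a (i.eval σ)
    have e1 : (i.weight + 1) ^ 2 * M = i.weight ^ 2 * M + 2 * (i.weight * M) + M := by ring
    simp only [cost, weight]
    omega
  | add x y hx hy => exact comb hx hy (bits_eval_le hM (.add x y))
  | sub x y hx hy => exact comb hx hy (bits_eval_le hM (.sub x y))
  | mul x y hx hy => exact comb hx hy (bits_eval_le hM (.mul x y))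

theorem bits_eval_le_of_linear {N : ℕ} (hM : ∀ a i, bits (σ a i) ≤ M)
    (hN : ∀ i, bits (σ 0 i) ≤ N) :
    ∀ e : Expr, e.linear = true → bits (e.eval σ) ≤ M + e.weight * N
  | .const z, _ => by
    have hN1 : 1 ≤ N := (one_le_bits _).trans (hN 0)
    exact (Nat.le_mul_of_pos_right _ hN1).trans (Nat.le_add_left _ _)
  | .get a i, _ => (hM _ _).trans (Nat.le_add_right _ _)
  | .add x y, h => by
    have hN1 : 1 ≤ N := (one_le_bits _).trans (hN 0)
    simp only [linear, Bool.and_eq_true] at h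
    have hx := bits_eval_le_of_linear hM hN x h.1
    have hy := bits_eval_le_of_linear hM hN y h.2
    have := bits_add_le (x.eval σ) (y.eval σ)
    have e1 : (x.weight + y.weight + 1) * N = x.weight * N + y.weight * N + N := by ring
    simp only [eval, weight]
    omega
  | .sub x y, h => by
    have hN1 : 1 ≤ N := (one_le_bits _).trans (hN 0)
    simp only [linear, Bool.and_eq_true] at h
    have hx := bits_eval_le_of_linear hM hN x h.1
    have hy := bits_eval_le_of_linear hM hN y h.2
    have := bits_sub_le (x.eval σ) (y.eval σ)
    have e1 : (x.weight + y.weight + 1) * N = x.weight * N + y.weight * N + N := by ring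
    simp only [eval, weight]
    omega
  | .mul x (.get 0 i), h => by
    have hx := bits_eval_le_of_linear hM hN x h
    have := bits_mul_le (x.eval σ) (σ 0 (i.eval σ))
    have h0 := hN (i.eval σ)
    simp only [eval, weight]
    have e1 : (x.weight + (i.weight + 1) + 1) * N = x.weight * N + i.weight * N + N + N := by ring
    omega

end Expr

/-! ### A weakest-precondition calculus that bounds the cost -/

/-- The weakest precondition of a loop that makes at most `k` iterations, given the weakest
precondition `body` of its body. -/
def loopWp (e : Expr) (body : Mem → (Mem → Prop) → Prop) : ℕ → Mem → (Mem → Prop) → Prop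
  | 0, σ, Q => ¬ 0 < e.eval σ ∧ Q σ
  | k + 1, σ, Q => (¬ 0 < e.eval σ → Q σ) ∧
      (0 < e.eval σ → body σ fun τ => loopWp e body k τ Q)

/-- `wp X p σ Q`: started in `σ`, the program `p` halts in a memory with property `Q`, and every
execution of a loop on the way makes at most `X` iterations. -/
def wp (X : ℕ) : Prog → Mem → (Mem → Prop) → Prop
  | .skip => fun σ Q => Q σ
  | .set a i e => fun σ Q => Q (σ.store a (i.eval σ) (e.eval σ))
  | .seq p q => fun σ Q => wp X p σ fun τ => wp X q τ Q
  | .cond e p q => fun σ Q => (0 < e.eval σ → wp X p σ Q) ∧ (¬ 0 < e.eval σ → wp X q σ Q)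
  | .loop e p => fun σ Q => loopWp e (wp X p) X σ Q

theorem wp_mono {X : ℕ} {p : Prog} {σ : Mem} {Q R : Mem → Prop} (h : wp X p σ Q)
    (hQR : ∀ τ, Q τ → R τ) : wp X p σ R := by
  induction p generalizing σ Q R with
  | skip => exact hQR _ h
  | set a i e => exact hQR _ h
  | seq p q hp hq => exact hp h fun τ hτ => hq hτ hQR
  | cond e p q hp hq => exact ⟨fun he => hp (h.1 he) hQR, fun he => hq (h.2 he) hQR⟩
  | loop e p hp =>
    have : ∀ k σ, loopWp e (wp X p) k σ Q → loopWp e (wp X p) k σ R := by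
      intro k
      induction k with
      | zero => exact fun σ h => ⟨h.1, hQR _ h.2⟩
      | succ k ih => exact fun σ h => ⟨fun he => hQR _ (h.1 he), fun he => hp (h.2 he) ih⟩
    exact this X σ h

theorem wp_seq {X : ℕ} {p q : Prog} {σ : Mem} {Q R : Mem → Prop} (h : wp X p σ R)
    (hR : ∀ τ, R τ → wp X q τ Q) : wp X (.seq p q) σ Q := by
  show wp X p σ fun _ => _
  exact wp_mono h hR

/-- As `wp` requires termination, no program guarantees an impossible outcome. For this reason a
loop whose measure has reached `0` must have stopped. -/
theorem not_wp_false {X : ℕ} (p : Prog) (σ : Mem) : ¬ wp X p σ fun _ => False := by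
  induction p generalizing σ with
  | skip => exact fun h => h
  | set a i e => exact fun h => h
  | seq p q hp hq => exact fun h => hp σ (wp_mono h fun τ hτ => hq τ hτ)
  | cond e p q hp hq =>
    intro h
    by_cases he : 0 < e.eval σ
    · exact hp σ (h.1 he)
    · exact hq σ (h.2 he)
  | loop e p hp =>
    have : ∀ k σ, ¬ loopWp e (wp X p) k σ fun _ => False := by
      intro k
      induction k with
      | zero => exact fun σ h => h.2
      | succ k ih =>
        intro σ h
        by_cases he : 0 < e.eval σ
        · exact hp σ (wp_mono (h.2 he) ih)
        · exact h.1 he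
    exact this X σ

/-- The rule for loops: the invariant carries a bound on the number of iterations to come. -/
theorem wp_loop {X : ℕ} {e : Expr} {p : Prog} {σ : Mem} {Q : Mem → Prop}
    (Inv : ℕ → Mem → Prop) (k : ℕ) (hk : k ≤ X) (h0 : Inv k σ)
    (step : ∀ j τ, Inv j τ → 0 < e.eval τ → wp X p τ fun τ' => ∃ i < j, Inv i τ')
    (post : ∀ j τ, Inv j τ → ¬ 0 < e.eval τ → Q τ) : wp X (.loop e p) σ Q := by
  have : ∀ l σ, (∃ j ≤ l, Inv j σ) → loopWp e (wp X p) l σ Q := by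
    intro l
    induction l with
    | zero =>
      rintro σ ⟨j, hj, h⟩
      have he : ¬ 0 < e.eval σ := fun he => by
        exact not_wp_false p σ (wp_mono (step j σ h he) fun τ ⟨i, hi, _⟩ => by omega)
      exact ⟨he, post j σ h he⟩
    | succ l ih =>
      rintro σ ⟨j, hj, h⟩
      exact ⟨fun he => post j σ h he, fun he => wp_mono (step j σ h he) fun τ ⟨i, hi, hτ⟩ =>
        ih τ ⟨i, by omega, hτ⟩⟩
  exact this X σ ⟨k, hk, h0⟩

namespace Prog

/-- The loop `for v = 0, …, b - 1`, where the variable `v` is cell `0` of the array `v`. -/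
def forLoop (v : ℕ) (b : Expr) (p : Prog) : Prog :=
  .seq (.set v (.const 0) (.const 0))
    (.loop (.sub b (.get v (.const 0)))
      (.seq p (.set v (.const 0) (.add (.get v (.const 0)) (.const 1)))))

/-- The total weight of the expressions of a program. -/
def weight : Prog → ℕ
  | .skip => 0
  | .set _ i e => i.weight + e.weight
  | .seq p q => p.weight + q.weight
  | .cond e p q => e.weight + p.weight + q.weight
  | .loop e p => e.weight + p.weight

/-- The program does not write to array `0`, and all expressions that it stores are linear. -/
def tame : Prog → Bool
  | .skip => true
  | .set a _ e => a != 0 && e.linear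
  | .seq p q => p.tame && q.tame
  | .cond _ p q => p.tame && q.tame
  | .loop _ p => p.tame

/-- A bound for the number of steps of a program, as a polynomial in a bound for the numbers of
iterations of its loops. -/
noncomputable def steps : Prog → Polynomial ℕ
  | .skip => 1
  | .set _ _ _ => 1
  | .seq p q => p.steps + q.steps + 1
  | .cond _ p q => p.steps + q.steps + 1
  | .loop _ p => Polynomial.X * (p.steps + 1) + 1

end Prog

/-- The rule for counting loops: `Inv k` holds when the counter has been set to `k`. -/
theorem wp_forLoop {X : ℕ} {v : ℕ} {b : Expr} {p : Prog} {σ : Mem} {Q : Mem → Prop}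
    (Inv : ℕ → Mem → Prop) (n : ℕ) (hn : n ≤ X) (h0 : Inv 0 (σ.store v 0 0))
    (bound : ∀ k τ, k ≤ n → Inv k τ → b.eval τ = n)
    (step : ∀ k τ, k < n → Inv k τ → τ v 0 = k →
      wp X p τ fun τ' => τ' v 0 = k ∧ Inv (k + 1) (τ'.store v 0 ((k : ℤ) + 1)))
    (post : ∀ τ, Inv n τ → Q τ) : wp X (.forLoop v b p) σ Q := by
  refine wp_loop (fun j τ => ∃ k, k + j = n ∧ τ v 0 = k ∧ Inv k τ) n hn
    ⟨0, by simp, by simp [Mem.store, Expr.eval], h0⟩ ?_ ?_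
  · rintro j τ ⟨k, hk, hv, hI⟩ he
    simp only [Expr.eval, bound k τ (by omega) hI, hv] at he
    show wp X p τ fun _ => _
    refine wp_mono (step k τ (by omega) hI hv) fun τ' ⟨h1, h2⟩ => ?_
    refine ⟨j - 1, by omega, k + 1, by omega, ?_, ?_⟩
    · simp [Mem.store, Expr.eval, h1]
    · simpa [Expr.eval, h1] using h2
  · rintro j τ ⟨k, hk, hv, hI⟩ he
    simp only [Expr.eval, bound k τ (by omega) hI, hv] at he
    obtain rfl : k = n := by omega
    exact post τ hI

/-- The soundness of the calculus, with the cost: in each of the at most `p.steps` steps, the bit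
lengths of the numbers in the memory grow by at most `W * N`, so all of them remain below `B`, and
a step costs at most a constant times `B`. -/
theorem exec_of_wp {X N W B : ℕ} (p : Prog) (htame : p.tame = true) (hW : p.weight ≤ W)
    {M : ℕ} {σ : Mem} {Q : Mem → Prop}
    (hN : ∀ i, bits (σ 0 i) ≤ N) (hM : ∀ a i, bits (σ a i) ≤ M)
    (hB : M + W * N * p.steps.eval X ≤ B) (h : wp X p σ Q) :
    ∃ t τ, Exec p σ t τ ∧ Q τ ∧ τ 0 = σ 0 ∧
      (∀ a i, bits (τ a i) ≤ M + W * N * p.steps.eval X) ∧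
      t ≤ p.steps.eval X * ((2 * W ^ 2 + 1) * B) := by
  have hN1 : 1 ≤ N := (one_le_bits _).trans (hN 0)
  have expr_cost : ∀ (e : Expr) {M : ℕ} {σ : Mem}, (∀ a i, bits (σ a i) ≤ M) → M ≤ B →
      e.weight ≤ W → e.cost σ ≤ W ^ 2 * B := fun e M σ hM hMB he =>
    (e.cost_le hM).trans (Nat.mul_le_mul (Nat.pow_le_pow_left he 2) hMB)
  have hB1 : 1 ≤ B := by have := (one_le_bits _).trans (hM 0 0); omega
  have eC : (2 * W ^ 2 + 1) * B = 2 * (W ^ 2 * B) + B := by ring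
  induction p generalizing M σ Q with
  | skip =>
    refine ⟨1, σ, .skip σ, h, rfl, fun a i => (hM a i).trans (Nat.le_add_right _ _), ?_⟩
    simp only [Prog.steps, Polynomial.eval_one, one_mul]
    omega
  | set a i e =>
    simp only [Prog.tame, Bool.and_eq_true, bne_iff_ne, ne_eq] at htame
    simp only [Prog.weight] at hW
    simp only [Prog.steps, Polynomial.eval_one, mul_one, one_mul] at hB ⊢
    have hMB : M ≤ B := by omega
    refine ⟨_, _, .set σ a i e, h, ?_, fun b j => ?_, ?_⟩
    · simp [Mem.store, Function.update_of_ne (Ne.symm htame.1)]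
    · have h1 := e.bits_eval_le_of_linear hM hN htame.2
      have h2 : e.weight * N ≤ W * N := Nat.mul_le_mul_right _ (by omega)
      have h3 := hM b j
      unfold Mem.store
      by_cases hb : b = a
      · subst hb
        rw [Function.update_self]
        by_cases hj : j = i.eval σ
        · subst hj
          rw [Function.update_self]
          omega
        · rw [Function.update_of_ne hj]
          omega
      · rw [Function.update_of_ne hb]
        omega
    · have h1 := expr_cost i hM hMB (by omega)
      have h2 := expr_cost e hM hMB (by omega)
      omega
  | seq p q hp hq =>
    simp only [Prog.tame, Bool.and_eq_true] at htame
    simp only [Prog.weight] at hW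
    simp only [Prog.steps, Polynomial.eval_add, Polynomial.eval_one] at hB ⊢
    set tp := p.steps.eval X
    set tq := q.steps.eval X
    have e1 : W * N * (tp + tq + 1) = W * N * tp + W * N * tq + W * N := by ring
    obtain ⟨s, τ, he, hτ, h0, hMτ, hs⟩ := hp htame.1 (by omega) hN hM (by omega) h
    obtain ⟨t, ρ, he', hρ, h0', hMρ, ht⟩ := hq htame.2 (by omega) (by simpa [h0] using hN) hMτ
      (by omega) hτ
    refine ⟨_, _, .seq he he', hρ, h0'.trans h0, fun a i => (hMρ a i).trans (by omega), ?_⟩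
    have e2 : ∀ C : ℕ, (tp + tq + 1) * C = tp * C + tq * C + C := fun C => by ring
    rw [e2]
    omega
  | cond e p q hp hq =>
    simp only [Prog.tame, Bool.and_eq_true] at htame
    simp only [Prog.weight] at hW
    simp only [Prog.steps, Polynomial.eval_add, Polynomial.eval_one] at hB ⊢
    set tp := p.steps.eval X
    set tq := q.steps.eval X
    have e1 : W * N * (tp + tq + 1) = W * N * tp + W * N * tq + W * N := by ring
    have e2 : ∀ C : ℕ, (tp + tq + 1) * C = tp * C + tq * C + C := fun C => by ring
    have hc := expr_cost e hM (by omega) (by omega)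
    rw [e2]
    by_cases hpos : 0 < e.eval σ
    · obtain ⟨s, τ, he, hτ, h0, hMτ, hs⟩ := hp htame.1 (by omega) hN hM (by omega) (h.1 hpos)
      exact ⟨_, _, .cond_pos hpos he, hτ, h0, fun a i => (hMτ a i).trans (by omega), by omega⟩
    · obtain ⟨s, τ, he, hτ, h0, hMτ, hs⟩ := hq htame.2 (by omega) hN hM (by omega) (h.2 hpos)
      exact ⟨_, _, .cond_neg hpos he, hτ, h0, fun a i => (hMτ a i).trans (by omega), by omega⟩
  | loop e p hp =>
    simp only [Prog.tame] at htame
    simp only [Prog.weight] at hW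
    simp only [Prog.steps, Polynomial.eval_add, Polynomial.eval_one, Polynomial.eval_mul,
      Polynomial.eval_X] at hB ⊢
    set tp := p.steps.eval X
    have main : ∀ (k : ℕ) {M : ℕ} {σ : Mem}, (∀ i, bits (σ 0 i) ≤ N) →
        (∀ a i, bits (σ a i) ≤ M) → M + W * N * (k * (tp + 1) + 1) ≤ B →
        loopWp e (wp X p) k σ Q → ∃ t τ, Exec (.loop e p) σ t τ ∧ Q τ ∧ τ 0 = σ 0 ∧
          (∀ a i, bits (τ a i) ≤ M + W * N * (k * (tp + 1) + 1)) ∧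
          t ≤ (k * (tp + 1) + 1) * ((2 * W ^ 2 + 1) * B) := by
      intro k
      induction k with
      | zero =>
        intro M σ hN hM hB h
        have hc := expr_cost e hM (by omega) (by omega)
        exact ⟨_, σ, Exec.loop_stop h.1, h.2, rfl, fun a i => (hM a i).trans (by omega), by
          simp only [zero_mul, zero_add, one_mul]; omega⟩
      | succ k ih =>
        intro M σ hN hM hB h
        have hc := expr_cost e hM (by omega) (by omega)
        have e1 : W * N * ((k + 1) * (tp + 1) + 1) =
          W * N * tp + W * N * (k * (tp + 1) + 1) + W * N := by ring
        have e2 : ∀ C : ℕ, ((k + 1) * (tp + 1) + 1) * C =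
          tp * C + (k * (tp + 1) + 1) * C + C := fun C => by ring
        rw [e2]
        by_cases hpos : 0 < e.eval σ
        · obtain ⟨s, τ, he, hτ, h0, hMτ, hs⟩ := hp htame (by omega) hN hM (by omega) (h.2 hpos)
          obtain ⟨t, ρ, he', hρ, h0', hMρ, ht⟩ := ih (by simpa [h0] using hN) hMτ (by omega) hτ
          exact ⟨_, _, .loop_step hpos he he', hρ, h0'.trans h0,
            fun a i => (hMρ a i).trans (by omega), by omega⟩
        · exact ⟨_, σ, Exec.loop_stop hpos, h.1 hpos, rfl, fun a i => (hM a i).trans (by omega), by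
            omega⟩
    exact main X hN hM hB h

namespace Inst

variable {I : Inst}

/-! ### Walks and paths -/

theorem IsWalk.isArc {u v : Fin I.n} {L : List I.Arc} (h : I.IsWalk u v L) {a : I.Arc}
    (ha : a ∈ L) : I.IsArc a := by
  induction L generalizing u with
  | nil => simp at ha
  | cons b L ih =>
    rcases List.mem_cons.1 ha with rfl | ha
    · exact h.1
    · exact ih h.2.2 ha

theorem IsWalk.cons_map_tgt {u v : Fin I.n} {L : List I.Arc} (h : I.IsWalk u v L) :
    u :: L.map I.tgt = L.map I.src ++ [v] := by
  induction L generalizing u with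
  | nil =>
    obtain rfl : u = v := h
    rfl
  | cons a L ih => simp [h.2.1, ih h.2.2]

theorem IsWalk.exists_suffix {u v w : Fin I.n} {L : List I.Arc} (h : I.IsWalk u v L)
    (hw : w ∈ u :: L.map I.tgt) :
    ∃ L', I.IsWalk w v L' ∧ L' <:+ L ∧ (w :: L'.map I.tgt) <:+ (u :: L.map I.tgt) := by
  induction L generalizing u with
  | nil =>
    obtain rfl : w = u := by simpa using hw
    exact ⟨[], h, List.suffix_rfl, List.suffix_rfl⟩
  | cons a L ih =>
    rcases List.mem_cons.1 hw with rfl | hw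
    · exact ⟨a :: L, h, List.suffix_rfl, List.suffix_rfl⟩
    · obtain ⟨L', h1, h2, h3⟩ := ih h.2.2 (by simpa using hw)
      exact ⟨L', h1, h2.trans (List.suffix_cons _ _), h3.trans (List.suffix_cons _ _)⟩

theorem IsWalk.reach {A : Set I.Arc} {u v : Fin I.n} {L : List I.Arc} (h : I.IsWalk u v L)
    (hA : ∀ a ∈ L, a ∈ A) : I.Reach A u v := by
  induction L generalizing u with
  | nil =>
    obtain rfl : u = v := h
    exact .refl
  | cons a L ih =>
    exact .head ⟨a, hA a (by simp), h.2.1, rfl⟩ (ih h.2.2 fun b hb => hA b (by simp [hb]))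

theorem IsWalk.reach_of_mem {A : Set I.Arc} {u v w : Fin I.n} {L : List I.Arc}
    (h : I.IsWalk u v L) (hA : ∀ a ∈ L, a ∈ A) (hw : w ∈ u :: L.map I.tgt) :
    I.Reach A u w := by
  induction L generalizing u with
  | nil =>
    obtain rfl : w = u := by simpa using hw
    exact .refl
  | cons a L ih =>
    rcases List.mem_cons.1 hw with rfl | hw
    · exact .refl
    · exact .head ⟨a, hA a (by simp), h.2.1, rfl⟩
        (ih h.2.2 (fun b hb => hA b (by simp [hb])) (by simpa using hw))

theorem exists_path_of_reach {A : Set I.Arc} (hA : ∀ a ∈ A, I.IsArc a) {u v : Fin I.n}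
    (h : I.Reach A u v) :
    ∃ L, I.IsWalk u v L ∧ (∀ a ∈ L, a ∈ A) ∧ (u :: L.map I.tgt).Nodup := by
  induction h using Relation.ReflTransGen.head_induction_on with
  | refl => exact ⟨[], rfl, by simp, by simp⟩
  | head hab _ ih =>
    rename_i x y
    obtain ⟨a, ha, rfl, rfl⟩ := hab
    obtain ⟨L, h1, h2, h3⟩ := ih
    by_cases hx : I.src a ∈ I.tgt a :: L.map I.tgt
    · obtain ⟨L', h1', h2', h3'⟩ := h1.exists_suffix hx
      exact ⟨L', h1', fun b hb => h2 b (h2'.subset hb), h3.sublist h3'.sublist⟩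
    · exact ⟨a :: L, ⟨hA a ha, rfl, h1⟩, by simpa [ha] using h2,
        by simpa using And.intro (by simpa using hx) (by simpa using h3)⟩

/-! ### Linkages -/

/-- The arc sets of families of disjoint paths, described locally: no arc enters the root or
leaves a terminal, every vertex other than the root has at most one entering and at most one
leaving arc, terminals are entered, and other vertices are entered if and only if they are left.
Up to cycles, these are the arc sets that carry a flow in the split network, and also the
perfect matchings between the two sets of copies of the vertices. -/
structure IsLinkage (I : Inst) (A : Finset I.Arc) : Prop where
  isArc : ∀ a ∈ A, I.IsArc a
  tgt_ne : ∀ a ∈ A, I.tgt a ≠ I.root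
  src_ne : ∀ a ∈ A, ∀ k, I.src a ≠ I.terminal k
  in_unique : ∀ a ∈ A, ∀ b ∈ A, I.tgt a = I.tgt b → a = b
  out_unique : ∀ a ∈ A, ∀ b ∈ A, I.src a = I.src b → I.src a ≠ I.root → a = b
  terminal_entered : ∀ k, ∃ a ∈ A, I.tgt a = I.terminal k
  entered_iff_left : ∀ v, v ≠ I.root → (∀ k, v ≠ I.terminal k) →
    ((∃ a ∈ A, I.tgt a = v) ↔ ∃ a ∈ A, I.src a = v)

/-- Arc sets from which disjoint paths to the terminals can be read off by going backwards from
the terminals. -/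
structure IsTraceable (I : Inst) (F : Set I.Arc) : Prop where
  isArc : ∀ a ∈ F, I.IsArc a
  src_ne : ∀ a ∈ F, ∀ k, I.src a ≠ I.terminal k
  out_unique : ∀ a ∈ F, ∀ b ∈ F, I.src a = I.src b → I.src a ≠ I.root → a = b
  terminal_entered : ∀ k, ∃ a ∈ F, I.tgt a = I.terminal k
  src_entered : ∀ a ∈ F, I.src a ≠ I.root → ∃ b ∈ F, I.tgt b = I.src a

/-- Going backwards inside a traceable set never returns to an earlier vertex, since a vertex
other than the root is left only once; so the root is reached eventually. -/
theorem IsTraceable.exists_path {F : Set I.Arc} (hF : I.IsTraceable F) (k : Fin I.K) :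
    ∃ L, I.IsWalk I.root (I.terminal k) L ∧ (I.verts L).Nodup ∧ ∀ a ∈ L, a ∈ F := by
  have main : ∀ (d : ℕ) (v : Fin I.n) (L : List I.Arc), I.n ≤ L.length + d →
      I.IsWalk v (I.terminal k) L → (v :: L.map I.tgt).Nodup → I.root ∉ L.map I.tgt →
      (∀ a ∈ L, a ∈ F) → (v ≠ I.root → ∃ b ∈ F, I.tgt b = v) →
      ∃ L, I.IsWalk I.root (I.terminal k) L ∧ (I.verts L).Nodup ∧ ∀ a ∈ L, a ∈ F := by
    intro d
    induction d with
    | zero =>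
      intro v L hd _ hn
      have := hn.length_le_card
      simp at this
      omega
    | succ d ih =>
      intro v L hd hL hn hr hLF hv
      by_cases hvr : v = I.root
      · subst hvr
        exact ⟨L, hL, hn, hLF⟩
      obtain ⟨b, hb, rfl⟩ := hv hvr
      have hnew : I.src b ∉ I.tgt b :: L.map I.tgt := by
        intro hmem
        have hsr : I.src b ≠ I.root := by
          rintro h
          rw [h] at hmem
          rcases List.mem_cons.1 hmem with h | h
          · exact hvr h.symm
          · exact hr h
        rw [hL.cons_map_tgt] at hmem
        rcases List.mem_append.1 hmem with h | h
        · obtain ⟨c, hc, hcb⟩ := List.mem_map.1 h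
          have : b = c := hF.out_unique b hb c (hLF c hc) hcb.symm hsr
          subst this
          exact (List.nodup_cons.1 hn).1 (List.mem_map_of_mem hc)
        · exact hF.src_ne b hb k (by simpa using h)
      refine ih (I.src b) (b :: L) (by simp; omega) ⟨hF.isArc b hb, rfl, hL⟩ ?_ ?_ ?_
        (hF.src_entered b hb)
      · simpa using And.intro (by simpa using hnew) (by simpa using hn)
      · simpa using And.intro (Ne.symm hvr) (by simpa using hr)
      · simpa [hb] using hLF
  exact main I.n (I.terminal k) [] (by simp) rfl (by simp) (by simp) (by simp)
    fun _ => hF.terminal_entered k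

theorem IsTraceable.walk_unique {F : Set I.Arc} (hF : I.IsTraceable F) {j k : Fin I.K}
    {v : Fin I.n} {L L' : List I.Arc} (hv : v ≠ I.root) (hL : I.IsWalk v (I.terminal j) L)
    (hL' : I.IsWalk v (I.terminal k) L') (h : ∀ a ∈ L, a ∈ F ∧ I.tgt a ≠ I.root)
    (h' : ∀ a ∈ L', a ∈ F) : j = k := by
  induction L generalizing v L' with
  | nil =>
    obtain rfl : v = I.terminal j := hL
    cases L' with
    | nil => exact I.terminal_injective hL'
    | cons b L' => exact absurd hL'.2.1 (hF.src_ne b (h' b (by simp)) j)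
  | cons a L ih =>
    cases L' with
    | nil =>
      obtain rfl : v = I.terminal k := hL'
      exact absurd hL.2.1 (hF.src_ne a (h a (by simp)).1 k)
    | cons b L' =>
      have hab : a = b := hF.out_unique a (h a (by simp)).1 b (h' b (by simp))
        (hL.2.1.trans hL'.2.1.symm) (hL.2.1 ▸ hv)
      subst hab
      exact ih (h a (by simp)).2 hL.2.2 hL'.2.2 (fun c hc => h c (by simp [hc]))
        fun c hc => h' c (by simp [hc])

theorem IsTraceable.exists_disjointPaths {F : Set I.Arc} (hF : I.IsTraceable F) :
    ∃ P, I.IsDisjointPaths P ∧ ∀ k, ∀ a ∈ P k, a ∈ F := by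
  choose P hP hn hPF using hF.exists_path
  refine ⟨P, ⟨fun k => ⟨hP k, hn k⟩, fun j k hjk v hj hk => ?_⟩, hPF⟩
  by_contra hv
  obtain ⟨L, h1, h2, -⟩ := (hP j).exists_suffix hj
  obtain ⟨L', h1', h2', -⟩ := (hP k).exists_suffix hk
  refine hjk (hF.walk_unique hv h1 h1' (fun a ha => ⟨hPF j a (h2.subset ha), fun h => ?_⟩)
    fun a ha => hPF k a (h2'.subset ha))
  exact (List.nodup_cons.1 (hn j)).1 (h ▸ List.mem_map_of_mem (h2.subset ha))

/-! ### Feasible solutions and disjoint paths -/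

theorem mem_arcsOf {P : Fin I.K → List I.Arc} {a : I.Arc} :
    a ∈ I.arcsOf P ↔ ∃ k, a ∈ P k := by simp [arcsOf]

/-- In a feasible solution, the paths to two terminals share the root only: the capacity of an
arc in both of them would be exceeded. -/
theorem IsFeasible.exists_disjointPaths (hI : I.UnitCapacities) {A : Finset I.Arc}
    (hA : I.IsFeasible A) : ∃ P, I.IsDisjointPaths P ∧ I.arcsOf P ⊆ A := by
  choose P hP hPA hn using fun k => exists_path_of_reach (A := (A : Set I.Arc))
    (fun a ha => hA.1.1 a ha) (hA.2.1 k)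
  refine ⟨P, ⟨fun k => ⟨hP k, hn k⟩, fun j k hjk v hj hk => ?_⟩, fun a ha => ?_⟩
  · by_contra hv
    obtain ⟨a, ha, rfl⟩ : ∃ a ∈ P j, I.tgt a = v := by simpa [verts, hv] using hj
    obtain ⟨L, h1, h2, -⟩ := (hP j).exists_suffix hj
    obtain ⟨L', h1', h2', -⟩ := (hP k).exists_suffix hk
    have hcap := hA.2.2 a (hPA j a ha)
    rw [hI, Set.ncard_le_one (Set.toFinite _)] at hcap
    exact hjk (hcap j (h1.reach fun a ha => hPA j a (h2.subset ha)) k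
      (h1'.reach fun a ha => hPA k a (h2'.subset ha)))
  · obtain ⟨k, hk⟩ := mem_arcsOf.1 ha
    exact hPA k a hk

theorem tgt_mem_verts {L : List I.Arc} {a : I.Arc} (ha : a ∈ L) : I.tgt a ∈ I.verts L :=
  List.mem_cons_of_mem _ (List.mem_map_of_mem ha)

namespace IsDisjointPaths

variable {P : Fin I.K → List I.Arc} (hP : I.IsDisjointPaths P)
include hP

theorem verts_eq (k : Fin I.K) : I.verts (P k) = (P k).map I.src ++ [I.terminal k] :=
  (hP.1 k).1.cons_map_tgt

theorem src_mem {k : Fin I.K} {a : I.Arc} (ha : a ∈ P k) : I.src a ∈ I.verts (P k) := by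
  rw [hP.verts_eq]
  exact List.mem_append_left _ (List.mem_map_of_mem ha)

theorem terminal_mem (k : Fin I.K) : I.terminal k ∈ I.verts (P k) := by
  simp [hP.verts_eq]

theorem eq_of_mem_verts {j k : Fin I.K} {v : Fin I.n} (hj : v ∈ I.verts (P j))
    (hk : v ∈ I.verts (P k)) (hv : v ≠ I.root) : j = k := by
  by_contra h
  exact hv (hP.2 j k h v hj hk)

theorem isLinkage : I.IsLinkage (I.arcsOf P) := by
  have tgt_ne : ∀ k, ∀ a ∈ P k, I.tgt a ≠ I.root := fun k a ha h =>
    (List.nodup_cons.1 (hP.1 k).2).1 (h ▸ List.mem_map_of_mem ha)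
  have nodup : ∀ k, ((P k).map I.src ++ [I.terminal k]).Nodup := fun k => by
    rw [← hP.verts_eq]
    exact (hP.1 k).2
  constructor
  · intro a ha
    obtain ⟨k, hk⟩ := mem_arcsOf.1 ha
    exact (hP.1 k).1.isArc hk
  · intro a ha
    obtain ⟨k, hk⟩ := mem_arcsOf.1 ha
    exact tgt_ne k a hk
  · intro a ha j h
    obtain ⟨k, hk⟩ := mem_arcsOf.1 ha
    obtain rfl : j = k := hP.eq_of_mem_verts (hP.terminal_mem j) (h ▸ hP.src_mem hk)
      (I.root_ne_terminal j)
    have := nodup j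
    rw [List.nodup_append] at this
    exact this.2.2 _ (List.mem_map_of_mem hk) _ (List.mem_singleton_self _) h
  · intro a ha b hb h
    obtain ⟨j, hj⟩ := mem_arcsOf.1 ha
    obtain ⟨k, hk⟩ := mem_arcsOf.1 hb
    obtain rfl : j = k := hP.eq_of_mem_verts (tgt_mem_verts hj) (h ▸ tgt_mem_verts hk)
      (tgt_ne j a hj)
    exact List.inj_on_of_nodup_map (List.nodup_cons.1 (hP.1 j).2).2 hj hk h
  · intro a ha b hb h hr
    obtain ⟨j, hj⟩ := mem_arcsOf.1 ha
    obtain ⟨k, hk⟩ := mem_arcsOf.1 hb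
    obtain rfl : j = k := hP.eq_of_mem_verts (hP.src_mem hj) (h ▸ hP.src_mem hk) hr
    exact List.inj_on_of_nodup_map (List.nodup_append.1 (nodup j)).1 hj hk h
  · intro k
    have := hP.terminal_mem k
    obtain ⟨a, ha, h⟩ : ∃ a ∈ P k, I.tgt a = I.terminal k := by
      simpa [verts, I.root_ne_terminal k] using this
    exact ⟨a, mem_arcsOf.2 ⟨k, ha⟩, h⟩
  · intro v hv ht
    constructor
    · rintro ⟨a, ha, rfl⟩
      obtain ⟨k, hk⟩ := mem_arcsOf.1 ha
      have := tgt_mem_verts hk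
      rw [hP.verts_eq] at this
      obtain ⟨b, hb, h⟩ : ∃ b ∈ P k, I.src b = I.tgt a := by simpa [ht k] using this
      exact ⟨b, mem_arcsOf.2 ⟨k, hb⟩, h⟩
    · rintro ⟨a, ha, rfl⟩
      obtain ⟨k, hk⟩ := mem_arcsOf.1 ha
      obtain ⟨b, hb, h⟩ : ∃ b ∈ P k, I.tgt b = I.src a := by
        simpa [verts, hv] using hP.src_mem hk
      exact ⟨b, mem_arcsOf.2 ⟨k, hb⟩, h⟩

theorem isFeasible (hI : I.UnitCapacities) : I.IsFeasible (I.arcsOf P) := by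
  have hL := hP.isLinkage
  have hsub : ∀ k, ∀ a ∈ P k, a ∈ ((I.arcsOf P : Finset I.Arc) : Set I.Arc) := fun k a ha =>
    mem_arcsOf.2 ⟨k, ha⟩
  refine ⟨⟨hL.isArc, hL.tgt_ne, hL.in_unique, fun a ha => ?_⟩,
    fun k => (hP.1 k).1.reach (hsub k), fun a ha => ?_⟩
  · obtain ⟨k, hk⟩ := mem_arcsOf.1 ha
    exact (hP.1 k).1.reach_of_mem (hsub k) (hP.src_mem hk)
  · rw [hI]
    obtain ⟨k, hk⟩ := mem_arcsOf.1 ha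
    -- From an inner vertex of a path, only vertices of the same path can be reached.
    have stay : ∀ w, I.Reach (I.arcsOf P) (I.tgt a) w → w ∈ I.verts (P k) ∧ w ≠ I.root := by
      intro w hw
      induction hw with
      | refl => exact ⟨tgt_mem_verts hk, hL.tgt_ne a ha⟩
      | tail _ hb ih =>
        obtain ⟨b, hb, rfl, rfl⟩ := hb
        refine ⟨?_, hL.tgt_ne b hb⟩
        obtain ⟨j, hj⟩ := mem_arcsOf.1 (Finset.mem_coe.1 hb)
        obtain rfl : j = k := hP.eq_of_mem_verts (hP.src_mem hj) ih.1 ih.2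
        exact tgt_mem_verts hj
    refine (Set.ncard_le_one (Set.toFinite _)).2 fun i hi j hj => ?_
    have hi' := stay _ hi
    have hj' := stay _ hj
    exact (hP.eq_of_mem_verts (hP.terminal_mem i) hi'.1 hi'.2).trans
      (hP.eq_of_mem_verts (hP.terminal_mem j) hj'.1 hj'.2).symm

theorem length_eq :
    I.length (I.arcsOf P) = ∑ k, ((P k).map fun a => I.len a.1).sum := by
  have hL := hP.isLinkage
  rw [length, arcsOf, Finset.sum_biUnion]
  · refine Finset.sum_congr rfl fun k _ => ?_
    exact List.sum_toFinset _ (List.Nodup.of_map _ (List.nodup_cons.1 (hP.1 k).2).2)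
  · intro j _ k _ hjk
    refine Finset.disjoint_left.2 fun a hj hk => hjk ?_
    rw [List.mem_toFinset] at hj hk
    exact hP.eq_of_mem_verts (tgt_mem_verts hj) (tgt_mem_verts hk)
      (hL.tgt_ne a (mem_arcsOf.2 ⟨j, hj⟩))

end IsDisjointPaths

/-- The solutions that consist of disjoint paths suffice for finding an optimum. -/
theorem isOptimal_of_forall_disjointPaths (hI : I.UnitCapacities) {P : Fin I.K → List I.Arc}
    (hP : I.IsDisjointPaths P)
    (h : ∀ P', I.IsDisjointPaths P' → I.length (I.arcsOf P) ≤ I.length (I.arcsOf P')) :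
    I.IsOptimal (I.arcsOf P) := by
  refine ⟨hP.isFeasible hI, fun B hB => ?_⟩
  obtain ⟨P', hP', hsub⟩ := hB.exists_disjointPaths hI
  exact (h P' hP').trans (Finset.sum_le_sum_of_subset hsub)

end Inst

/-! ### Flows in the split network -/

/-- If the flow is conserved at all inner nodes, the balance at the source follows from that at
the sink. -/
theorem Network.outflow_source (H : Network) {N : ℕ} {f : H.Edge → ℕ}
    (hne : H.source ≠ H.sink)
    (h : ∀ x, x ≠ H.source → x ≠ H.sink → H.inflow f x = H.outflow f x)
    (hs : H.inflow f H.sink = H.outflow f H.sink + N) :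
    H.outflow f H.source = H.inflow f H.source + N := by
  classical
  set s : Finset H.Node :=
    insert H.source (insert H.sink (Finset.univ.image H.tail ∪ Finset.univ.image H.head)) with hsdef
  have h1 : ∑ x ∈ s, H.outflow f x = ∑ e, f e := by
    rw [← Finset.sum_fiberwise_of_maps_to (s := Finset.univ) (t := s) (g := H.tail)
      (fun e _ => by simp [hsdef]) f]
    exact Finset.sum_congr rfl fun x _ => by simp only [Network.outflow]
  have h2 : ∑ x ∈ s, H.inflow f x = ∑ e, f e := by
    rw [← Finset.sum_fiberwise_of_maps_to (s := Finset.univ) (t := s) (g := H.head)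
      (fun e _ => by simp [hsdef]) f]
    exact Finset.sum_congr rfl fun x _ => by simp only [Network.inflow]
  have hsrc : H.source ∈ s := by simp [hsdef]
  have hsink : H.sink ∈ s.erase H.source := by simp [hsdef, hne.symm]
  rw [← Finset.add_sum_erase s _ hsrc, ← Finset.add_sum_erase _ _ hsink] at h1 h2
  have h3 : ∑ x ∈ (s.erase H.source).erase H.sink, H.inflow f x =
      ∑ x ∈ (s.erase H.source).erase H.sink, H.outflow f x :=
    Finset.sum_congr rfl fun x hx => by
      simp only [Finset.mem_erase] at hx
      exact h x hx.2.1 hx.1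
  omega

namespace Inst

variable {I : Inst}

theorem enter_eq_inCopy {u : Fin I.n} {v : {v : Fin I.n // v ≠ I.root}} :
    I.enter u = .inCopy v ↔ u = v := by
  unfold enter
  split
  · rename_i h
    simpa [h] using v.2.symm
  · simp [Subtype.ext_iff]

theorem leave_eq_outCopy {u : Fin I.n} {v : {v : Fin I.n // v ≠ I.root}} :
    I.leave u = .outCopy v ↔ u = v := by
  unfold leave
  split
  · rename_i h
    simpa [h] using v.2.symm
  · simp [Subtype.ext_iff]

theorem enter_ne_sink {u : Fin I.n} : I.enter u ≠ .sink := by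
  unfold enter
  split <;> simp

theorem enter_ne_outCopy {u : Fin I.n} {v} : I.enter u ≠ .outCopy v := by
  unfold enter
  split <;> simp

theorem leave_ne_sink {u : Fin I.n} : I.leave u ≠ .sink := by
  unfold leave
  split <;> simp

theorem leave_ne_inCopy {u : Fin I.n} {v} : I.leave u ≠ .inCopy v := by
  unfold leave
  split <;> simp

/-- An arc of the graph, as an arc of the split network. -/
abbrev arcEdge (a : {a : I.Arc // I.IsArc a}) : I.splitNetwork.Edge :=
  (.inl a : I.SplitEdge)

/-- The arc between the two copies of a vertex. -/
abbrev vertexEdge (v : {v : Fin I.n // v ≠ I.root}) : I.splitNetwork.Edge :=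
  (.inr (.inl v) : I.SplitEdge)

/-- The arc from a terminal to the sink. -/
abbrev sinkEdge (k : Fin I.K) : I.splitNetwork.Edge :=
  (.inr (.inr k) : I.SplitEdge)

instance : DecidablePred I.IsArc := fun a =>
  inferInstanceAs (Decidable (I.directed = true → a.2 = true))

theorem sum_edge {M : Type*} [AddCommMonoid M] (g : I.splitNetwork.Edge → M) :
    ∑ e, g e = ∑ a, g (arcEdge a) + (∑ v, g (vertexEdge v) + ∑ k, g (sinkEdge k)) := by
  have : (∑ e : I.splitNetwork.Edge, g e) = ∑ e : I.SplitEdge, g e :=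
    -- The two sums are formed with different instances of `Fintype`.
    Finset.sum_congr (Finset.ext fun e => iff_of_true
      (@Finset.mem_univ _ I.splitNetwork.fintypeEdge e) (@Finset.mem_univ I.SplitEdge _ e))
      fun _ _ => rfl
  exact this.trans ((Fintype.sum_sum_type _).trans
    (congrArg _ (Fintype.sum_sum_type _)))

variable (f : I.splitNetwork.Edge → ℕ)

open Classical in
theorem inflow_eq (x : I.splitNetwork.Node) : I.splitNetwork.inflow f x =
    (∑ a : {a : I.Arc // I.IsArc a}, if I.enter (I.tgt a.1) = x then f (arcEdge a) else 0) +
      ((∑ v, if SplitNode.outCopy v = x then f (vertexEdge v) else 0) +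
        ∑ k, if SplitNode.sink = x then f (sinkEdge k) else 0) := by
  unfold Network.inflow
  rw [Finset.sum_filter, sum_edge]
  rfl

open Classical in
theorem outflow_eq (x : I.splitNetwork.Node) : I.splitNetwork.outflow f x =
    (∑ a : {a : I.Arc // I.IsArc a}, if I.leave (I.src a.1) = x then f (arcEdge a) else 0) +
      ((∑ v, if SplitNode.inCopy v = x then f (vertexEdge v) else 0) +
        ∑ k, if I.leave (I.terminal k) = x then f (sinkEdge k) else 0) := by
  unfold Network.outflow
  rw [Finset.sum_filter, sum_edge]
  rfl

theorem inflow_inCopy (v : {v : Fin I.n // v ≠ I.root}) :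
    I.splitNetwork.inflow f (.inCopy v : I.SplitNode) =
      ∑ a : {a : I.Arc // I.IsArc a}, if I.tgt a.1 = v then f (arcEdge a) else 0 := by
  refine (inflow_eq f _).trans ?_
  simp [enter_eq_inCopy]

theorem outflow_inCopy (v : {v : Fin I.n // v ≠ I.root}) :
    I.splitNetwork.outflow f (.inCopy v : I.SplitNode) = f (vertexEdge v) := by
  refine (outflow_eq f _).trans ?_
  simp [leave_ne_inCopy]

theorem inflow_outCopy (v : {v : Fin I.n // v ≠ I.root}) :
    I.splitNetwork.inflow f (.outCopy v : I.SplitNode) = f (vertexEdge v) := by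
  refine (inflow_eq f _).trans ?_
  simp [enter_ne_outCopy]

theorem outflow_outCopy (v : {v : Fin I.n // v ≠ I.root}) :
    I.splitNetwork.outflow f (.outCopy v : I.SplitNode) =
      (∑ a : {a : I.Arc // I.IsArc a}, if I.src a.1 = v then f (arcEdge a) else 0) +
        ∑ k, if I.terminal k = v then f (sinkEdge k) else 0 := by
  refine (outflow_eq f _).trans ?_
  simp [leave_eq_outCopy]

theorem inflow_sink : I.splitNetwork.inflow f (.sink : I.SplitNode) = ∑ k, f (sinkEdge k) := by
  refine (inflow_eq f _).trans ?_
  simp [enter_ne_sink]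

theorem outflow_sink : I.splitNetwork.outflow f (.sink : I.SplitNode) = 0 := by
  refine (outflow_eq f _).trans ?_
  simp [leave_ne_sink]

theorem flowCost_eq : I.splitNetwork.flowCost f =
    ∑ a : {a : I.Arc // I.IsArc a}, (f (arcEdge a) : ℚ≥0) * I.len a.1.1 := by
  have : ∀ e : {v : Fin I.n // v ≠ I.root} ⊕ Fin I.K,
    I.splitNetwork.cost (Sum.inr e : I.SplitEdge) = 0 := fun _ => rfl
  rw [Network.flowCost, sum_edge]
  simp only [vertexEdge, sinkEdge, this, mul_zero, Finset.sum_const_zero, add_zero]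
  rfl

variable {f}

theorem two_le_sum_ite {α : Type*} [Fintype α] {p : α → Prop} [DecidablePred p] {g : α → ℕ}
    {a b : α} (hab : a ≠ b) (ha : p a) (hb : p b) (hga : 0 < g a) (hgb : 0 < g b) :
    2 ≤ ∑ x, if p x then g x else 0 := by
  classical
  have := Finset.sum_le_sum_of_subset (f := fun x => if p x then g x else 0)
    (Finset.subset_univ {a, b})
  rw [Finset.sum_pair hab, if_pos ha, if_pos hb] at this
  omega

theorem sum_ite_pos_iff {α : Type*} [Fintype α] {p : α → Prop} [DecidablePred p] {g : α → ℕ} :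
    0 < (∑ x, if p x then g x else 0) ↔ ∃ x, p x ∧ 0 < g x := by
  rw [Finset.sum_pos_iff]
  simp only [Finset.mem_univ, true_and]
  refine exists_congr fun x => ?_
  split <;> simp_all

/-- The arcs that carry a flow of `K` units contain disjoint paths to the terminals. -/
theorem isTraceable_flowSupport (hf : I.splitNetwork.IsFlow I.K f) :
    I.IsTraceable (I.flowSupport f) := by
  obtain ⟨hcap, hcons, -, hsink⟩ := hf
  have hle : ∀ e, f e ≤ 1 := hcap
  have hin : ∀ v : {v : Fin I.n // v ≠ I.root},
      (∑ a : {a : I.Arc // I.IsArc a}, if I.tgt a.1 = v then f (arcEdge a) else 0) =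
      f (vertexEdge v) := fun v => by
    have := hcons (.inCopy v : I.SplitNode) (by simp [splitNetwork]) (by simp [splitNetwork])
    rwa [inflow_inCopy, outflow_inCopy] at this
  have hout : ∀ v : {v : Fin I.n // v ≠ I.root}, f (vertexEdge v) =
      (∑ a : {a : I.Arc // I.IsArc a}, if I.src a.1 = v then f (arcEdge a) else 0) +
        ∑ k, if I.terminal k = v then f (sinkEdge k) else 0 := fun v => by
    have := hcons (.outCopy v : I.SplitNode) (by simp [splitNetwork]) (by simp [splitNetwork])
    rwa [inflow_outCopy, outflow_outCopy] at this
  -- The `K` arcs into the sink have capacity one, so all of them are saturated.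
  have hk : ∀ k, f (sinkEdge k) = 1 := by
    have h1 : I.splitNetwork.inflow f (.sink : I.SplitNode) =
      I.splitNetwork.outflow f (.sink : I.SplitNode) + I.K := hsink
    rw [inflow_sink, outflow_sink, zero_add] at h1
    have h2 : ∑ k : Fin I.K, f (sinkEdge k) = ∑ _k : Fin I.K, 1 := by simp [h1]
    exact fun k => (Finset.sum_eq_sum_iff_of_le fun k _ => hle (sinkEdge k)).1 h2 k
      (Finset.mem_univ k)
  have hterm : ∀ k, 0 < ∑ j, if I.terminal j = I.terminal k then f (sinkEdge j) else 0 :=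
    fun k => sum_ite_pos_iff.2 ⟨k, rfl, (hk k).symm ▸ Nat.one_pos⟩
  have hentered : ∀ v : {v : Fin I.n // v ≠ I.root}, 0 < f (vertexEdge v) →
      ∃ a ∈ I.flowSupport f, I.tgt a = v := fun v hv => by
    rw [← hin, sum_ite_pos_iff] at hv
    obtain ⟨a, ha, hfa⟩ := hv
    exact ⟨a.1, ⟨a.2, hfa⟩, ha⟩
  constructor
  · rintro a ⟨h, -⟩
    exact h
  · rintro a ⟨h, ha⟩ k hak
    have h1 := hout ⟨I.terminal k, I.root_ne_terminal k⟩
    have h2 := hle (vertexEdge ⟨I.terminal k, I.root_ne_terminal k⟩)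
    have h3 := hterm k
    have h4 : 0 < ∑ a : {a : I.Arc // I.IsArc a},
        if I.src a.1 = I.terminal k then f (arcEdge a) else 0 :=
      sum_ite_pos_iff.2 ⟨⟨a, h⟩, hak, ha⟩
    simp only at h1
    omega
  · rintro a ⟨h, ha⟩ b ⟨h', hb⟩ hab hr
    by_contra hne
    have h1 := hout ⟨I.src a, hr⟩
    have h2 := hle (vertexEdge ⟨I.src a, hr⟩)
    have h3 := two_le_sum_ite (p := fun x : {a : I.Arc // I.IsArc a} => I.src x.1 = I.src a)
      (g := fun x => f (arcEdge x)) (a := ⟨a, h⟩) (b := ⟨b, h'⟩) (by simpa using hne) rfl hab.symm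
      ha hb
    simp only at h1
    omega
  · intro k
    refine hentered ⟨I.terminal k, I.root_ne_terminal k⟩ ?_
    rw [hout]
    exact Nat.add_pos_right _ (hterm k)
  · rintro a ⟨h, ha⟩ hr
    refine hentered ⟨I.src a, hr⟩ ?_
    rw [hout]
    refine Nat.add_pos_left ?_ _
    exact sum_ite_pos_iff.2 ⟨⟨a, h⟩, rfl, ha⟩

theorem length_le_flowCost {A : Finset I.Arc} (hA : (A : Set I.Arc) ⊆ I.flowSupport f) :
    I.length A ≤ I.splitNetwork.flowCost f := by
  classical
  rw [flowCost_eq, length, ← Finset.sum_subtype_of_mem (p := I.IsArc) (fun a => I.len a.1)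
    fun a ha => (hA ha).1]
  have : ∑ a ∈ A.subtype I.IsArc, I.len a.1.1 ≤
      ∑ a ∈ A.subtype I.IsArc, (f (arcEdge a) : ℚ≥0) * I.len a.1.1 := by
    refine Finset.sum_le_sum fun a ha => ?_
    obtain ⟨h, hf⟩ := hA (Finset.mem_subtype.1 ha)
    exact le_mul_of_one_le_left (zero_le) (by exact_mod_cast hf)
  exact this.trans (Finset.sum_le_sum_of_subset (Finset.subset_univ _))

/-- The flow of one unit along each of the paths that make up a linkage. -/
def linkageFlow (A : Finset I.Arc) : I.splitNetwork.Edge → ℕ := fun e =>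
  match (e : I.SplitEdge) with
  | .inl a => if a.1 ∈ A then 1 else 0
  | .inr (.inl v) => if ∃ a ∈ A, I.tgt a = v then 1 else 0
  | .inr (.inr _) => 1

theorem sum_indicator_eq {α : Type*} [Fintype α] {p q : α → Prop} [DecidablePred p]
    [DecidablePred q] [Decidable (∃ x, p x ∧ q x)]
    (h : ∀ a b, p a → q a → p b → q b → a = b) :
    (∑ x, if p x then (if q x then 1 else 0) else 0) = if ∃ x, p x ∧ q x then 1 else 0 := by
  split
  · rename_i hx
    obtain ⟨x, hp, hq⟩ := hx
    rw [Finset.sum_eq_single x]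
    · simp [hp, hq]
    · intro b _ hb
      by_contra hne
      simp only [ite_eq_right_iff, Classical.not_imp] at hne
      exact hb (h b x hne.1 hne.2.1 hp hq)
    · simp
  · rename_i hx
    refine Finset.sum_eq_zero fun x _ => ?_
    by_contra hne
    simp only [ite_eq_right_iff, Classical.not_imp] at hne
    exact hx ⟨x, hne.1, hne.2.1⟩

namespace IsLinkage

variable {A : Finset I.Arc}

theorem isFlow (hA : I.IsLinkage A) : I.splitNetwork.IsFlow I.K (linkageFlow A) := by
  classical
  have hin : ∀ v : {v : Fin I.n // v ≠ I.root},
      (∑ a : {a : I.Arc // I.IsArc a}, if I.tgt a.1 = v then linkageFlow A (arcEdge a) else 0) =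
        linkageFlow A (vertexEdge v) := fun v => by
    simp only [linkageFlow]
    rw [sum_indicator_eq fun a b h1 h2 h3 h4 =>
      Subtype.ext (hA.in_unique _ h2 _ h4 (h1.trans h3.symm))]
    refine if_congr ⟨?_, ?_⟩ rfl rfl
    · rintro ⟨a, h1, h2⟩
      exact ⟨a.1, h2, h1⟩
    · rintro ⟨a, h1, h2⟩
      exact ⟨⟨a, hA.isArc a h1⟩, h2, h1⟩
  have hout : ∀ v : {v : Fin I.n // v ≠ I.root}, linkageFlow A (vertexEdge v) =
      (∑ a : {a : I.Arc // I.IsArc a}, if I.src a.1 = v then linkageFlow A (arcEdge a) else 0) +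
        ∑ k, if I.terminal k = v then linkageFlow A (sinkEdge k) else 0 := fun v => by
    simp only [linkageFlow]
    rw [sum_indicator_eq fun a b h1 h2 h3 h4 =>
      Subtype.ext (hA.out_unique _ h2 _ h4 (h1.trans h3.symm) (h1 ▸ v.2))]
    by_cases hv : ∃ k, I.terminal k = v
    · obtain ⟨k, hk⟩ := hv
      rw [if_pos (hk ▸ hA.terminal_entered k), if_neg, zero_add,
        Finset.sum_eq_single k _ (by simp), if_pos hk]
      · intro j _ hj
        rw [if_neg fun h => hj (I.terminal_injective (h.trans hk.symm))]
      · rintro ⟨a, h1, h2⟩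
        exact hA.src_ne _ h2 k (h1.trans hk.symm)
    · rw [Finset.sum_eq_zero fun k _ => if_neg fun h => hv ⟨k, h⟩, add_zero]
      refine if_congr ((hA.entered_iff_left v v.2 fun k h => hv ⟨k, h.symm⟩).trans
        ⟨?_, ?_⟩) rfl rfl
      · rintro ⟨a, h1, h2⟩
        exact ⟨⟨a, hA.isArc a h1⟩, h2, h1⟩
      · rintro ⟨a, h1, h2⟩
        exact ⟨a.1, h2, h1⟩
  have hcons : ∀ x, x ≠ I.splitNetwork.source → x ≠ I.splitNetwork.sink →
      I.splitNetwork.inflow (linkageFlow A) x = I.splitNetwork.outflow (linkageFlow A) x := by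
    intro x h1 h2
    match (x : I.SplitNode) with
    | .root => exact absurd rfl h1
    | .sink => exact absurd rfl h2
    | .inCopy v => rw [inflow_inCopy, outflow_inCopy, hin]
    | .outCopy v => rw [inflow_outCopy, outflow_outCopy, hout]
  have hsink : I.splitNetwork.inflow (linkageFlow A) I.splitNetwork.sink =
      I.splitNetwork.outflow (linkageFlow A) I.splitNetwork.sink + I.K := by
    refine (inflow_sink _).trans ((?_ : _ = _).trans (congrArg (· + I.K) (outflow_sink _).symm))
    simp [linkageFlow]
  refine ⟨fun e => ?_, hcons, Network.outflow_source _ (by simp [splitNetwork]) hcons hsink, hsink⟩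
  show linkageFlow A e ≤ 1
  unfold linkageFlow
  split <;> (try split) <;> simp

theorem flowCost_eq_length (hA : I.IsLinkage A) :
    I.splitNetwork.flowCost (linkageFlow A) = I.length A := by
  classical
  rw [flowCost_eq, length, ← Finset.sum_subtype_of_mem (p := I.IsArc) (fun a => I.len a.1)
    hA.isArc]
  rw [← Finset.sum_subset (Finset.subset_univ (A.subtype I.IsArc)) fun a _ ha => ?_]
  · refine Finset.sum_congr rfl fun a ha => ?_
    rw [Finset.mem_subtype] at ha
    simp [linkageFlow, ha]
  · rw [Finset.mem_subtype] at ha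
    simp [linkageFlow, ha]

end IsLinkage

/-! ### The structure of feasible solutions -/

theorem feasible_iff_flow (hI : I.UnitCapacities) : (∃ A : Finset I.Arc, I.IsFeasible A) ↔
    ∃ f : I.splitNetwork.Edge → ℕ, I.splitNetwork.IsFlow I.K f := by
  constructor
  · rintro ⟨A, hA⟩
    obtain ⟨P, hP, -⟩ := hA.exists_disjointPaths hI
    exact ⟨_, hP.isLinkage.isFlow⟩
  · rintro ⟨f, hf⟩
    obtain ⟨P, hP, -⟩ := (isTraceable_flowSupport hf).exists_disjointPaths
    exact ⟨_, hP.isFeasible hI⟩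

/-- The paths contained in a flow of least cost cost no more than the flow, which in turn costs no
more than any other family of disjoint paths. -/
theorem exists_isOptimal_of_isMinCostFlow (hI : I.UnitCapacities)
    (hf : I.splitNetwork.IsMinCostFlow I.K f) :
    ∃ A : Finset I.Arc, I.IsOptimal A ∧ (A : Set I.Arc) ⊆ I.flowSupport f ∧
      I.length A = I.splitNetwork.flowCost f := by
  obtain ⟨P, hP, hPf⟩ := (isTraceable_flowSupport hf.1).exists_disjointPaths
  have hsub : (I.arcsOf P : Set I.Arc) ⊆ I.flowSupport f := fun a ha => by
    obtain ⟨k, hk⟩ := mem_arcsOf.1 (Finset.mem_coe.1 ha)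
    exact hPf k a hk
  have hmin : ∀ P', I.IsDisjointPaths P' →
      I.splitNetwork.flowCost f ≤ I.length (I.arcsOf P') := fun P' hP' =>
    (hf.2 _ hP'.isLinkage.isFlow).trans_eq hP'.isLinkage.flowCost_eq_length
  exact ⟨I.arcsOf P, isOptimal_of_forall_disjointPaths hI hP fun P' hP' =>
    (length_le_flowCost hsub).trans (hmin P' hP'), hsub,
    (length_le_flowCost hsub).antisymm (hmin P hP)⟩

theorem exists_disjointPaths_of_isFeasible (hI : I.UnitCapacities) {A : Finset I.Arc}
    (hA : I.IsFeasible A) : ∃ P : Fin I.K → List I.Arc, I.IsDisjointPaths P ∧ I.arcsOf P ⊆ A ∧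
      ((∀ B ⊆ A, I.IsFeasible B → B = A) → I.arcsOf P = A) := by
  obtain ⟨P, hP, hsub⟩ := hA.exists_disjointPaths hI
  exact ⟨P, hP, hsub, fun h => h _ hsub (hP.isFeasible hI)⟩

end Inst

/-! ### The assignment problem and its dual -/

/-- An assignment problem: columns are the integers in `[0, n)` other than the root; rows are the
columns that satisfy `inner`, and the root, which may be assigned to any number of columns. Edges
are the integers `e` in `[0, E)` with `0 ≤ tgt e`, so that setting `tgt e` to a negative
value deletes `e`; they join the row `src e` to the column `tgt e`, at cost `len e`. -/
structure Assignment where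
  n : ℕ
  E : ℕ
  root : ℤ
  inner : ℤ → Prop
  src : ℤ → ℤ
  tgt : ℤ → ℤ
  len : ℤ → ℤ
  tgt_col : ∀ e : ℤ, 0 ≤ e → e < E → 0 ≤ tgt e → tgt e < n ∧ tgt e ≠ root
  src_row : ∀ e : ℤ, 0 ≤ e → e < E → 0 ≤ tgt e →
    src e = root ∨ (0 ≤ src e ∧ src e < n ∧ src e ≠ root ∧ inner (src e))

namespace Assignment

variable (G : Assignment)

/-- The columns. -/
def IsCol (v : ℤ) : Prop := 0 ≤ v ∧ v < G.n ∧ v ≠ G.root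

/-- The rows other than the root. -/
def IsRow (x : ℤ) : Prop := G.IsCol x ∧ G.inner x

/-- The edges. -/
def IsEdge (e : ℤ) : Prop := 0 ≤ e ∧ e < G.E ∧ 0 ≤ G.tgt e

/-- `p` assigns to each column an edge at that column, such that no row other than the root is
used twice. -/
structure IsPerfect (p : ℤ → ℤ) : Prop where
  edge : ∀ v, G.IsCol v → G.IsEdge (p v) ∧ G.tgt (p v) = v
  src_inj : ∀ v w, G.IsCol v → G.IsCol w → G.src (p v) ≠ G.root → G.src (p v) = G.src (p w) →
    v = w

/-- Dual solutions: `a` and `b` are potentials of rows and columns, with nonnegative slack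
`len e + a (src e) - b (tgt e)` at every edge. -/
structure IsPotential (a b : ℤ → ℤ) : Prop where
  le : ∀ e, G.IsEdge e → b (G.tgt e) ≤ G.len e + a (G.src e)
  root : a G.root = 0
  nonneg : ∀ x, 0 ≤ a x

/-- The edges without slack. -/
def IsTight (a b : ℤ → ℤ) (e : ℤ) : Prop :=
  G.IsEdge e ∧ G.len e + a (G.src e) = b (G.tgt e)

/-- A partial assignment by tight edges: `pin v` is the edge at the column `v`, for all columns
in `U`, and `mate x` is the column assigned to the row `x`, for all rows except `hole`. If `hole`
is the root, no row is excepted. -/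
structure IsMatching (a b : ℤ → ℤ) (U : ℤ → Prop) (hole : ℤ) (pin mate : ℤ → ℤ) : Prop where
  tight : ∀ v, U v → G.IsTight a b (pin v)
  tgt_pin : ∀ v, U v → G.tgt (pin v) = v
  mate_src : ∀ v, U v → G.src (pin v) ≠ G.root → mate (G.src (pin v)) = v
  src_ne : ∀ v, U v → G.src (pin v) ≠ G.root → G.src (pin v) ≠ hole
  mate_mem : ∀ x, G.IsRow x → x ≠ hole → U (mate x)
  src_pin : ∀ x, G.IsRow x → x ≠ hole → G.src (pin (mate x)) = x

variable {G} {a b pin mate : ℤ → ℤ} {U : ℤ → Prop} {hole : ℤ}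

theorem IsEdge.tgt_isCol {e : ℤ} (h : G.IsEdge e) : G.IsCol (G.tgt e) :=
  ⟨h.2.2, G.tgt_col e h.1 h.2.1 h.2.2⟩

theorem IsEdge.src_isRow {e : ℤ} (h : G.IsEdge e) (hr : G.src e ≠ G.root) :
    G.IsRow (G.src e) := by
  obtain h' | h' := G.src_row e h.1 h.2.1 h.2.2
  · exact absurd h' hr
  · exact ⟨⟨h'.1, h'.2.1, h'.2.2.1⟩, h'.2.2.2⟩

theorem IsMatching.isCol (h : G.IsMatching a b U hole pin mate) {v : ℤ} (hv : U v) :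
    G.IsCol v := by
  have := (h.tight v hv).1.tgt_isCol
  rwa [h.tgt_pin v hv] at this

open Classical in
/-- The set of columns. -/
noncomputable def cols (G : Assignment) : Finset ℤ := {v ∈ Finset.Ico 0 (G.n : ℤ) | G.IsCol v}

open Classical in
/-- The set of rows other than the root. -/
noncomputable def rows (G : Assignment) : Finset ℤ := {v ∈ Finset.Ico 0 (G.n : ℤ) | G.IsRow v}

theorem mem_cols {v : ℤ} : v ∈ G.cols ↔ G.IsCol v := by
  simp only [cols, Finset.mem_filter, Finset.mem_Ico, and_iff_right_iff_imp]
  exact fun h => ⟨h.1, h.2.1⟩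

theorem mem_rows {v : ℤ} : v ∈ G.rows ↔ G.IsRow v := by
  simp only [rows, Finset.mem_filter, Finset.mem_Ico, and_iff_right_iff_imp]
  exact fun h => ⟨h.1.1, h.1.2.1⟩

/-- Weak duality: a complete assignment by tight edges is optimal. -/
theorem IsMatching.sum_len_le (hab : G.IsPotential a b)
    (h : G.IsMatching a b G.IsCol G.root pin mate) {p : ℤ → ℤ} (hp : G.IsPerfect p) :
    ∑ v ∈ G.cols, G.len (pin v) ≤ ∑ v ∈ G.cols, G.len (p v) := by
  classical
  have h1 : ∑ v ∈ G.cols, G.len (pin v) =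
      ∑ v ∈ G.cols, b v - ∑ v ∈ G.cols, a (G.src (pin v)) := by
    rw [← Finset.sum_sub_distrib]
    refine Finset.sum_congr rfl fun v hv => ?_
    have := (h.tight v (mem_cols.1 hv)).2
    rw [h.tgt_pin v (mem_cols.1 hv)] at this
    omega
  have h2 : ∑ v ∈ G.cols, b v - ∑ v ∈ G.cols, a (G.src (p v)) ≤
      ∑ v ∈ G.cols, G.len (p v) := by
    rw [← Finset.sum_sub_distrib]
    refine Finset.sum_le_sum fun v hv => ?_
    have h' := hp.edge v (mem_cols.1 hv)
    have := hab.le _ h'.1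
    rw [h'.2] at this
    omega
  -- The assignment `pin` uses every row, while `p` may leave rows unused, so it matters that row
  -- potentials are nonnegative.
  have h3 : ∑ x ∈ G.rows, a x ≤ ∑ v ∈ G.cols, a (G.src (pin v)) := by
    calc ∑ x ∈ G.rows, a x = ∑ x ∈ G.rows, a (G.src (pin (mate x))) :=
          Finset.sum_congr rfl fun x hx => by
            rw [h.src_pin x (mem_rows.1 hx) (mem_rows.1 hx).1.2.2]
      _ = ∑ v ∈ G.rows.image mate, a (G.src (pin v)) := by
          rw [Finset.sum_image]
          intro x hx y hy hxy
          rw [← h.src_pin x (mem_rows.1 hx) (mem_rows.1 hx).1.2.2,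
            ← h.src_pin y (mem_rows.1 hy) (mem_rows.1 hy).1.2.2]
          exact congrArg _ (congrArg _ hxy)
      _ ≤ _ := by
          refine Finset.sum_le_sum_of_subset_of_nonneg (fun v hv => ?_) fun _ _ _ => hab.nonneg _
          obtain ⟨x, hx, rfl⟩ := Finset.mem_image.1 hv
          exact mem_cols.2 (h.mate_mem x (mem_rows.1 hx) (mem_rows.1 hx).1.2.2)
  have h4 : ∑ v ∈ G.cols, a (G.src (p v)) ≤ ∑ x ∈ G.rows, a x := by
    rw [← Finset.sum_filter_add_sum_filter_not G.cols fun v => G.src (p v) ≠ G.root,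
      Finset.sum_eq_zero (s := {v ∈ G.cols | ¬ G.src (p v) ≠ G.root}), add_zero]
    · rw [← Finset.sum_image (f := a) (g := fun v => G.src (p v))]
      · refine Finset.sum_le_sum_of_subset_of_nonneg (fun x hx => ?_) fun _ _ _ => hab.nonneg _
        obtain ⟨v, hv, rfl⟩ := Finset.mem_image.1 hx
        rw [Finset.mem_filter, mem_cols] at hv
        exact mem_rows.2 ((hp.edge v hv.1).1.src_isRow hv.2)
      · intro v hv w hw hvw
        rw [Finset.mem_coe, Finset.mem_filter, mem_cols] at hv hw
        exact hp.src_inj v w hv.1 hw.1 hv.2 hvw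
    · intro v hv
      rw [Finset.mem_filter, not_not] at hv
      rw [hv.2, hab.root]
  omega

/-! ### The alternating tree of the Hungarian method -/

/-- The edge `way x` leads from the row `x` one step towards the column `t` in the tree with the
set of rows `S`: it is tight, and it ends at `t` or at a column whose mate is a row of `S` of lower
rank. -/
def Leads (G : Assignment) (a b : ℤ → ℤ) (t : ℤ) (mate : ℤ → ℤ) (S : ℤ → Prop) (way : ℤ → ℤ)
    (rk : ℤ → ℕ) (x : ℤ) : Prop :=
  G.IsTight a b (way x) ∧ G.src (way x) = x ∧
    (G.tgt (way x) = t ∨ ∃ y, S y ∧ rk y < rk x ∧ mate y = G.tgt (way x))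

/-- An alternating tree with the column `t`, which is not yet assigned, as its root. It has been
grown by adding rows together with their mates; `S` and `T` are its sets of rows and columns. The
ranks are the times at which the rows were added. -/
structure IsTree (G : Assignment) (a b : ℤ → ℤ) (t : ℤ) (mate : ℤ → ℤ) (S T : ℤ → Prop)
    (way : ℤ → ℤ) (rk : ℤ → ℕ) (c : ℕ) : Prop where
  isRow : ∀ x, S x → G.IsRow x
  mem_iff : ∀ v, T v ↔ v = t ∨ ∃ x, S x ∧ mate x = v
  leads : ∀ x, S x → G.Leads a b t mate S way rk x
  rk_lt : ∀ x, S x → rk x < c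

variable {t : ℤ} {S T : ℤ → Prop} {way : ℤ → ℤ} {rk : ℤ → ℕ} {c : ℕ}

theorem isTree_singleton (G : Assignment) (a b : ℤ → ℤ) (t : ℤ) (mate : ℤ → ℤ) {S T : ℤ → Prop}
    (way : ℤ → ℤ) (hS : ∀ x, ¬ S x) (hT : ∀ v, T v ↔ v = t) :
    G.IsTree a b t mate S T way 0 0 :=
  ⟨fun x hx => (hS x hx).elim, fun v => by simp [hS, hT], fun x hx => (hS x hx).elim,
    fun x hx => (hS x hx).elim⟩

/-- If every edge at a column of the tree comes from a row of the tree, there is no perfect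
assignment, since the tree has more columns than rows. -/
theorem IsTree.not_isPerfect (hT : G.IsTree a b t mate S T way rk c)
    (h : G.IsMatching a b U G.root pin mate) (ht : G.IsCol t) (htU : ¬ U t)
    (hstuck : ∀ e, G.IsEdge e → T (G.tgt e) → S (G.src e)) (p : ℤ → ℤ) : ¬ G.IsPerfect p := by
  classical
  intro hp
  have hTcol : ∀ v, T v → G.IsCol v := fun v hv => by
    obtain rfl | ⟨x, hx, rfl⟩ := (hT.mem_iff v).1 hv
    · exact ht
    · exact h.isCol (h.mate_mem x (hT.isRow x hx) (hT.isRow x hx).1.2.2)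
  have hpS : ∀ v, T v → S (G.src (p v)) := fun v hv => by
    have := hp.edge v (hTcol v hv)
    exact hstuck _ this.1 (by rwa [this.2])
  have h1 : (G.cols.filter T).card ≤ (G.rows.filter S).card := by
    refine Finset.card_le_card_of_injOn (fun v => G.src (p v)) (fun v hv => ?_) ?_
    · rw [Finset.mem_coe, Finset.mem_filter] at hv ⊢
      exact ⟨mem_rows.2 (hT.isRow _ (hpS v hv.2)), hpS v hv.2⟩
    · intro v hv w hw hvw
      rw [Finset.mem_coe, Finset.mem_filter] at hv hw
      exact hp.src_inj v w (hTcol v hv.2) (hTcol w hw.2) (hT.isRow _ (hpS v hv.2)).1.2.2 hvw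
  have h2 : (G.rows.filter S).card ≤ ((G.cols.filter T).erase t).card := by
    refine Finset.card_le_card_of_injOn mate (fun x hx => ?_) ?_
    · rw [Finset.mem_coe, Finset.mem_filter] at hx
      have hU := h.mate_mem x (hT.isRow x hx.2) (hT.isRow x hx.2).1.2.2
      rw [Finset.mem_coe, Finset.mem_erase, Finset.mem_filter, mem_cols]
      exact ⟨fun h => htU (h ▸ hU), h.isCol hU, (hT.mem_iff _).2 (.inr ⟨x, hx.2, rfl⟩)⟩
    · intro x hx y hy hxy
      rw [Finset.mem_coe, Finset.mem_filter] at hx hy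
      rw [← h.src_pin x (hT.isRow x hx.2) (hT.isRow x hx.2).1.2.2,
        ← h.src_pin y (hT.isRow y hy.2) (hT.isRow y hy.2).1.2.2]
      exact congrArg _ (congrArg _ hxy)
  have h3 : ((G.cols.filter T).erase t).card < (G.cols.filter T).card :=
    Finset.card_erase_lt_of_mem
      (Finset.mem_filter.2 ⟨mem_cols.2 ht, (hT.mem_iff t).2 (.inl rfl)⟩)
  omega

section Adjust

variable {a' b' : ℤ → ℤ} {d : ℤ}

/-- The potentials may be raised on the tree by the least slack of an edge that leads into it. -/
theorem IsPotential.adjust (hab : G.IsPotential a b) (hT : G.IsTree a b t mate S T way rk c)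
    (hd : 0 ≤ d)
    (hmin : ∀ e, G.IsEdge e → T (G.tgt e) → ¬ S (G.src e) →
      d ≤ G.len e + a (G.src e) - b (G.tgt e))
    (haS : ∀ x, S x → a' x = a x + d) (haS' : ∀ x, ¬ S x → a' x = a x)
    (hbT : ∀ v, T v → b' v = b v + d) (hbT' : ∀ v, ¬ T v → b' v = b v) :
    G.IsPotential a' b' := by
  refine ⟨fun e he => ?_, ?_, fun x => ?_⟩
  · have h1 := hab.le e he
    by_cases h2 : T (G.tgt e) <;> by_cases h3 : S (G.src e)
    · rw [haS _ h3, hbT _ h2]; omega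
    · have := hmin e he h2 h3
      rw [haS' _ h3, hbT _ h2]; omega
    · rw [haS _ h3, hbT' _ h2]; omega
    · rw [haS' _ h3, hbT' _ h2]; omega
  · rw [haS' _ fun h => (hT.isRow _ h).1.2.2 rfl, hab.root]
  · have := hab.nonneg x
    by_cases h : S x
    · rw [haS _ h]; omega
    · rwa [haS' _ h]

theorem IsMatching.adjust (h : G.IsMatching a b U G.root pin mate) (htU : ¬ U t)
    (hT : G.IsTree a b t mate S T way rk c)
    (haS : ∀ x, S x → a' x = a x + d) (haS' : ∀ x, ¬ S x → a' x = a x)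
    (hbT : ∀ v, T v → b' v = b v + d) (hbT' : ∀ v, ¬ T v → b' v = b v) :
    G.IsMatching a' b' U G.root pin mate := by
  refine ⟨fun v hv => ⟨(h.tight v hv).1, ?_⟩, h.tgt_pin, h.mate_src, h.src_ne, h.mate_mem,
    h.src_pin⟩
  have h1 := (h.tight v hv).2
  -- Rows and their mates belong to the tree simultaneously, so their potentials change together.
  have h2 : T v ↔ S (G.src (pin v)) := by
    rw [hT.mem_iff]
    constructor
    · rintro (rfl | ⟨x, hx, rfl⟩)
      · exact absurd hv htU
      · rwa [h.src_pin x (hT.isRow x hx) (hT.isRow x hx).1.2.2]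
    · exact fun hS => .inr ⟨_, hS, h.mate_src v hv (hT.isRow _ hS).1.2.2⟩
  rw [h.tgt_pin v hv] at h1 ⊢
  by_cases h3 : T v
  · rw [haS _ (h2.1 h3), hbT _ h3]; omega
  · rw [haS' _ fun h => h3 (h2.2 h), hbT' _ h3]; omega

theorem IsTree.adjust (hT : G.IsTree a b t mate S T way rk c)
    (haS : ∀ x, S x → a' x = a x + d) (hbT : ∀ v, T v → b' v = b v + d) :
    G.IsTree a' b' t mate S T way rk c := by
  refine ⟨hT.isRow, hT.mem_iff, fun x hx => ?_, hT.rk_lt⟩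
  obtain ⟨⟨h1, h2⟩, h3, h4⟩ := hT.leads x hx
  have hTt : T (G.tgt (way x)) := by
    rw [hT.mem_iff]
    obtain h | ⟨y, hy, -, h⟩ := h4
    · exact .inl h
    · exact .inr ⟨y, hy, h⟩
  refine ⟨⟨h1, ?_⟩, h3, h4⟩
  rw [h3] at h2 ⊢
  rw [haS _ hx, hbT _ hTt]
  omega

end Adjust

/-- A tight edge into the tree whose row is not in the tree extends the way to `t`. -/
theorem IsTree.leads_update (hT : G.IsTree a b t mate S T way rk c) {e : ℤ}
    (he : G.IsTight a b e) (hTe : T (G.tgt e)) (hSe : ¬ S (G.src e)) {S' : ℤ → Prop}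
    (hSS' : ∀ x, S x → S' x) (x : ℤ) (hx : S x ∨ x = G.src e) :
    G.Leads a b t mate S' (Function.update way (G.src e) e)
      (Function.update rk (G.src e) c) x := by
  by_cases hxe : x = G.src e
  · subst hxe
    refine ⟨by simpa using he, by simp, ?_⟩
    rw [Function.update_self, Function.update_self]
    obtain h | ⟨y, hy, h⟩ := (hT.mem_iff _).1 hTe
    · exact .inl h
    · refine .inr ⟨y, hSS' y hy, ?_, h⟩
      rw [Function.update_of_ne fun h => hSe (by rwa [← h])]
      exact hT.rk_lt y hy
  · have hSx := hx.resolve_right hxe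
    obtain ⟨h1, h2, h3⟩ := hT.leads x hSx
    unfold Leads
    rw [Function.update_of_ne hxe, Function.update_of_ne hxe]
    refine ⟨h1, h2, h3.imp id ?_⟩
    rintro ⟨y, hy, hlt, h⟩
    refine ⟨y, hSS' y hy, ?_, h⟩
    rwa [Function.update_of_ne fun h => hSe (by rwa [← h])]

theorem IsTree.extend (hT : G.IsTree a b t mate S T way rk c) {e : ℤ}
    (he : G.IsTight a b e) (hTe : T (G.tgt e)) (hSe : ¬ S (G.src e)) (hr : G.src e ≠ G.root)
    {S' T' : ℤ → Prop} (hS' : ∀ x, S' x ↔ S x ∨ x = G.src e)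
    (hT' : ∀ v, T' v ↔ T v ∨ v = mate (G.src e)) :
    G.IsTree a b t mate S' T' (Function.update way (G.src e) e)
      (Function.update rk (G.src e) c) (c + 1) := by
  refine ⟨fun x hx => ?_, fun v => ?_, fun x hx => ?_, fun x hx => ?_⟩
  · obtain h | rfl := (hS' x).1 hx
    · exact hT.isRow x h
    · exact he.1.src_isRow hr
  · rw [hT', hT.mem_iff]
    constructor
    · rintro ((h | ⟨x, hx, h⟩) | rfl)
      · exact .inl h
      · exact .inr ⟨x, (hS' x).2 (.inl hx), h⟩
      · exact .inr ⟨_, (hS' _).2 (.inr rfl), rfl⟩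
    · rintro (h | ⟨x, hx, rfl⟩)
      · exact .inl (.inl h)
      · obtain h | rfl := (hS' x).1 hx
        · exact .inl (.inr ⟨x, h, rfl⟩)
        · exact .inr rfl
  · exact hT.leads_update he hTe hSe (fun x hx => (hS' x).2 (.inl hx)) x ((hS' x).1 hx)
  · by_cases hxe : x = G.src e
    · subst hxe; simp
    · rw [Function.update_of_ne hxe]
      have := hT.rk_lt x (((hS' x).1 hx).resolve_right hxe)
      omega

/-! ### Augmentation -/

/-- The last step of an augmentation, at an edge that ends at the unassigned column `t`. -/
theorem IsMatching.augment_last {x : ℤ} (h : G.IsMatching a b U x pin mate) (htU : ¬ U t)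
    (hx : G.Leads a b t mate S way rk x) (htgt : G.tgt (way x) = t) {U' : ℤ → Prop}
    (hU' : ∀ v, U' v ↔ U v ∨ v = t) :
    G.IsMatching a b U' G.root (Function.update pin t (way x)) (Function.update mate x t) := by
  have hU : ∀ {v}, U v → v ≠ t := fun hv h => htU (h ▸ hv)
  refine ⟨fun v hv => ?_, fun v hv => ?_, fun v hv => ?_, fun v _ hr => hr, fun y hy hr => ?_,
    fun y hy hr => ?_⟩
  · obtain hv | rfl := (hU' v).1 hv
    · rw [Function.update_of_ne (hU hv)]; exact h.tight v hv
    · rw [Function.update_self]; exact hx.1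
  · obtain hv | rfl := (hU' v).1 hv
    · rw [Function.update_of_ne (hU hv)]; exact h.tgt_pin v hv
    · rw [Function.update_self]; exact htgt
  · obtain hv | rfl := (hU' v).1 hv
    · rw [Function.update_of_ne (hU hv)]
      intro hr
      rw [Function.update_of_ne (h.src_ne v hv hr)]
      exact h.mate_src v hv hr
    · rw [Function.update_self, hx.2.1]
      simp
  · rw [hU']
    by_cases hyx : y = x
    · subst hyx; simp
    · rw [Function.update_of_ne hyx]; exact .inl (h.mate_mem y hy hyx)
  · by_cases hyx : y = x
    · subst hyx; simpa using hx.2.1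
    · rw [Function.update_of_ne hyx, Function.update_of_ne (hU (h.mate_mem y hy hyx))]
      exact h.src_pin y hy hyx

/-- An inner step of an augmentation: the row `x` takes over a column, which leaves another row
`y` without a column. -/
theorem IsMatching.augment_step {x y : ℤ} (h : G.IsMatching a b U x pin mate)
    (hx : G.Leads a b t mate S way rk x) (hy : G.IsRow y) (hyx : y ≠ x)
    (hmate : mate y = G.tgt (way x)) :
    G.IsMatching a b U y (Function.update pin (G.tgt (way x)) (way x))
      (Function.update mate x (G.tgt (way x))) := by
  rw [← hmate]
  have hU := h.mate_mem y hy hyx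
  have hsrc := h.src_pin y hy hyx
  refine ⟨fun v hv => ?_, fun v hv => ?_, fun v hv => ?_, fun v hv => ?_, fun z hz hr => ?_,
    fun z hz hr => ?_⟩
  · by_cases hv' : v = mate y
    · rw [hv', Function.update_self]; exact hx.1
    · rw [Function.update_of_ne hv']; exact h.tight v hv
  · by_cases hv' : v = mate y
    · rw [hv', Function.update_self]; exact hmate.symm
    · rw [Function.update_of_ne hv']; exact h.tgt_pin v hv
  · by_cases hv' : v = mate y
    · rw [hv', Function.update_self, hx.2.1]
      simp
    · rw [Function.update_of_ne hv']
      intro hr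
      rw [Function.update_of_ne (h.src_ne v hv hr)]
      exact h.mate_src v hv hr
  · by_cases hv' : v = mate y
    · rw [hv', Function.update_self, hx.2.1]
      exact fun _ => hyx.symm
    · rw [Function.update_of_ne hv']
      rintro hr rfl
      exact hv' (h.mate_src v hv hr).symm
  · by_cases hzx : z = x
    · rw [hzx, Function.update_self]; exact hU
    · rw [Function.update_of_ne hzx]; exact h.mate_mem z hz hzx
  · by_cases hzx : z = x
    · rw [hzx, Function.update_self, Function.update_self]; exact hx.2.1
    · rw [Function.update_of_ne hzx, Function.update_of_ne]
      · exact h.src_pin z hz hzx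
      · intro he
        have := h.src_pin z hz hzx
        rw [he, hsrc] at this
        exact hr this.symm

/-- The rest of the way of an augmentation is not affected by the change at `x`, because it uses
only rows of lower rank. -/
theorem Leads.update_mate {x z : ℤ} (hz : G.Leads a b t mate S way rk z) (hzx : rk z ≤ rk x)
    (v : ℤ) : G.Leads a b t (Function.update mate x v) S way rk z := by
  refine ⟨hz.1, hz.2.1, hz.2.2.imp id ?_⟩
  rintro ⟨y, hy, hlt, h⟩
  refine ⟨y, hy, hlt, ?_⟩
  rwa [Function.update_of_ne]
  rintro rfl
  omega

end Assignment

/-! ### Memories -/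

@[simp]
theorem Mem.store_self (σ : Mem) (a : ℕ) (i z : ℤ) :
    σ.store a i z a = Function.update (σ a) i z := by
  simp [Mem.store]

@[simp]
theorem Mem.store_of_ne (σ : Mem) {a b : ℕ} (h : b ≠ a) (i z : ℤ) : σ.store a i z b = σ b := by
  simp [Mem.store, h]

/-- `τ` arises from `σ` by changes to the arrays in `L`. -/
def Frame (L : List ℕ) (σ τ : Mem) : Prop := ∀ a, a ∉ L → τ a = σ a

theorem Frame.refl (L : List ℕ) (σ : Mem) : Frame L σ σ := fun _ _ => rfl

theorem Frame.store {L : List ℕ} {σ τ : Mem} (h : Frame L σ τ) {a : ℕ} (ha : a ∈ L) (i z : ℤ) :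
    Frame L σ (τ.store a i z) := fun b hb => by
  rw [Mem.store_of_ne τ (by rintro rfl; exact hb ha), h b hb]

theorem Frame.mono {L L' : List ℕ} {σ τ : Mem} (h : Frame L σ τ) (hL : L ⊆ L') :
    Frame L' σ τ := fun a ha => h a fun h => ha (hL h)

@[simp]
theorem frame_store_iff {L : List ℕ} {σ τ : Mem} {a : ℕ} (ha : a ∈ L) {i z : ℤ} :
    Frame L σ (τ.store a i z) ↔ Frame L σ τ :=
  ⟨fun h b hb => by
    rw [← h b hb, Mem.store_of_ne τ (by rintro rfl; exact hb ha)], fun h => h.store ha i z⟩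

theorem Frame.trans {L L' : List ℕ} {σ τ ρ : Mem} (h : Frame L σ τ) (h' : Frame L' τ ρ)
    (hL : L' ⊆ L) : Frame L σ ρ := fun a ha => (h' a fun h => ha (hL h)).trans (h a ha)

/-! ### The program -/

-- The arrays and variables of the program are numbered as follows; a variable is stored in cell
-- `0` of an array of its own. `IN` and `OUT` are the input and the output. `SRC`, `TGT` and `LEN`
-- hold the edges of the assignment problem, `TERM` marks the terminals, `PIN` and `MATE` hold the
-- current assignment, and `ROWPOT` and `COLPOT` the potentials. `ROWS` and `COLS` mark the rows and
-- columns of the alternating tree, and `WAY` holds for each of its rows the edge towards the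
-- terminal.

notation "IN" => (0 : ℕ)
notation "OUT" => (1 : ℕ)
notation "SRC" => (2 : ℕ)
notation "TGT" => (3 : ℕ)
notation "LEN" => (4 : ℕ)
notation "TERM" => (5 : ℕ)
notation "PIN" => (6 : ℕ)
notation "MATE" => (7 : ℕ)
notation "ROWPOT" => (8 : ℕ)
notation "COLPOT" => (9 : ℕ)
notation "ROWS" => (10 : ℕ)
notation "COLS" => (11 : ℕ)
notation "WAY" => (12 : ℕ)
notation "vE" => (13 : ℕ)
notation "vF" => (14 : ℕ)
notation "vV" => (15 : ℕ)
notation "vK" => (16 : ℕ)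
notation "vAcc" => (17 : ℕ)
notation "vDone" => (18 : ℕ)
notation "vFail" => (19 : ℕ)
notation "vBest" => (20 : ℕ)
notation "vDelta" => (21 : ℕ)
notation "vRow" => (22 : ℕ)
notation "vCol" => (23 : ℕ)
notation "vNext" => (24 : ℕ)

infixr:60 " ;; " => Prog.seq

namespace Expr

instance : Add Expr := ⟨Expr.add⟩
instance : Sub Expr := ⟨Expr.sub⟩
instance : Mul Expr := ⟨Expr.mul⟩
instance (k : ℕ) : OfNat Expr k := ⟨Expr.const k⟩

@[simp]
theorem eval_add (σ : Mem) (x y : Expr) : (x + y).eval σ = x.eval σ + y.eval σ := rfl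

@[simp]
theorem eval_sub (σ : Mem) (x y : Expr) : (x - y).eval σ = x.eval σ - y.eval σ := rfl

@[simp]
theorem eval_mul (σ : Mem) (x y : Expr) : (x * y).eval σ = x.eval σ * y.eval σ := rfl

@[simp]
theorem eval_ofNat (σ : Mem) (k : ℕ) [k.AtLeastTwo] :
    (no_index (OfNat.ofNat k : Expr)).eval σ = (k : ℤ) := rfl

@[simp]
theorem eval_zero (σ : Mem) : (0 : Expr).eval σ = 0 := rfl

@[simp]
theorem eval_one (σ : Mem) : (1 : Expr).eval σ = 1 := rfl

@[simp]
theorem eval_const (σ : Mem) (z : ℤ) : (Expr.const z).eval σ = z := rfl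

@[simp]
theorem eval_get (σ : Mem) (a : ℕ) (i : Expr) : (Expr.get a i).eval σ = σ a (i.eval σ) := rfl

end Expr

namespace Prog

/-- The value of a variable, which is stored in cell `0` of its array. -/
abbrev var (a : ℕ) : Expr := .get a 0

/-- Assignment to a variable. -/
abbrev assign (a : ℕ) (e : Expr) : Prog := .set a 0 e

/-- An expression that is positive if and only if the values of `x` and `y` differ. -/
abbrev differ (x y : Expr) : Expr := (x - y) * (x - y)

abbrev inN : Expr := .get IN 2
abbrev inM : Expr := .get IN 3
abbrev inK : Expr := .get IN 4
abbrev inRoot : Expr := .get IN 5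

/-- The `k`-th terminal, for the current `k`. -/
abbrev inTerm : Expr := .get IN (6 + var vK)

/-- The `i`-th entry in the description of the edge whose index is the value of the variable
`e`. -/
abbrev inEdge (e : ℕ) (i : ℤ) : Expr := .get IN (.const (6 + i) + inK + 5 * var e)

/-- The number of edges of the assignment problem. -/
abbrev numEdges : Expr := inM + inM + inN

/-- Find an edge of least slack that leads into the tree; `vBest` becomes its index plus one, or
`0` if there is none, and `vDelta` its slack. -/
def search : Prog :=
  assign vBest 0 ;;
  forLoop vE numEdges
    (.cond (.get COLS (.get TGT (var vE)))
      (.cond (.get ROWS (.get SRC (var vE))) .skip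
        (assign vAcc (.get LEN (var vE) + .get ROWPOT (.get SRC (var vE)) -
            .get COLPOT (.get TGT (var vE))) ;;
          .cond (var vBest)
            (.cond (var vDelta - var vAcc)
              (assign vBest (var vE + 1) ;; assign vDelta (var vAcc)) .skip)
            (assign vBest (var vE + 1) ;; assign vDelta (var vAcc))))
      .skip)

/-- Raise the potentials on the tree by `vDelta`. -/
def adjust : Prog :=
  forLoop vV inN
    (.cond (.get COLS (var vV))
        (.set COLPOT (var vV) (.get COLPOT (var vV) + var vDelta)) .skip ;;
      .cond (.get ROWS (var vV))
        (.set ROWPOT (var vV) (.get ROWPOT (var vV) + var vDelta)) .skip)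

/-- Grow the tree by one row and its mate; `vDone` becomes `1` when the row is the root, and `vFail`
becomes `1` if the tree cannot grow. -/
def growStep : Prog :=
  search ;;
  .cond (var vBest)
    (adjust ;;
      assign vBest (var vBest - 1) ;;
      assign vRow (.get SRC (var vBest)) ;;
      .set WAY (var vRow) (var vBest) ;;
      .cond (differ (var vRow) inRoot)
        (.set ROWS (var vRow) 1 ;; .set COLS (.get MATE (var vRow)) 1)
        (assign vDone 1))
    (assign vFail 1)

/-- Start with the tree that consists of the `k`-th terminal only. -/
def initTree : Prog :=
  forLoop vV inN (.set ROWS (var vV) 0 ;; .set COLS (var vV) 0) ;;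
  .set COLS inTerm 1 ;;
  assign vDone 0

/-- Change the assignment along the way from the root to the `k`-th terminal. -/
def augment : Prog :=
  assign vRow inRoot ;;
  assign vDone 1 ;;
  .loop (var vDone)
    (assign vE (.get WAY (var vRow)) ;;
      assign vCol (.get TGT (var vE)) ;;
      assign vNext (.get SRC (.get PIN (var vCol))) ;;
      .set PIN (var vCol) (var vE) ;;
      .set MATE (var vRow) (var vCol) ;;
      .cond (differ (var vCol) inTerm) (assign vRow (var vNext)) (assign vDone 0))

/-- Assign an edge to the `k`-th terminal, or set `vFail`. -/
def stage : Prog :=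
  initTree ;;
  .loop (1 - var vDone - var vFail) growStep ;;
  .cond (var vFail) .skip augment

/-- Assign edges to all terminals, or set `vFail`. -/
def stages : Prog := forLoop vK inK (.cond (var vFail) .skip stage)

end Prog

namespace Assignment

/-- The memory `σ` describes the assignment problem `G`, whose last `G.n` edges come after `2 * m`
others. -/
structure Describes (G : Assignment) (m : ℕ) (σ : Mem) : Prop where
  src : σ SRC = G.src
  tgt : σ TGT = G.tgt
  len : σ LEN = G.len
  n : σ IN 2 = G.n
  m_eq : σ IN 3 = m
  root : σ IN 5 = G.root
  E : (G.E : ℤ) = m + m + G.n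

variable {G : Assignment} {m : ℕ} {σ τ : Mem} {X : ℕ}

theorem Describes.frame (h : G.Describes m σ) {L : List ℕ} (hF : Frame L σ τ) (h0 : IN ∉ L)
    (h2 : SRC ∉ L) (h3 : TGT ∉ L) (h4 : LEN ∉ L) : G.Describes m τ := by
  constructor
  · rw [hF SRC h2, h.src]
  · rw [hF TGT h3, h.tgt]
  · rw [hF LEN h4, h.len]
  · rw [hF IN h0, h.n]
  · rw [hF IN h0, h.m_eq]
  · rw [hF IN h0, h.root]
  · exact h.E

/-- The outcome of the search among the edges below `k`, in the memory `σ`: `β` is the index, plus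
one, of an edge of least slack `δ` that leads into the tree, or `0` if there is none. -/
def IsLeastSlack (G : Assignment) (σ : Mem) (k β δ : ℤ) : Prop :=
  (β = 0 ∧ ∀ e, G.IsEdge e → e < k → 0 < σ COLS (G.tgt e) → 0 < σ ROWS (G.src e)) ∨
  ∃ e, β = e + 1 ∧ G.IsEdge e ∧ 0 < σ COLS (G.tgt e) ∧ ¬ 0 < σ ROWS (G.src e) ∧
    δ = G.len e + σ ROWPOT (G.src e) - σ COLPOT (G.tgt e) ∧
    ∀ e', G.IsEdge e' → e' < k → 0 < σ COLS (G.tgt e') → ¬ 0 < σ ROWS (G.src e') →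
      δ ≤ G.len e' + σ ROWPOT (G.src e') - σ COLPOT (G.tgt e')

theorem IsLeastSlack.keep {k β δ : ℤ} (h : G.IsLeastSlack σ k β δ)
    (hk : 0 < σ COLS (G.tgt k) → ¬ 0 < σ ROWS (G.src k) →
      0 < β ∧ δ ≤ G.len k + σ ROWPOT (G.src k) - σ COLPOT (G.tgt k)) :
    G.IsLeastSlack σ (k + 1) β δ := by
  obtain ⟨h0, h1⟩ | ⟨e, h1, h2, h3, h4, h5, h6⟩ := h
  · refine .inl ⟨h0, fun e he hek hT => ?_⟩
    obtain rfl | hne := eq_or_ne e k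
    · by_contra hS
      have := (hk hT hS).1
      omega
    · exact h1 e he (by omega) hT
  · refine .inr ⟨e, h1, h2, h3, h4, h5, fun e' he' hek hT hS => ?_⟩
    obtain rfl | hne := eq_or_ne e' k
    · exact (hk hT hS).2
    · exact h6 e' he' (by omega) hT hS

theorem IsLeastSlack.take {k β δ : ℤ} (h : G.IsLeastSlack σ k β δ) (he : G.IsEdge k)
    (hT : 0 < σ COLS (G.tgt k)) (hS : ¬ 0 < σ ROWS (G.src k))
    (hk : 0 < β → G.len k + σ ROWPOT (G.src k) - σ COLPOT (G.tgt k) < δ) :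
    G.IsLeastSlack σ (k + 1) (k + 1) (G.len k + σ ROWPOT (G.src k) - σ COLPOT (G.tgt k)) := by
  refine .inr ⟨k, rfl, he, hT, hS, rfl, fun e' he' hek hT' hS' => ?_⟩
  obtain rfl | hne := eq_or_ne e' k
  · exact le_rfl
  · obtain ⟨h0, h1⟩ | ⟨e, h1, h2, h3, h4, h5, h6⟩ := h
    · exact absurd (h1 e' he' (by omega) hT') hS'
    · have h7 := h6 e' he' (by omega) hT' hS'
      have h8 := hk (by have := h2.1; omega)
      omega

theorem wp_search (hG : G.Describes m σ) (hX : G.E ≤ X) (hT : ∀ v, 0 < σ COLS v → 0 ≤ v) :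
    wp X Prog.search σ fun τ => Frame [vE, vAcc, vBest, vDelta] σ τ ∧
      G.IsLeastSlack σ G.E (τ vBest 0) (τ vDelta 0) := by
  refine wp_forLoop (fun k τ => Frame [vE, vAcc, vBest, vDelta] σ τ ∧
    G.IsLeastSlack σ k (τ vBest 0) (τ vDelta 0)) G.E hX ?_ ?_ ?_ (fun τ h => h)
  · refine ⟨((Frame.refl _ _).store (by decide) _ _).store (by decide) _ _, .inl ⟨by simp, ?_⟩⟩
    intro e he h
    have := he.1
    omega
  · rintro k τ - ⟨hF, -⟩
    have h := hG.frame hF (by decide) (by decide) (by decide) (by decide)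
    simp [h.n, h.m_eq, h.E]
  · rintro k τ hk ⟨hF, hI⟩ hv
    have h := hG.frame hF (by decide) (by decide) (by decide) (by decide)
    have keep := hI.keep
    have take := hI.take
    have hE : 0 < σ COLS (G.tgt k) → G.IsEdge k := fun h => ⟨by omega, by omega, hT _ h⟩
    simp only [wp, Expr.eval_add, Expr.eval_sub, Expr.eval_get, Expr.eval_zero, Expr.eval_one, hv,
      h.src, h.tgt, h.len, hF COLS (by decide), hF ROWS (by decide), hF ROWPOT (by decide),
      hF COLPOT (by decide), Nat.cast_add, Nat.cast_one]
    refine ⟨fun h1 => ⟨fun h2 => ?_, fun h2 => ⟨fun h3 => ⟨fun h4 => ?_, fun h4 => ?_⟩,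
      fun h3 => ?_⟩⟩, fun h1 => ?_⟩
    all_goals refine ⟨by simp [hv], by simp [hF], ?_⟩
    all_goals simp [hv]
    · exact keep fun _ h => absurd h2 h
    · exact take (hE h1) h1 h2 fun _ => by simpa using h4
    · exact keep fun _ _ => ⟨h3, by simpa using h4⟩
    · exact take (hE h1) h1 h2 fun h => absurd h h3
    · exact keep fun h => absurd h h1

theorem wp_adjust (hn : G.n ≤ X) (hG : σ IN 2 = G.n)
    (hS : ∀ x, 0 < σ ROWS x → 0 ≤ x ∧ x < G.n) (hT : ∀ v, 0 < σ COLS v → 0 ≤ v ∧ v < G.n) :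
    wp X Prog.adjust σ fun τ => Frame [ROWPOT, COLPOT, vV] σ τ ∧
      (∀ x, τ ROWPOT x = if 0 < σ ROWS x then σ ROWPOT x + σ vDelta 0 else σ ROWPOT x) ∧
      ∀ v, τ COLPOT v = if 0 < σ COLS v then σ COLPOT v + σ vDelta 0 else σ COLPOT v := by
  refine wp_forLoop (fun k τ => Frame [ROWPOT, COLPOT, vV] σ τ ∧
    (∀ x, τ ROWPOT x =
      if 0 < σ ROWS x ∧ x < k then σ ROWPOT x + σ vDelta 0 else σ ROWPOT x) ∧
    ∀ v, τ COLPOT v = if 0 < σ COLS v ∧ v < k then σ COLPOT v + σ vDelta 0 else σ COLPOT v)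
    G.n hn ?_ ?_ ?_ ?_
  · refine ⟨(Frame.refl _ _).store (by decide) _ _, fun x => ?_, fun v => ?_⟩
    · rw [if_neg fun h => by have := hS x h.1; omega]
      simp
    · rw [if_neg fun h => by have := hT v h.1; omega]
      simp
  · rintro k τ - ⟨hF, -⟩
    simp [hF IN (by decide), hG]
  · rintro k τ hk ⟨hF, hA, hB⟩ hv
    simp only [wp, Expr.eval_add, Expr.eval_get, Expr.eval_zero, hv, hF COLS (by decide)]
    refine ⟨fun h1 => ?_, fun h1 => ?_⟩
    all_goals
      simp only [Mem.store_self, Mem.store_of_ne, ne_eq, Nat.reduceEqDiff,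
        not_false_eq_true, hv, hF ROWS (by decide), hF vDelta (by decide), frame_store_iff,
        List.mem_cons, true_or, or_true, hF, true_and]
      refine ⟨fun h2 => ⟨fun x => ?_, fun v => ?_⟩, fun h2 => ⟨fun x => ?_, fun v => ?_⟩⟩
      all_goals grind
  · rintro τ ⟨hF, hA, hB⟩
    refine ⟨hF, fun x => ?_, fun v => ?_⟩
    · rw [hA]
      exact if_congr (and_iff_left_of_imp fun h => (hS x h).2) rfl rfl
    · rw [hB]
      exact if_congr (and_iff_left_of_imp fun h => (hT v h).2) rfl rfl

/-- The potentials and the assignment in the memory are in order, and the columns in `U` are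
assigned. -/
def Valid (G : Assignment) (U : ℤ → Prop) (σ : Mem) : Prop :=
  G.IsPotential (σ ROWPOT) (σ COLPOT) ∧
    G.IsMatching (σ ROWPOT) (σ COLPOT) U G.root (σ PIN) (σ MATE)

/-- The memory holds an alternating tree for the column `t`. -/
def HasTree (G : Assignment) (t : ℤ) (σ : Mem) : Prop :=
  ∃ rk c, G.IsTree (σ ROWPOT) (σ COLPOT) t (σ MATE) (0 < σ ROWS ·) (0 < σ COLS ·) (σ WAY) rk c

/-- The memory holds a way from the root to the column `t`. -/
def HasWay (G : Assignment) (t : ℤ) (σ : Mem) : Prop :=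
  ∃ (rk : ℤ → ℕ) (S : ℤ → Prop), (∀ x, S x → G.IsRow x) ∧
    ∀ x, S x ∨ x = G.root → G.Leads (σ ROWPOT) (σ COLPOT) t (σ MATE) S (σ WAY) rk x

open Classical in
/-- The number of rows outside the tree, which bounds the number of times that it can still grow. -/
noncomputable def numFree (G : Assignment) (σ : Mem) : ℕ :=
  (G.rows.filter fun x => ¬ 0 < σ ROWS x).card

/-- Marks of rows and columns occur in the range of the indices only. -/
def Clean (G : Assignment) (σ : Mem) : Prop :=
  (∀ x, 0 < σ ROWS x → 0 ≤ x ∧ x < G.n) ∧ ∀ v, 0 < σ COLS v → 0 ≤ v ∧ v < G.n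

variable {U : ℤ → Prop} {t : ℤ}

theorem HasTree.clean (hT : G.HasTree t σ) (hV : G.Valid U σ) (ht : G.IsCol t) : G.Clean σ := by
  obtain ⟨rk, c, hT⟩ := hT
  refine ⟨fun x hx => ⟨(hT.isRow x hx).1.1, (hT.isRow x hx).1.2.1⟩, fun v hv => ?_⟩
  obtain rfl | ⟨x, hx, rfl⟩ := (hT.mem_iff v).1 hv
  · exact ⟨ht.1, ht.2.1⟩
  · have := hV.2.isCol (hV.2.mate_mem x (hT.isRow x hx) (hT.isRow x hx).1.2.2)
    exact ⟨this.1, this.2.1⟩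

/-- A step extends the tree by a row that is not the root, or finds that the tree cannot be
extended, or completes a way from the root to `t`. -/
theorem wp_growStep (hG : G.Describes m σ) (hX : G.E ≤ X) (hn : G.n ≤ X) (hV : G.Valid U σ)
    (ht : G.IsCol t) (htU : ¬ U t) (hT : G.HasTree t σ) (hd : σ vDone 0 = 0)
    (hf : σ vFail 0 = 0) :
    wp X Prog.growStep σ fun τ =>
      Frame [vE, vAcc, vBest, vDelta, vV, vRow, vDone, vFail, ROWPOT, COLPOT, ROWS, COLS, WAY]
        σ τ ∧ G.Valid U τ ∧
      ((τ vDone 0 = 0 ∧ τ vFail 0 = 0 ∧ G.HasTree t τ ∧ G.numFree τ < G.numFree σ) ∨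
        (τ vDone 0 = 0 ∧ τ vFail 0 = 1 ∧ ∀ p, ¬ G.IsPerfect p) ∨
        (τ vDone 0 = 1 ∧ τ vFail 0 = 0 ∧ G.Clean τ ∧ G.HasWay t τ)) := by
  obtain ⟨hrows, hcols⟩ := hT.clean hV ht
  obtain ⟨rk, c, hT⟩ := hT
  obtain ⟨hP, hM⟩ := hV
  unfold Prog.growStep
  refine wp_seq (wp_search hG hX fun v hv => (hcols v hv).1) ?_
  rintro τ ⟨hF, hI⟩
  refine ⟨fun hb => ?_, fun hb => ?_⟩
  · simp only [Expr.eval_get, Expr.eval_zero] at hb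
    obtain ⟨h0, -⟩ | ⟨e, hbe, he, hTe, hSe, hδ, hmin⟩ := hI
    · omega
    have hC := hF COLS (by decide)
    have hR := hF ROWS (by decide)
    refine wp_seq (wp_adjust hn (by rw [hF IN (by decide), hG.n]) (by rwa [hR])
      (by rwa [hC])) ?_
    rintro τ' ⟨hF', hA, hB⟩
    rw [hC, hF COLPOT (by decide)] at hB
    rw [hR, hF ROWPOT (by decide)] at hA
    have hG' : G.Describes m τ' := (hG.frame hF (by decide) (by decide) (by decide)
      (by decide)).frame hF' (by decide) (by decide) (by decide) (by decide)
    have hFF : Frame [vE, vAcc, vBest, vDelta, vV, vRow, vDone, vFail, ROWPOT, COLPOT, ROWS, COLS,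
      WAY] σ τ' := fun a ha => by
      simp only [List.mem_cons, not_or] at ha
      rw [hF' a (by simp [ha]), hF a (by simp [ha])]
    have hC' : τ' COLS = σ COLS := (hF' _ (by decide)).trans hC
    have hR' : τ' ROWS = σ ROWS := (hF' _ (by decide)).trans hR
    have hW' : τ' WAY = σ WAY := (hF' _ (by decide)).trans (hF _ (by decide))
    have hM' : τ' MATE = σ MATE := hFF _ (by decide)
    have hPin : τ' PIN = σ PIN := hFF _ (by decide)
    have hd' : τ' vDone 0 = 0 := by rw [hF' _ (by decide), hF _ (by decide), hd]
    have hf' : τ' vFail 0 = 0 := by rw [hF' _ (by decide), hF _ (by decide), hf]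
    have hbe' : τ' vBest 0 = e + 1 := by rw [hF' _ (by decide), hbe]
    have hA1 : ∀ x, 0 < σ ROWS x → τ' ROWPOT x = σ ROWPOT x + τ vDelta 0 := fun x hx => by
      rw [hA, if_pos hx]
    have hA2 : ∀ x, ¬ 0 < σ ROWS x → τ' ROWPOT x = σ ROWPOT x := fun x hx => by
      rw [hA, if_neg hx]
    have hB1 : ∀ x, 0 < σ COLS x → τ' COLPOT x = σ COLPOT x + τ vDelta 0 := fun x hx => by
      rw [hB, if_pos hx]
    have hB2 : ∀ x, ¬ 0 < σ COLS x → τ' COLPOT x = σ COLPOT x := fun x hx => by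
      rw [hB, if_neg hx]
    have hδ0 : 0 ≤ τ vDelta 0 := by
      have := hP.le e he
      omega
    have hP' := hP.adjust hT hδ0 (fun e he => hmin e he he.2.1) hA1 hA2 hB1 hB2
    have hMat := hM.adjust htU hT hA1 hA2 hB1 hB2
    have hT' := hT.adjust hA1 hB1
    have htight : G.IsTight (τ' ROWPOT) (τ' COLPOT) e :=
      ⟨he, by rw [hA2 _ hSe, hB1 _ hTe]; omega⟩
    simp only [wp, Expr.eval_get, Expr.eval_sub, Expr.eval_mul, Expr.eval_zero, Expr.eval_one,
      Expr.eval_ofNat, Mem.store_self, Mem.store_of_ne, Function.update_self, ne_eq,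
      Nat.reduceEqDiff, not_false_eq_true, Nat.cast_ofNat, hbe', hG'.src,
      hG'.root, add_sub_cancel_right, mul_self_pos, sub_eq_zero, hM', OfNat.zero_ne_ofNat]
    refine ⟨fun hr => ⟨by simp [hFF], by simp [Valid, hPin, hM', hP', hMat],
      .inl ⟨by simp [hd'], by simp [hf'], ?_, ?_⟩⟩, fun hr => ⟨by simp [hFF],
      by simp [Valid, hPin, hM', hP', hMat], .inr (.inr ⟨by simp, by simp [hf'], ?_, ?_⟩)⟩⟩
    · refine ⟨Function.update rk (G.src e) c, c + 1, ?_⟩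
      simp only [Mem.store_self, Mem.store_of_ne, ne_eq, Nat.reduceEqDiff, not_false_eq_true, hM',
        hW', hC', hR']
      exact hT'.extend htight hTe hSe hr (fun x => by grind) fun v => by grind
    · refine Finset.card_lt_card ((Finset.ssubset_iff_of_subset fun x => ?_).2
        ⟨G.src e, ?_, ?_⟩)
      · simp only [Finset.mem_filter, Mem.store_self, Mem.store_of_ne, ne_eq, Nat.reduceEqDiff,
          not_false_eq_true, hR']
        grind
      · rw [Finset.mem_filter, mem_rows]
        exact ⟨he.src_isRow hr, hSe⟩
      · simp
    · simpa [Clean, hC', hR'] using And.intro hrows hcols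
    · refine ⟨Function.update rk (G.src e) c, (0 < σ ROWS ·), hT'.isRow, ?_⟩
      simp only [Mem.store_self, Mem.store_of_ne, ne_eq, Nat.reduceEqDiff, not_false_eq_true, hM',
        hW']
      rw [not_not] at hr
      rw [← hr]
      exact hT'.leads_update htight hTe hSe fun x hx => hx
  · simp only [Expr.eval_get, Expr.eval_zero] at hb
    obtain ⟨-, hstuck⟩ | ⟨e, hbe, he, -⟩ := hI
    · have hV : G.Valid U τ := by
        unfold Valid
        rw [hF ROWPOT (by decide), hF COLPOT (by decide), hF PIN (by decide),
          hF MATE (by decide)]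
        exact ⟨hP, hM⟩
      refine ⟨?_, ?_, .inr (.inl ⟨?_, ?_,
        hT.not_isPerfect hM ht htU fun e he => hstuck e he he.2.1⟩)⟩
      · rw [frame_store_iff (by decide)]
        exact hF.mono (by decide)
      · simpa [Valid] using And.intro hV.1 hV.2
      · simp [hF vDone (by decide), hd]
      · simp
    · have := he.1
      omega

theorem wp_initTree (hn : G.n ≤ X) (hG : σ IN 2 = G.n) (hσ : G.Clean σ)
    (ht : σ IN (6 + σ vK 0) = t) :
    wp X Prog.initTree σ fun τ => Frame [ROWS, COLS, vV, vDone] σ τ ∧ τ vDone 0 = 0 ∧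
      (∀ x, ¬ 0 < τ ROWS x) ∧ ∀ v, 0 < τ COLS v ↔ v = t := by
  unfold Prog.initTree
  refine wp_seq (R := fun τ => Frame [ROWS, COLS, vV] σ τ ∧ (∀ x, ¬ 0 < τ ROWS x) ∧
    ∀ v, ¬ 0 < τ COLS v) ?_ ?_
  · refine wp_forLoop (fun k τ => Frame [ROWS, COLS, vV] σ τ ∧
      (∀ x, 0 < τ ROWS x → k ≤ x ∧ x < G.n) ∧ ∀ v, 0 < τ COLS v → k ≤ v ∧ v < G.n) G.n hn
      ?_ ?_ ?_ ?_
    · simpa [Frame.refl] using And.intro hσ.1 hσ.2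
    · rintro k τ - ⟨hF, -⟩
      simp [hF IN (by decide), hG]
    · rintro k τ hk ⟨hF, h1, h2⟩ hv
      simp only [wp, Expr.eval_get, Expr.eval_zero, hv, Mem.store_self, Mem.store_of_ne, ne_eq,
        Nat.reduceEqDiff, not_false_eq_true, frame_store_iff, List.mem_cons, true_or, or_true, hF,
        true_and]
      refine ⟨fun x => ?_, fun x => ?_⟩
      all_goals
        have h1x := h1 x
        have h2x := h2 x
        rw [Function.update_apply]
        push_cast
        split <;> omega
    · rintro τ ⟨hF, h1, h2⟩
      exact ⟨hF, fun x hx => by have := h1 x hx; omega, fun x hx => by have := h2 x hx; omega⟩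
  · rintro τ ⟨hF, h1, h2⟩
    have hF' : Frame [ROWS, COLS, vV, vDone] σ τ := hF.mono (by decide)
    simp only [wp, Expr.eval_add, Expr.eval_get, Expr.eval_zero, Expr.eval_one, Expr.eval_ofNat,
      Nat.cast_ofNat, hF vK (by decide), hF IN (by decide), ht]
    refine ⟨by simp [hF'], by simp, by simpa using h1, fun v => ?_⟩
    have := h2 v
    simp only [Mem.store_self, Mem.store_of_ne, ne_eq, Nat.reduceEqDiff, not_false_eq_true]
    rw [Function.update_apply]
    split <;> simp_all

theorem card_rows_le : G.rows.card ≤ G.n := by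
  classical
  unfold rows
  exact (Finset.card_filter_le _ _).trans (by simp)

theorem numFree_le : G.numFree σ ≤ G.n := (Finset.card_filter_le _ _).trans card_rows_le

/-- The augmentation along the way from the root assigns the column `t`. At any time the row `x` in
progress is without a column, and the rest of the way consists of rows of lower rank. -/
theorem wp_augment (hG : G.Describes m σ) (hn : G.n + 1 ≤ X) (hV : G.Valid U σ)
    (hW : G.HasWay t σ) (htU : ¬ U t) (ht : σ IN (6 + σ vK 0) = t) :
    wp X Prog.augment σ fun τ => Frame [PIN, MATE, vE, vDone, vRow, vCol, vNext] σ τ ∧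
      G.Valid (fun v => U v ∨ v = t) τ := by
  classical
  obtain ⟨rk, S, hS, hW⟩ := hW
  obtain ⟨hP, hM⟩ := hV
  unfold Prog.augment
  set below : ℤ → Finset ℤ := fun x => G.rows.filter fun y => S y ∧ rk y < rk x with hbelow
  refine wp_loop (fun j τ => Frame [PIN, MATE, vE, vDone, vRow, vCol, vNext] σ τ ∧
    ((τ vDone 0 = 0 ∧ G.Valid (fun v => U v ∨ v = t) τ) ∨
      ∃ x, τ vDone 0 = 1 ∧ τ vRow 0 = x ∧ (S x ∨ x = G.root) ∧ j = (below x).card + 1 ∧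
        G.IsMatching (σ ROWPOT) (σ COLPOT) U x (τ PIN) (τ MATE) ∧
        ∀ z, (S z ∨ z = G.root) → rk z ≤ rk x →
          G.Leads (σ ROWPOT) (σ COLPOT) t (τ MATE) S (σ WAY) rk z))
    ((below G.root).card + 1) ?_ ?_ ?_ ?_
  · have := (Finset.card_filter_le G.rows fun y => S y ∧ rk y < rk G.root).trans card_rows_le
    simp only [hbelow]
    omega
  · simpa [Frame.refl, hG.root, hM] using fun z hz _ => hW z hz
  · rintro j τ ⟨hF, h⟩ hpos
    simp only [Expr.eval_get, Expr.eval_zero] at hpos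
    obtain ⟨h, -⟩ | ⟨x, hdone, hrow, hx, rfl, hM', hlead⟩ := h
    · omega
    have hG' := hG.frame hF (by decide) (by decide) (by decide) (by decide)
    have hl := hlead x hx le_rfl
    simp only [wp, Expr.eval_add, Expr.eval_get, Expr.eval_sub, Expr.eval_mul, Expr.eval_zero,
      Expr.eval_ofNat, Mem.store_self, Mem.store_of_ne, Function.update_self, ne_eq,
      Nat.reduceEqDiff, not_false_eq_true, Nat.cast_ofNat, hG'.src, hG'.tgt,
      mul_self_pos, sub_eq_zero, OfNat.zero_ne_ofNat, hrow, hF WAY (by decide), hF IN (by decide),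
      hF vK (by decide), ht]
    refine ⟨fun hne => ?_, fun heq => ?_⟩
    · obtain h | ⟨y, hy, hlt, hmate⟩ := hl.2.2
      · exact absurd h hne
      have hyx : y ≠ x := by rintro rfl; omega
      have hsrc := hM'.src_pin y (hS y hy) hyx
      rw [hmate] at hsrc
      rw [hsrc]
      refine ⟨(below y).card + 1, ?_, by simp [hF],
        .inr ⟨y, by simp [hdone], by simp, .inl hy, rfl, ?_, ?_⟩⟩
      · refine Nat.succ_lt_succ (Finset.card_lt_card ((Finset.ssubset_iff_of_subset
          fun z => ?_).2 ⟨y, ?_, ?_⟩))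
        · simp only [hbelow, Finset.mem_filter]
          exact fun h => ⟨h.1, h.2.1, h.2.2.trans hlt⟩
        · simp only [hbelow, Finset.mem_filter, mem_rows]
          exact ⟨hS y hy, hy, hlt⟩
        · simp [hbelow]
      · simpa using hM'.augment_step hl (hS y hy) hyx hmate
      · simpa using fun z hz hzy => (hlead z hz (hzy.trans hlt.le)).update_mate
          (hzy.trans hlt.le) _
    · rw [not_not] at heq
      refine ⟨0, by omega, by simp [hF], .inl ⟨by simp, ?_⟩⟩
      simp only [Valid, Mem.store_self, Mem.store_of_ne, ne_eq, Nat.reduceEqDiff,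
        not_false_eq_true, hF ROWPOT (by decide), hF COLPOT (by decide), heq]
      exact ⟨hP, hM'.augment_last htU hl heq fun v => Iff.rfl⟩
  · rintro j τ ⟨hF, h⟩ hpos
    simp only [Expr.eval_get, Expr.eval_zero] at hpos
    refine ⟨hF, ?_⟩
    obtain ⟨-, h⟩ | ⟨x, hdone, hrow, hx, rfl, hM', hlead⟩ := h
    · exact h
    · omega

theorem Valid.congr {U' : ℤ → Prop} (h : G.Valid U σ) (hU : ∀ v, U v ↔ U' v) :
    G.Valid U' σ := by
  obtain rfl : U = U' := funext fun v => propext (hU v)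
  exact h

theorem Valid.frame (h : G.Valid U σ) {L : List ℕ} (hF : Frame L σ τ) (hP : PIN ∉ L)
    (hM : MATE ∉ L) (hA : ROWPOT ∉ L) (hB : COLPOT ∉ L) : G.Valid U τ := by
  unfold Valid
  rw [hF _ hP, hF _ hM, hF _ hA, hF _ hB]
  exact h

/-- The tree grows until it contains the root, or cannot grow; in the latter case there is no
perfect assignment. -/
theorem wp_grow (hG : G.Describes m σ) (hX : G.E ≤ X) (hn : G.n + 1 ≤ X) (hV : G.Valid U σ)
    (ht : G.IsCol t) (htU : ¬ U t) (hT : G.HasTree t σ) (hd : σ vDone 0 = 0)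
    (hf : σ vFail 0 = 0) :
    wp X (.loop (1 - Prog.var vDone - Prog.var vFail) Prog.growStep) σ fun τ =>
      Frame [vE, vAcc, vBest, vDelta, vV, vRow, vDone, vFail, ROWPOT, COLPOT, ROWS, COLS, WAY]
        σ τ ∧ G.Valid U τ ∧
      ((τ vFail 0 = 1 ∧ ∀ p, ¬ G.IsPerfect p) ∨
        (τ vFail 0 = 0 ∧ G.Clean τ ∧ G.HasWay t τ)) := by
  refine wp_loop (fun j τ =>
    Frame [vE, vAcc, vBest, vDelta, vV, vRow, vDone, vFail, ROWPOT, COLPOT, ROWS, COLS, WAY]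
      σ τ ∧ G.Valid U τ ∧
    ((τ vDone 0 = 0 ∧ τ vFail 0 = 0 ∧ G.HasTree t τ ∧ j = G.numFree τ + 1) ∨
      (τ vDone 0 = 0 ∧ τ vFail 0 = 1 ∧ ∀ p, ¬ G.IsPerfect p) ∨
      (τ vDone 0 = 1 ∧ τ vFail 0 = 0 ∧ G.Clean τ ∧ G.HasWay t τ)))
    (G.numFree σ + 1) ?_ ⟨Frame.refl _ _, hV, .inl ⟨hd, hf, hT, rfl⟩⟩ ?_ ?_
  · have := numFree_le (G := G) (σ := σ)
    omega
  · rintro j τ ⟨hF, hV', ⟨hd', hf', hT', rfl⟩ | ⟨h1, h2, -⟩ | ⟨h1, h2, -⟩⟩ hpos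
    · refine wp_mono (wp_growStep (hG.frame hF (by decide) (by decide) (by decide) (by decide)) hX
        (by omega) hV' ht htU hT' hd' hf') ?_
      rintro ρ ⟨hF', hVρ, h⟩
      have hFF := hF.trans hF' (List.Subset.refl _)
      obtain ⟨h1, h2, h3, h4⟩ | h | h := h
      · exact ⟨G.numFree ρ + 1, by omega, hFF, hVρ, .inl ⟨h1, h2, h3, rfl⟩⟩
      · exact ⟨0, by omega, hFF, hVρ, .inr (.inl h)⟩
      · exact ⟨0, by omega, hFF, hVρ, .inr (.inr h)⟩
    · simp only [Expr.eval_sub, Expr.eval_get, Expr.eval_zero, Expr.eval_one] at hpos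
      omega
    · simp only [Expr.eval_sub, Expr.eval_get, Expr.eval_zero, Expr.eval_one] at hpos
      omega
  · rintro j τ ⟨hF, hV', ⟨hd', hf', hT', rfl⟩ | ⟨h1, h2, h3⟩ | ⟨h1, h2, h3⟩⟩ hpos
    · simp only [Expr.eval_sub, Expr.eval_get, Expr.eval_zero, Expr.eval_one] at hpos
      omega
    · exact ⟨hF, hV', .inl ⟨h2, h3⟩⟩
    · exact ⟨hF, hV', .inr ⟨h2, h3⟩⟩

/-- One stage assigns one more column `t`, unless there is no perfect assignment. -/
theorem wp_stage (hG : G.Describes m σ) (hX : G.E ≤ X) (hn : G.n + 1 ≤ X) (hV : G.Valid U σ)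
    (ht : σ IN (6 + σ vK 0) = t) (htc : G.IsCol t) (htU : ¬ U t) (hσ : G.Clean σ)
    (hf : σ vFail 0 = 0) :
    wp X Prog.stage σ fun τ =>
      Frame [vE, vAcc, vBest, vDelta, vV, vRow, vDone, vFail, ROWPOT, COLPOT, ROWS, COLS, WAY,
        PIN, MATE, vCol, vNext] σ τ ∧
      ((τ vFail 0 = 1 ∧ ∀ p, ¬ G.IsPerfect p) ∨
        (τ vFail 0 = 0 ∧ G.Clean τ ∧ G.Valid (fun v => U v ∨ v = t) τ)) := by
  unfold Prog.stage
  refine wp_seq (wp_initTree (by omega) hG.n hσ ht) ?_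
  rintro τ ⟨hF, hd, hR, hC⟩
  have hG' := hG.frame hF (by decide) (by decide) (by decide) (by decide)
  refine wp_seq (wp_grow hG' hX hn
    (hV.frame hF (by decide) (by decide) (by decide) (by decide)) htc htU
    ⟨_, _, isTree_singleton G _ _ t _ _ hR hC⟩ hd (by rw [hF _ (by decide), hf])) ?_
  rintro ρ ⟨hF', hV', hρ⟩
  have hFF : Frame [vE, vAcc, vBest, vDelta, vV, vRow, vDone, vFail, ROWPOT, COLPOT, ROWS, COLS,
      WAY, PIN, MATE, vCol, vNext] σ ρ := (hF.mono (by decide)).trans hF' (by decide)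
  refine ⟨fun hpos => ?_, fun hpos => ?_⟩
  · simp only [Expr.eval_get, Expr.eval_zero] at hpos
    obtain h | h := hρ
    · exact ⟨hFF, .inl h⟩
    · omega
  · simp only [Expr.eval_get, Expr.eval_zero] at hpos
    obtain h | ⟨h1, h2, h3⟩ := hρ
    · omega
    refine wp_mono (wp_augment (hG'.frame hF' (by decide) (by decide) (by decide) (by decide)) hn
      hV' h3 htU ?_) ?_
    · rw [hFF IN (by decide), hFF vK (by decide), ht]
    · rintro ρ' ⟨hF'', hV''⟩
      refine ⟨hFF.trans hF'' (by decide), .inr ⟨?_, ?_, hV''⟩⟩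
      · rw [hF'' _ (by decide), h1]
      · unfold Clean
        rw [hF'' ROWS (by decide), hF'' COLS (by decide)]
        exact h2

/-- Stage `k` assigns an edge to the `k`-th terminal. -/
theorem wp_stages {K : ℕ} {term : ℕ → ℤ} (hG : G.Describes m σ) (hX : G.E ≤ X)
    (hn : G.n + 1 ≤ X) (hKX : K ≤ X) (hK : σ IN 4 = K)
    (hterm : ∀ k < K, σ IN (6 + (k : ℤ)) = term k) (hcol : ∀ k < K, G.IsCol (term k))
    (hinj : ∀ j < K, ∀ k < K, term j = term k → j = k)
    (hV : G.Valid (fun v => G.IsCol v ∧ ∀ k < K, v ≠ term k) σ)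
    (hσ : G.Clean σ) (hf : σ vFail 0 = 0) :
    wp X Prog.stages σ fun τ =>
      Frame [vE, vAcc, vBest, vDelta, vV, vRow, vDone, vFail, ROWPOT, COLPOT, ROWS, COLS, WAY,
        PIN, MATE, vCol, vNext, vK] σ τ ∧
      ((τ vFail 0 = 1 ∧ ∀ p, ¬ G.IsPerfect p) ∨ (τ vFail 0 = 0 ∧ G.Valid G.IsCol τ)) := by
  refine wp_forLoop (fun k τ =>
    Frame [vE, vAcc, vBest, vDelta, vV, vRow, vDone, vFail, ROWPOT, COLPOT, ROWS, COLS, WAY,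
        PIN, MATE, vCol, vNext, vK] σ τ ∧
      ((τ vFail 0 = 1 ∧ ∀ p, ¬ G.IsPerfect p) ∨ (τ vFail 0 = 0 ∧ G.Clean τ ∧
        G.Valid (fun v => G.IsCol v ∧ ∀ i < K, k ≤ i → v ≠ term i) τ))) K hKX ?_ ?_ ?_ ?_
  · refine ⟨by simp [Frame.refl], .inr ⟨by simp [hf], by simpa [Clean] using And.intro hσ.1 hσ.2,
      ?_⟩⟩
    simpa [Valid] using And.intro hV.1 hV.2
  · rintro k τ - ⟨hF, -⟩
    simp [hF IN (by decide), hK]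
  · rintro k τ hk ⟨hF, h⟩ hv
    refine ⟨fun hpos => ?_, fun hpos => ?_⟩
    · simp only [Expr.eval_get, Expr.eval_zero] at hpos
      obtain h | h := h
      · exact ⟨hv, by simp [hF], .inl (by simpa using h)⟩
      · omega
    · simp only [Expr.eval_get, Expr.eval_zero] at hpos
      obtain h | ⟨h1, h2, h3⟩ := h
      · omega
      refine wp_mono (wp_stage (t := term k)
        (hG.frame hF (by decide) (by decide) (by decide) (by decide)) hX hn h3
        (by rw [hF IN (by decide), hv, hterm k hk]) (hcol k hk)
        (fun h => h.2 k hk le_rfl rfl) h2 h1) ?_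
      rintro ρ ⟨hF', h⟩
      refine ⟨by rw [hF' _ (by decide), hv], ?_, ?_⟩
      · rw [frame_store_iff (by decide)]
        exact hF.trans hF' (by decide)
      · refine h.imp (fun h => by simpa using h) fun ⟨h1, h2, h3⟩ => ⟨by simpa using h1,
          by simpa [Clean] using And.intro h2.1 h2.2, ?_⟩
        have h4 := h3.congr (U' := fun v => G.IsCol v ∧ ∀ i < K, k + 1 ≤ i → v ≠ term i)
          fun v => ?_
        · simpa [Valid] using And.intro h4.1 h4.2
        · constructor
          · rintro (⟨h, h'⟩ | rfl)
            · exact ⟨h, fun i hi hki => h' i hi (by omega)⟩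
            · exact ⟨hcol k hk, fun i hi hki h => by have := hinj k hk i hi h; omega⟩
          · rintro ⟨h, h'⟩
            by_cases hvk : v = term k
            · exact .inr hvk
            · refine .inl ⟨h, fun i hi hki => ?_⟩
              obtain rfl | hne := eq_or_ne i k
              · exact hvk
              · exact h' i hi (by omega)
  · rintro τ ⟨hF, h⟩
    refine ⟨hF, h.imp id fun ⟨h1, h2, h3⟩ => ⟨h1, h3.congr fun v => ?_⟩⟩
    exact ⟨fun h => h.1, fun h => ⟨h, fun i hi hKi => by omega⟩⟩

end Assignment

/-! ### Setting up the assignment problem -/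

namespace Prog

/-- Enter the arcs of the graph as edges `2 * e` (forwards) and `2 * e + 1` (backwards). The length
of `e` is multiplied by the product of all denominators, which makes it an integer. -/
def enterArcs : Prog :=
  forLoop vE inM
    (assign vAcc (inEdge vE 2) ;;
      forLoop vF inM
        (.cond (differ (var vF) (var vE)) (assign vAcc (var vAcc * inEdge vF 3)) .skip) ;;
      .set SRC (var vE + var vE) (inEdge vE 0) ;;
      .set TGT (var vE + var vE) (inEdge vE 1) ;;
      .set LEN (var vE + var vE) (var vAcc) ;;
      .set SRC (var vE + var vE + 1) (inEdge vE 1) ;;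
      .set TGT (var vE + var vE + 1) (inEdge vE 0) ;;
      .set LEN (var vE + var vE + 1) (var vAcc) ;;
      .cond (.get IN 1) (.set TGT (var vE + var vE + 1) (.const (-1))) .skip)

/-- Mark the terminals. -/
def markTerminals : Prog := forLoop vK inK (.set TERM inTerm 1)

/-- Enter the edges `2 * m + v` of length `0` between the two copies of `v`, and begin with the
assignment by these edges. -/
def enterLoops : Prog :=
  forLoop vV inN
    (.set SRC (inM + inM + var vV) (var vV) ;;
      .set TGT (inM + inM + var vV) (var vV) ;;
      .set LEN (inM + inM + var vV) 0 ;;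
      .set PIN (var vV) (inM + inM + var vV) ;;
      .set MATE (var vV) (var vV))

/-- Delete the edges that start at a terminal or end at the root. -/
def deleteEdges : Prog :=
  forLoop vE numEdges
    (.cond (.get TERM (.get SRC (var vE))) (.set TGT (var vE) (.const (-1))) .skip ;;
      .cond (differ (.get TGT (var vE)) inRoot) .skip (.set TGT (var vE) (.const (-1))))

/-- Set up the assignment problem. -/
def prepare : Prog := enterArcs ;; markTerminals ;; enterLoops ;; deleteEdges

end Prog

namespace Inst

variable (I : Inst)

/-- The memory holds the instance. -/
structure IsHeld (σ : Mem) : Prop where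
  directed : σ IN 1 = if I.directed then 1 else 0
  n : σ IN 2 = I.n
  m : σ IN 3 = I.m
  K : σ IN 4 = I.K
  root : σ IN 5 = (I.root : ℕ)
  terminal : ∀ k : Fin I.K, σ IN (6 + (k : ℕ)) = (I.terminal k : ℕ)
  fst : ∀ e : Fin I.m, σ IN (6 + 0 + I.K + 5 * (e : ℕ)) = (I.fst e : ℕ)
  snd : ∀ e : Fin I.m, σ IN (6 + 1 + I.K + 5 * (e : ℕ)) = (I.snd e : ℕ)
  num : ∀ e : Fin I.m, σ IN (6 + 2 + I.K + 5 * (e : ℕ)) = (I.len e).num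
  den : ∀ e : Fin I.m, σ IN (6 + 3 + I.K + 5 * (e : ℕ)) = (I.len e).den

/-- The length of an edge, multiplied by the product of the denominators of all lengths. -/
def scaledLen (e : Fin I.m) : ℤ :=
  (I.len e).num * ∏ f : Fin I.m, if (f : ℕ) = e then 1 else ((I.len f).den : ℤ)

variable {I} {X : ℕ} {σ τ : Mem}

theorem IsHeld.frame (h : I.IsHeld σ) {L : List ℕ} (hF : Frame L σ τ) (h0 : IN ∉ L) :
    I.IsHeld τ := by
  have := hF IN h0
  constructor <;> rw [this]
  exacts [h.directed, h.n, h.m, h.K, h.root, h.terminal, h.fst, h.snd, h.num, h.den]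

/-- The edges for the first `k` edges of the graph have been entered. -/
def ArcsEntered (I : Inst) (k : ℕ) (τ : Mem) : Prop :=
  ∀ e : Fin I.m, (e : ℕ) < k →
    τ SRC ((e : ℤ) + e) = (I.fst e : ℕ) ∧ τ TGT ((e : ℤ) + e) = (I.snd e : ℕ) ∧
    τ LEN ((e : ℤ) + e) = I.scaledLen e ∧
    τ SRC ((e : ℤ) + e + 1) = (I.snd e : ℕ) ∧
    τ TGT ((e : ℤ) + e + 1) = (if I.directed then (-1 : ℤ) else (I.fst e : ℕ)) ∧
    τ LEN ((e : ℤ) + e + 1) = I.scaledLen e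

theorem wp_enterArcs (h : I.IsHeld σ) (hX : I.m ≤ X) :
    wp X Prog.enterArcs σ fun τ => Frame [SRC, TGT, LEN, vE, vF, vAcc] σ τ ∧
      I.ArcsEntered I.m τ := by
  refine wp_forLoop (fun k τ => Frame [SRC, TGT, LEN, vE, vF, vAcc] σ τ ∧ I.ArcsEntered k τ)
    I.m hX ⟨by simp [Frame.refl], fun e he => absurd he (by omega)⟩ ?_ ?_ fun τ h => h
  · rintro k τ - ⟨hF, -⟩
    simp [hF IN (by decide), h.m]
  · rintro k τ hk ⟨hF, hI⟩ hv
    have hnum := h.num ⟨k, hk⟩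
    refine wp_seq (R := fun τ' => Frame [vAcc] τ τ' ∧ τ' vAcc 0 = (I.len ⟨k, hk⟩).num) ?_ ?_
    · simp only [wp, Expr.eval_add, Expr.eval_mul, Expr.eval_get, Expr.eval_zero,
        Expr.eval_ofNat, Expr.eval_const, Nat.cast_ofNat, hF IN (by decide), h.K, hv]
      refine ⟨by simp [Frame.refl], ?_⟩
      simpa using hnum
    rintro τ₁ ⟨hF₁, hacc⟩
    have hv₁ : τ₁ vE 0 = k := by rw [hF₁ _ (by decide), hv]
    have hF₁' : Frame [SRC, TGT, LEN, vE, vF, vAcc] σ τ₁ := hF.trans hF₁ (by decide)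
    refine wp_seq (R := fun τ' => Frame [vF, vAcc] τ τ' ∧
      τ' vAcc 0 = I.scaledLen ⟨k, hk⟩) ?_ ?_
    · refine wp_forLoop (fun j τ' => Frame [vF, vAcc] τ τ' ∧ τ' vAcc 0 = (I.len ⟨k, hk⟩).num *
        ∏ i ∈ Finset.range j, if i = k then 1 else σ IN (6 + 3 + I.K + 5 * i)) I.m hX ?_ ?_ ?_ ?_
      · exact ⟨by simpa using hF₁.mono (by decide), by simp [hacc]⟩
      · rintro j τ' - ⟨hF', -⟩
        simp [hF' IN (by decide), hF IN (by decide), h.m]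
      · rintro j τ' hj ⟨hF', hI'⟩ hv'
        simp only [wp, Expr.eval_add, Expr.eval_sub, Expr.eval_mul, Expr.eval_get, Expr.eval_zero,
          Expr.eval_ofNat, Expr.eval_const, Nat.cast_ofNat, hF' IN (by decide), hF IN (by decide),
          hF' vE (by decide), h.K, hv, hv', mul_self_pos, sub_ne_zero]
        refine ⟨fun hne => ⟨by simp [hv'], by simp [hF'], ?_⟩, fun heq => ⟨trivial,
          by simp [hF'], ?_⟩⟩
        · rw [Finset.prod_range_succ, if_neg (by exact_mod_cast hne)]
          simp [hI', mul_assoc]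
        · rw [Finset.prod_range_succ, if_pos (by simpa using heq)]
          simp [hI']
      · rintro τ' ⟨hF', hI'⟩
        refine ⟨hF', hI'.trans ?_⟩
        rw [Finset.prod_range, scaledLen]
        simp only [h.den]
    rintro τ₂ ⟨hF₂, hacc₂⟩
    have hv₂ : τ₂ vE 0 = k := by rw [hF₂ _ (by decide), hv]
    have hF₂' : Frame [SRC, TGT, LEN, vE, vF, vAcc] σ τ₂ := hF.trans hF₂ (by decide)
    have hI₂ : I.ArcsEntered k τ₂ := by
      unfold ArcsEntered
      rw [hF₂ SRC (by decide), hF₂ TGT (by decide), hF₂ LEN (by decide)]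
      exact hI
    have hfst := h.fst ⟨k, hk⟩
    have hsnd := h.snd ⟨k, hk⟩
    simp only at hfst hsnd
    simp only [wp, Expr.eval_add, Expr.eval_mul, Expr.eval_get, Expr.eval_zero, Expr.eval_one,
      Expr.eval_ofNat, Expr.eval_const, Nat.cast_ofNat, Mem.store_of_ne, ne_eq,
      Nat.reduceEqDiff, not_false_eq_true, OfNat.zero_ne_ofNat, hF₂' IN (by decide), h.K, hv₂,
      hacc₂, hfst, hsnd, h.directed]
    refine ⟨fun hd => ⟨trivial, by simp [hF₂'], fun e he => ?_⟩,
      fun hd => ⟨trivial, by simp [hF₂'], fun e he => ?_⟩⟩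
    all_goals
      simp only [Mem.store_self, Mem.store_of_ne, ne_eq, Nat.reduceEqDiff, not_false_eq_true,
        Function.update_apply]
      obtain rfl | hne := eq_or_ne e ⟨k, hk⟩
      · cases hdir : I.directed <;> simp [hdir] at hd ⊢
      · have hek : (e : ℤ) ≠ k := fun h => hne (Fin.ext (by exact_mod_cast h))
        have := hI₂ e (by omega)
        grind

theorem wp_markTerminals (h : I.IsHeld σ) (hX : I.K ≤ X) (h0 : ∀ v, ¬ 0 < σ TERM v) :
    wp X Prog.markTerminals σ fun τ => Frame [TERM, vK] σ τ ∧
      ∀ v, 0 < τ TERM v ↔ ∃ k : Fin I.K, ((I.terminal k : ℕ) : ℤ) = v := by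
  refine wp_forLoop (fun k τ => Frame [TERM, vK] σ τ ∧
      ∀ v, 0 < τ TERM v ↔ ∃ i : Fin I.K, (i : ℕ) < k ∧ ((I.terminal i : ℕ) : ℤ) = v) I.K hX
      ?_ ?_ ?_ ?_
  · exact ⟨by simp [Frame.refl], fun v => by simpa using h0 v⟩
  · rintro k τ - ⟨hF, -⟩
    simp [hF IN (by decide), h.K]
  · rintro k τ hk ⟨hF, hI⟩ hv
    have hterm := h.terminal ⟨k, hk⟩
    simp only at hterm
    simp only [wp, Expr.eval_add, Expr.eval_get, Expr.eval_zero, Expr.eval_one, Expr.eval_ofNat,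
      Nat.cast_ofNat, hF IN (by decide), hv, hterm]
    refine ⟨by simp [hv], by simp [hF], fun v => ?_⟩
    simp only [Mem.store_self, Mem.store_of_ne, ne_eq, Nat.reduceEqDiff, not_false_eq_true,
      Function.update_apply]
    split
    · rename_i hv'
      simp only [Int.one_pos, true_iff]
      exact ⟨⟨k, hk⟩, by simp, hv'.symm⟩
    · rename_i hv'
      rw [hI]
      constructor
      · rintro ⟨i, hi, h⟩
        exact ⟨i, by omega, h⟩
      · rintro ⟨i, hi, h⟩
        refine ⟨i, lt_of_le_of_ne (by omega) fun hik => hv' ?_, h⟩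
        rw [← h, show i = ⟨k, hk⟩ from Fin.ext hik]
  · rintro τ ⟨hF, hI⟩
    exact ⟨hF, fun v => (hI v).trans (exists_congr fun k => and_iff_right k.2)⟩

theorem wp_enterLoops (h : I.IsHeld σ) (hX : I.n ≤ X) :
    wp X Prog.enterLoops σ fun τ => Frame [SRC, TGT, LEN, PIN, MATE, vV] σ τ ∧
      (∀ i : ℤ, i < I.m + I.m → τ SRC i = σ SRC i ∧ τ TGT i = σ TGT i ∧ τ LEN i = σ LEN i) ∧
      ∀ v : ℤ, 0 ≤ v → v < I.n → τ SRC (I.m + I.m + v) = v ∧ τ TGT (I.m + I.m + v) = v ∧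
        τ LEN (I.m + I.m + v) = 0 ∧ τ PIN v = I.m + I.m + v ∧ τ MATE v = v := by
  refine wp_forLoop (fun k τ => Frame [SRC, TGT, LEN, PIN, MATE, vV] σ τ ∧
      (∀ i : ℤ, i < I.m + I.m → τ SRC i = σ SRC i ∧ τ TGT i = σ TGT i ∧ τ LEN i = σ LEN i) ∧
      ∀ v : ℤ, 0 ≤ v → v < k → τ SRC (I.m + I.m + v) = v ∧ τ TGT (I.m + I.m + v) = v ∧
        τ LEN (I.m + I.m + v) = 0 ∧ τ PIN v = I.m + I.m + v ∧ τ MATE v = v) I.n hX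
      ?_ ?_ ?_ fun τ h => h
  · exact ⟨by simp [Frame.refl], fun i _ => by simp, fun v h0 h1 => by omega⟩
  · rintro k τ - ⟨hF, -⟩
    simp [hF IN (by decide), h.n]
  · rintro k τ hk ⟨hF, hI, hI'⟩ hv
    simp only [wp, Expr.eval_add, Expr.eval_get, Expr.eval_zero, Expr.eval_ofNat, Nat.cast_ofNat,
      Mem.store_of_ne, ne_eq, Nat.reduceEqDiff, not_false_eq_true, OfNat.zero_ne_ofNat,
      hF IN (by decide), h.m, hv]
    refine ⟨trivial, by simp [hF], fun i hi => ?_, fun v h0 h1 => ?_⟩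
    · have := hI i hi
      simp only [Mem.store_self, Mem.store_of_ne, ne_eq, Nat.reduceEqDiff, not_false_eq_true,
        Function.update_apply]
      grind
    · have := hI' v h0
      simp only [Mem.store_self, Mem.store_of_ne, ne_eq, Nat.reduceEqDiff, not_false_eq_true,
        Function.update_apply, add_right_inj]
      grind

theorem wp_deleteEdges (h : I.IsHeld σ) (hX : I.m + I.m + I.n ≤ X) :
    wp X Prog.deleteEdges σ fun τ => Frame [TGT, vE] σ τ ∧
      ∀ e : ℤ, 0 ≤ e → e < I.m + I.m + I.n → τ TGT e =
        if 0 < σ TERM (σ SRC e) ∨ σ TGT e = (I.root : ℕ) then -1 else σ TGT e := by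
  refine wp_forLoop (fun k τ => Frame [TGT, vE] σ τ ∧
      ∀ e : ℤ, 0 ≤ e → τ TGT e =
        if e < k ∧ (0 < σ TERM (σ SRC e) ∨ σ TGT e = (I.root : ℕ)) then -1 else σ TGT e)
      (I.m + I.m + I.n) hX ?_ ?_ ?_ ?_
  · exact ⟨by simp [Frame.refl], fun e he => by simp [he]⟩
  · rintro k τ - ⟨hF, -⟩
    simp [hF IN (by decide), h.m, h.n]
  · rintro k τ hk ⟨hF, hI⟩ hv
    have hk' := hI k (by omega)
    rw [if_neg (by omega)] at hk'
    simp only [wp, Expr.eval_mul, Expr.eval_sub, Expr.eval_get, Expr.eval_zero,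
      Expr.eval_const, Expr.eval_ofNat, Nat.cast_ofNat, Mem.store_self, Mem.store_of_ne, ne_eq,
      Nat.reduceEqDiff, not_false_eq_true, OfNat.zero_ne_ofNat, hF IN (by decide),
      hF TERM (by decide), hF SRC (by decide), Function.update_self, hk', hv, h.root,
      mul_self_pos, sub_eq_zero]
    refine ⟨fun h1 => ⟨fun h2 => ⟨trivial, by simp [hF], fun e he => ?_⟩,
      fun h2 => ⟨trivial, by simp [hF], fun e he => ?_⟩⟩,
      fun h1 => ⟨fun h2 => ⟨trivial, by simp [hF], fun e he => ?_⟩,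
      fun h2 => ⟨trivial, by simp [hF], fun e he => ?_⟩⟩⟩
    all_goals
      have := hI e he
      try simp only [Function.update_apply]
      grind
  · rintro τ ⟨hF, hI⟩
    refine ⟨hF, fun e h0 h1 => (hI e h0).trans (if_congr (and_iff_right ?_) rfl rfl)⟩
    push_cast
    exact h1

/-- The index of the edge of the assignment problem that represents an arc. -/
def arcIndex (a : I.Arc) : ℤ := (a.1 : ℤ) + (a.1 : ℕ) + if a.2 then 0 else 1

/-- The arcs that are kept as edges of the assignment problem. -/
def IsUsable (I : Inst) (a : I.Arc) : Prop :=
  I.IsArc a ∧ I.tgt a ≠ I.root ∧ ∀ k, I.src a ≠ I.terminal k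

open Classical in
/-- The memory describes the assignment problem that belongs to the instance. -/
structure IsPrepared (I : Inst) (τ : Mem) : Prop where
  src_arc : ∀ a : I.Arc, τ SRC (arcIndex a) = (I.src a : ℕ)
  tgt_arc : ∀ a : I.Arc, τ TGT (arcIndex a) = if I.IsUsable a then ((I.tgt a : ℕ) : ℤ) else -1
  len_arc : ∀ a : I.Arc, τ LEN (arcIndex a) = I.scaledLen a.1
  src_loop : ∀ v : Fin I.n, τ SRC (I.m + I.m + (v : ℕ)) = (v : ℕ)
  tgt_loop : ∀ v : Fin I.n, τ TGT (I.m + I.m + (v : ℕ)) =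
    if v ≠ I.root ∧ ∀ k, v ≠ I.terminal k then ((v : ℕ) : ℤ) else -1
  len_loop : ∀ v : Fin I.n, τ LEN (I.m + I.m + (v : ℕ)) = 0
  pin : ∀ v : Fin I.n, τ PIN (v : ℕ) = I.m + I.m + (v : ℕ)
  mate : ∀ v : Fin I.n, τ MATE (v : ℕ) = (v : ℕ)

theorem wp_prepare (h : I.IsHeld σ) (hX : I.m + I.m + I.n ≤ X) (hK : I.K ≤ X)
    (h0 : ∀ v, ¬ 0 < σ TERM v) :
    wp X Prog.prepare σ fun τ =>
      Frame [SRC, TGT, LEN, TERM, PIN, MATE, vE, vF, vV, vK, vAcc] σ τ ∧ I.IsPrepared τ := by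
  unfold Prog.prepare
  refine wp_seq (wp_enterArcs h (by omega)) ?_
  rintro τ₁ ⟨hF₁, hA⟩
  have h₁ := h.frame hF₁ (by decide)
  refine wp_seq (wp_markTerminals h₁ hK (by simpa [hF₁ TERM (by decide)] using h0)) ?_
  rintro τ₂ ⟨hF₂, hT⟩
  have h₂ := h₁.frame hF₂ (by decide)
  refine wp_seq (wp_enterLoops h₂ (by omega)) ?_
  rintro τ₃ ⟨hF₃, hL, hL'⟩
  have h₃ := h₂.frame hF₃ (by decide)
  refine wp_mono (wp_deleteEdges h₃ hX) ?_
  rintro τ₄ ⟨hF₄, hD⟩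
  refine ⟨(((hF₁.mono (by decide)).trans hF₂ (by decide)).trans hF₃ (by decide)).trans hF₄
    (by decide), ?_⟩
  rw [hF₂ SRC (by decide), hF₂ TGT (by decide), hF₂ LEN (by decide)] at hL
  rw [hF₃ TERM (by decide)] at hD
  have hroot : ∀ v : Fin I.n, ((v : ℕ) : ℤ) = (I.root : ℕ) ↔ v = I.root := fun v => by
    rw [Fin.ext_iff]; norm_cast
  have hterm : ∀ v : Fin I.n, 0 < τ₂ TERM (v : ℕ) ↔ ∃ k, v = I.terminal k := fun v => by
    rw [hT]
    refine exists_congr fun k => ?_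
    rw [Fin.ext_iff, eq_comm]; norm_cast
  have harc : ∀ a : I.Arc, τ₃ SRC (arcIndex a) = (I.src a : ℕ) ∧
      (τ₃ TGT (arcIndex a) = if I.IsArc a then ((I.tgt a : ℕ) : ℤ) else -1) ∧
      τ₃ LEN (arcIndex a) = I.scaledLen a.1 := by
    rintro ⟨e, b⟩
    obtain ⟨h1, h2, h3, h4, h5, h6⟩ := hA e e.2
    have he := e.2
    cases b
    · have hlt := hL ((e : ℤ) + (e : ℕ) + 1) (by omega)
      simp only [arcIndex, PreInst.src, PreInst.tgt, PreInst.IsArc, Bool.false_eq_true,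
        if_false, hlt, h4, h5, h6, imp_false, true_and, and_true]
      cases I.directed <;> simp
    · have hlt := hL ((e : ℤ) + (e : ℕ)) (by omega)
      simp [arcIndex, PreInst.src, PreInst.tgt, PreInst.IsArc, hlt, h1, h2, h3]
  have hrange : ∀ a : I.Arc, 0 ≤ arcIndex a ∧ arcIndex a < I.m + I.m + I.n := fun a => by
    have := a.1.2
    unfold arcIndex
    split <;> omega
  constructor
  · intro a
    rw [hF₄ SRC (by decide), (harc a).1]
  · intro a
    rw [hD _ (hrange a).1 (hrange a).2, (harc a).1, (harc a).2.1]
    simp only [hterm]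
    by_cases h1 : I.IsArc a <;> by_cases h2 : I.tgt a = I.root <;>
      by_cases h3 : ∃ k, I.src a = I.terminal k <;> simp_all [IsUsable]
  · intro a
    rw [hF₄ LEN (by decide), (harc a).2.2]
  · intro v
    rw [hF₄ SRC (by decide), (hL' v (by omega) (by omega)).1]
  · intro v
    rw [hD _ (by omega) (by omega), (hL' v (by omega) (by omega)).1,
      (hL' v (by omega) (by omega)).2.1]
    simp only [hterm, hroot]
    by_cases h2 : v = I.root <;>
      by_cases h3 : ∃ k, v = I.terminal k <;> simp_all
  · intro v
    rw [hF₄ LEN (by decide), (hL' v (by omega) (by omega)).2.2.1]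
  · intro v
    rw [hF₄ PIN (by decide), (hL' v (by omega) (by omega)).2.2.2.1]
  · intro v
    rw [hF₄ MATE (by decide), (hL' v (by omega) (by omega)).2.2.2.2]

end Inst

/-! ### Linkages and perfect assignments -/

namespace Inst

variable {I : Inst} {X : ℕ} {σ τ : Mem}

theorem arcIndex_nonneg (a : I.Arc) : 0 ≤ arcIndex a := by
  unfold arcIndex
  split <;> omega

theorem arcIndex_lt (a : I.Arc) : arcIndex a < I.m + I.m := by
  have := a.1.2
  unfold arcIndex
  split <;> omega

theorem arcIndex_injective : Function.Injective (arcIndex (I := I)) := by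
  rintro ⟨e, b⟩ ⟨f, c⟩ h
  simp only [arcIndex] at h
  have hef : e = f := Fin.ext (by split at h <;> split at h <;> omega)
  subst hef
  cases b <;> cases c <;> simp at h ⊢

theorem index_cases {e : ℤ} (h0 : 0 ≤ e) (h1 : e < I.m + I.m + I.n) :
    (∃ a : I.Arc, e = arcIndex a) ∨ ∃ v : Fin I.n, e = I.m + I.m + (v : ℕ) := by
  by_cases h : e < I.m + I.m
  · refine .inl ⟨(⟨(e / 2).toNat, by omega⟩, decide (e % 2 = 0)), ?_⟩
    simp only [arcIndex, decide_eq_true_eq]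
    split <;> omega
  · exact .inr ⟨⟨(e - (I.m + I.m)).toNat, by omega⟩, by simp only; omega⟩

theorem scaledLen_nonneg (e : Fin I.m) : 0 ≤ I.scaledLen e := by
  refine mul_nonneg (by positivity) (Finset.prod_nonneg fun f _ => ?_)
  split <;> positivity

theorem scaledLen_eq (e : Fin I.m) :
    (I.scaledLen e : ℚ) = I.len e * ∏ f, ((I.len f).den : ℚ) := by
  have h1 : ((I.len e : ℚ≥0) : ℚ) * (I.len e).den = (I.len e).num := by
    exact_mod_cast NNRat.mul_den_eq_num (I.len e)
  have h2 : ∏ f, ((I.len f).den : ℚ) =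
      (I.len e).den * ∏ f : Fin I.m, if (f : ℕ) = e then (1 : ℚ) else (I.len f).den := by
    rw [← Finset.mul_prod_erase _ _ (Finset.mem_univ e),
      ← Finset.mul_prod_erase (a := e) Finset.univ
        (fun f : Fin I.m => if (f : ℕ) = e then (1 : ℚ) else (I.len f).den) (Finset.mem_univ e)]
    simp only [if_true, one_mul]
    congr 1
    refine Finset.prod_congr rfl fun f hf => ?_
    rw [if_neg fun h => Finset.ne_of_mem_erase hf (Fin.ext h)]
  rw [h2, ← mul_assoc, h1, scaledLen]
  push_cast
  rfl

/-- Scaling the lengths does not change which of two arc sets is shorter. -/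
theorem length_le_length_iff {A B : Finset I.Arc} : I.length A ≤ I.length B ↔
    ∑ a ∈ A, I.scaledLen a.1 ≤ ∑ a ∈ B, I.scaledLen a.1 := by
  have h : ∀ A : Finset I.Arc, ((∑ a ∈ A, I.scaledLen a.1 : ℤ) : ℚ) =
      I.length A * ∏ f, ((I.len f).den : ℚ) := fun A => by
    rw [length]
    push_cast
    rw [Finset.sum_mul]
    exact Finset.sum_congr rfl fun a _ => scaledLen_eq a.1
  have hD : 0 < ∏ f, ((I.len f).den : ℚ) :=
    Finset.prod_pos fun f _ => by exact_mod_cast (I.len f).den_pos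
  rw [← Int.cast_le (R := ℚ), h, h, mul_le_mul_iff_left₀ hD]
  norm_cast

namespace IsPrepared

variable (hτ : I.IsPrepared τ)
include hτ

/-- The assignment problem that belongs to an instance: terminals have no row, since the paths end
there. -/
def assignment : Assignment where
  n := I.n
  E := I.m + I.m + I.n
  root := (I.root : ℕ)
  inner x := ∀ k, x ≠ (I.terminal k : ℕ)
  src := τ SRC
  tgt := τ TGT
  len := τ LEN
  tgt_col e h0 h1 h2 := by
    obtain ⟨a, rfl⟩ | ⟨v, rfl⟩ := index_cases h0 (by exact_mod_cast h1)
    · rw [hτ.tgt_arc] at h2 ⊢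
      split
      · rename_i h
        have := h.2.1
        rw [Ne, Fin.ext_iff] at this
        omega
      · rename_i h
        simp [h] at h2
    · rw [hτ.tgt_loop] at h2 ⊢
      split
      · rename_i h
        have := h.1
        rw [Ne, Fin.ext_iff] at this
        omega
      · rename_i h
        simp [h] at h2
  src_row e h0 h1 h2 := by
    obtain ⟨a, rfl⟩ | ⟨v, rfl⟩ := index_cases h0 (by exact_mod_cast h1)
    · rw [hτ.tgt_arc] at h2
      rw [hτ.src_arc]
      split at h2
      · rename_i h
        by_cases hr : I.src a = I.root
        · exact .inl (by rw [hr])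
        · refine .inr ⟨by omega, by omega, fun h => hr (Fin.ext (by omega)), fun k hk => ?_⟩
          exact h.2.2 k (Fin.ext (by omega))
      · omega
    · rw [hτ.tgt_loop] at h2
      rw [hτ.src_loop]
      split at h2
      · rename_i h
        refine .inr ⟨by omega, by omega, fun hr => h.1 (Fin.ext (by omega)), fun k hk => ?_⟩
        exact h.2 k (Fin.ext (by omega))
      · omega

theorem isEdge_arc {a : I.Arc} : hτ.assignment.IsEdge (arcIndex a) ↔ I.IsUsable a := by
  have h0 := arcIndex_nonneg a
  have h1 := arcIndex_lt a
  show (_ ∧ arcIndex a < ((I.m + I.m + I.n : ℕ) : ℤ) ∧ 0 ≤ τ TGT (arcIndex a)) ↔ _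
  rw [hτ.tgt_arc]
  split <;> simp_all
  omega

theorem isEdge_loop {v : Fin I.n} : hτ.assignment.IsEdge (I.m + I.m + (v : ℕ)) ↔
    v ≠ I.root ∧ ∀ k, v ≠ I.terminal k := by
  show (_ ∧ (I.m + I.m + (v : ℕ) : ℤ) < ((I.m + I.m + I.n : ℕ) : ℤ) ∧
    0 ≤ τ TGT (I.m + I.m + (v : ℕ))) ↔ _
  rw [hτ.tgt_loop]
  split
  · rename_i h
    exact iff_of_true ⟨by omega, by push_cast; omega, by omega⟩ h
  · rename_i h
    exact iff_of_false (fun h' => by omega) h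

theorem isCol_iff {z : ℤ} : hτ.assignment.IsCol z ↔ ∃ v : Fin I.n, v ≠ I.root ∧ z = (v : ℕ) := by
  constructor
  · rintro ⟨h0, h1, h2⟩
    have h1' : z < I.n := h1
    refine ⟨⟨z.toNat, by omega⟩, fun h => h2 ?_, by simp only; omega⟩
    show z = ((I.root : ℕ) : ℤ)
    rw [← h]
    simp only
    omega
  · rintro ⟨v, hv, rfl⟩
    refine ⟨by omega, by simp [assignment], fun h => hv (Fin.ext ?_)⟩
    have : ((v : ℕ) : ℤ) = (I.root : ℕ) := h
    omega

theorem isPotential_zero : hτ.assignment.IsPotential 0 0 := by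
  refine ⟨fun e he => ?_, rfl, fun x => le_rfl⟩
  have : 0 ≤ τ LEN e := by
    obtain ⟨a, rfl⟩ | ⟨v, rfl⟩ := index_cases he.1 (by exact_mod_cast he.2.1)
    · rw [hτ.len_arc]
      exact scaledLen_nonneg _
    · rw [hτ.len_loop]
  show 0 ≤ τ LEN e + 0
  rwa [add_zero]

/-- The edges between the two copies of a vertex form the initial assignment; all columns are
assigned except those of the terminals. -/
theorem isMatching_loops {U : ℤ → Prop}
    (hU : ∀ z, U z ↔ ∃ v : Fin I.n, (v ≠ I.root ∧ ∀ k, v ≠ I.terminal k) ∧ z = (v : ℕ)) :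
    hτ.assignment.IsMatching 0 0 U hτ.assignment.root (τ PIN) (τ MATE) := by
  have row : ∀ z, hτ.assignment.IsRow z →
      ∃ v : Fin I.n, (v ≠ I.root ∧ ∀ k, v ≠ I.terminal k) ∧ z = (v : ℕ) := fun z hz => by
    obtain ⟨v, hv, rfl⟩ := hτ.isCol_iff.1 hz.1
    exact ⟨v, ⟨hv, fun k hk => hz.2 k (by rw [hk])⟩, rfl⟩
  constructor
  · intro z hz
    obtain ⟨v, hv, rfl⟩ := (hU z).1 hz
    rw [hτ.pin]
    refine ⟨hτ.isEdge_loop.2 hv, ?_⟩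
    show τ LEN _ + 0 = 0
    rw [hτ.len_loop, add_zero]
  · intro z hz
    obtain ⟨v, hv, rfl⟩ := (hU z).1 hz
    show τ TGT _ = _
    rw [hτ.pin, hτ.tgt_loop, if_pos hv]
  · intro z hz _
    obtain ⟨v, hv, rfl⟩ := (hU z).1 hz
    show τ MATE (τ SRC _) = _
    rw [hτ.pin, hτ.src_loop, hτ.mate]
  · exact fun z _ h => h
  · intro z hz _
    obtain ⟨v, hv, rfl⟩ := row z hz
    rw [hτ.mate, hU]
    exact ⟨v, hv, rfl⟩
  · intro z hz _
    obtain ⟨v, hv, rfl⟩ := row z hz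
    show τ SRC _ = _
    rw [hτ.mate, hτ.pin, hτ.src_loop]

/-- A linkage yields a perfect assignment of the same cost: columns that are not entered are
assigned to their own rows. -/
theorem exists_isPerfect {A : Finset I.Arc} (hA : I.IsLinkage A) :
    ∃ p, hτ.assignment.IsPerfect p ∧
      ∑ z ∈ hτ.assignment.cols, hτ.assignment.len (p z) = ∑ a ∈ A, I.scaledLen a.1 := by
  classical
  set p : ℤ → ℤ := fun z => if h : ∃ a ∈ A, ((I.tgt a : ℕ) : ℤ) = z then arcIndex h.choose
    else I.m + I.m + z with hp
  have p_arc : ∀ a ∈ A, p (I.tgt a : ℕ) = arcIndex a := fun a ha => by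
    have h : ∃ b ∈ A, ((I.tgt b : ℕ) : ℤ) = (I.tgt a : ℕ) := ⟨a, ha, rfl⟩
    simp only [hp]
    rw [dif_pos h]
    exact congrArg _ (hA.in_unique _ h.choose_spec.1 a ha
      (Fin.ext (by exact_mod_cast h.choose_spec.2)))
  have p_loop : ∀ v : Fin I.n, (¬ ∃ a ∈ A, I.tgt a = v) → p (v : ℕ) = I.m + I.m + (v : ℕ) :=
    fun v hv => dif_neg fun ⟨a, ha, h⟩ => hv ⟨a, ha, Fin.ext (by exact_mod_cast h)⟩
  have usable : ∀ a ∈ A, I.IsUsable a := fun a ha => ⟨hA.isArc a ha, hA.tgt_ne a ha, hA.src_ne a ha⟩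
  have hloop : ∀ v : Fin I.n, v ≠ I.root → (¬ ∃ a ∈ A, I.tgt a = v) →
      v ≠ I.root ∧ ∀ k, v ≠ I.terminal k := fun v hv h =>
    ⟨hv, fun k hk => h (hk ▸ hA.terminal_entered k)⟩
  refine ⟨p, ⟨fun z hz => ?_, fun z w hz hw hr hzw => ?_⟩, ?_⟩
  · obtain ⟨v, hv, rfl⟩ := hτ.isCol_iff.1 hz
    by_cases h : ∃ a ∈ A, I.tgt a = v
    · obtain ⟨a, ha, rfl⟩ := h
      rw [p_arc a ha]
      refine ⟨hτ.isEdge_arc.2 (usable a ha), ?_⟩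
      show τ TGT _ = _
      rw [hτ.tgt_arc, if_pos (usable a ha)]
    · rw [p_loop v h]
      refine ⟨hτ.isEdge_loop.2 (hloop v hv h), ?_⟩
      show τ TGT _ = _
      rw [hτ.tgt_loop, if_pos (hloop v hv h)]
  · obtain ⟨v, hv, rfl⟩ := hτ.isCol_iff.1 hz
    obtain ⟨w, hw', rfl⟩ := hτ.isCol_iff.1 hw
    replace hr : τ SRC (p (v : ℕ)) ≠ (I.root : ℕ) := hr
    replace hzw : τ SRC (p (v : ℕ)) = τ SRC (p (w : ℕ)) := hzw
    -- An arc of the linkage cannot start at a vertex that is assigned to itself.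
    have mixed : ∀ a ∈ A, ∀ w : Fin I.n, w ≠ I.root → (¬ ∃ b ∈ A, I.tgt b = w) →
        I.src a ≠ w := by
      rintro a ha w hw hn rfl
      exact hn ((hA.entered_iff_left _ hw (hA.src_ne a ha)).2 ⟨a, ha, rfl⟩)
    by_cases h : ∃ a ∈ A, I.tgt a = v <;> by_cases h' : ∃ a ∈ A, I.tgt a = w
    · obtain ⟨a, ha, rfl⟩ := h
      obtain ⟨b, hb, rfl⟩ := h'
      rw [p_arc a ha, hτ.src_arc] at hzw hr
      rw [p_arc b hb, hτ.src_arc] at hzw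
      rw [hA.out_unique a ha b hb (Fin.ext (by exact_mod_cast hzw))
        fun h => hr (by rw [h])]
    · obtain ⟨a, ha, rfl⟩ := h
      rw [p_arc a ha, hτ.src_arc, p_loop w h', hτ.src_loop] at hzw
      exact absurd (Fin.ext (by exact_mod_cast hzw)) (mixed a ha w hw' h')
    · obtain ⟨b, hb, rfl⟩ := h'
      rw [p_arc b hb, hτ.src_arc, p_loop v h, hτ.src_loop] at hzw
      exact absurd (Fin.ext (by exact_mod_cast hzw.symm)) (mixed b hb v hv h)
    · rwa [p_loop v h, p_loop w h', hτ.src_loop, hτ.src_loop] at hzw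
  · rw [← Finset.sum_subset (s₁ := A.image fun a => ((I.tgt a : ℕ) : ℤ)), Finset.sum_image]
    · refine Finset.sum_congr rfl fun a ha => ?_
      show τ LEN _ = _
      rw [p_arc a ha, hτ.len_arc]
    · intro a ha b hb hab
      have hab' : ((I.tgt a : ℕ) : ℤ) = (I.tgt b : ℕ) := hab
      exact hA.in_unique a ha b hb (Fin.ext (by exact_mod_cast hab'))
    · intro z hz
      obtain ⟨a, ha, rfl⟩ := Finset.mem_image.1 hz
      exact Assignment.mem_cols.2 (hτ.isCol_iff.2 ⟨_, hA.tgt_ne a ha, rfl⟩)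
    · intro z hz hn
      obtain ⟨v, hv, rfl⟩ := hτ.isCol_iff.1 (Assignment.mem_cols.1 hz)
      show τ LEN _ = _
      rw [p_loop v, hτ.len_loop]
      rintro ⟨a, ha, rfl⟩
      exact hn (Finset.mem_image_of_mem _ ha)

variable {b c pin mate : ℤ → ℤ}

/-- A perfect matching contains disjoint paths to the terminals, together with cycles. -/
theorem isTraceable
    (hM : hτ.assignment.IsMatching b c hτ.assignment.IsCol hτ.assignment.root pin mate) :
    I.IsTraceable {a | I.tgt a ≠ I.root ∧ pin (I.tgt a : ℕ) = arcIndex a} := by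
  have usable : ∀ a, I.tgt a ≠ I.root ∧ pin (I.tgt a : ℕ) = arcIndex a → I.IsUsable a :=
    fun a ha => by
      have := (hM.tight _ (hτ.isCol_iff.2 ⟨_, ha.1, rfl⟩)).1
      rwa [ha.2, hτ.isEdge_arc] at this
  -- A column is assigned to its own row, or entered by an arc.
  have cases : ∀ v : Fin I.n, v ≠ I.root →
      (pin (v : ℕ) = I.m + I.m + (v : ℕ) ∧ ∀ k, v ≠ I.terminal k) ∨
      ∃ a, (I.tgt a ≠ I.root ∧ pin (I.tgt a : ℕ) = arcIndex a) ∧ I.tgt a = v := by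
    intro v hv
    have hcol := hτ.isCol_iff.2 ⟨v, hv, rfl⟩
    have he := (hM.tight _ hcol).1
    have ht : τ TGT (pin (v : ℕ)) = (v : ℕ) := hM.tgt_pin _ hcol
    obtain ⟨a, ha⟩ | ⟨w, hw⟩ := index_cases he.1 (by exact_mod_cast he.2.1)
    · rw [ha, hτ.isEdge_arc] at he
      rw [ha, hτ.tgt_arc, if_pos he] at ht
      have hv' : I.tgt a = v := Fin.ext (by exact_mod_cast ht)
      exact .inr ⟨a, ⟨hv' ▸ hv, hv' ▸ ha⟩, hv'⟩
    · rw [hw, hτ.isEdge_loop] at he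
      rw [hw, hτ.tgt_loop, if_pos he] at ht
      obtain rfl : w = v := Fin.ext (by exact_mod_cast ht)
      exact .inl ⟨hw, he.2⟩
  have root_eq : ∀ {v : Fin I.n}, ((v : ℕ) : ℤ) = hτ.assignment.root → v = I.root := fun {v} h => by
    have h' : ((v : ℕ) : ℤ) = (I.root : ℕ) := h
    exact Fin.ext (by exact_mod_cast h')
  have hmate : ∀ a, I.tgt a ≠ I.root ∧ pin (I.tgt a : ℕ) = arcIndex a → I.src a ≠ I.root →
      mate (I.src a : ℕ) = (I.tgt a : ℕ) := fun a ha hr => by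
    have hs : hτ.assignment.src (pin (I.tgt a : ℕ)) = (I.src a : ℕ) := by
      rw [ha.2]
      exact hτ.src_arc a
    have := hM.mate_src _ (hτ.isCol_iff.2 ⟨_, ha.1, rfl⟩) (by
      rw [hs]
      exact fun h => hr (root_eq h))
    rwa [hs] at this
  constructor
  · exact fun a ha => (usable a ha).1
  · exact fun a ha => (usable a ha).2.2
  · intro a ha d hd had hr
    have h1 := hmate a ha hr
    have h2 := hmate d hd (had ▸ hr)
    rw [had, h2] at h1
    apply arcIndex_injective
    rw [← ha.2, ← hd.2, h1]
  · intro k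
    obtain ⟨-, h⟩ | h := cases _ (I.root_ne_terminal k)
    · exact absurd rfl (h k)
    · exact h
  · intro a ha hr
    obtain ⟨h, -⟩ | h := cases _ hr
    · have hs : hτ.assignment.src (pin (I.src a : ℕ)) = (I.src a : ℕ) := by
        rw [h]
        exact hτ.src_loop _
      have := hM.mate_src _ (hτ.isCol_iff.2 ⟨_, hr, rfl⟩) (by
        rw [hs]
        exact fun h => hr (root_eq h))
      rw [hs, hmate a ha hr] at this
      have hst : I.tgt a = I.src a := Fin.ext (by exact_mod_cast this)
      have h1 := ha.2
      rw [hst, h] at h1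
      have := arcIndex_lt a
      omega
    · exact h

/-- The disjoint paths contained in a perfect matching of least cost form an optimal solution. -/
theorem isOptimal (hI : I.UnitCapacities) (hbc : hτ.assignment.IsPotential b c)
    (hM : hτ.assignment.IsMatching b c hτ.assignment.IsCol hτ.assignment.root pin mate)
    {P : Fin I.K → List I.Arc} (hP : I.IsDisjointPaths P)
    (hPpin : ∀ k, ∀ a ∈ P k, I.tgt a ≠ I.root ∧ pin (I.tgt a : ℕ) = arcIndex a) :
    I.IsOptimal (I.arcsOf P) := by
  refine isOptimal_of_forall_disjointPaths hI hP fun P' hP' => length_le_length_iff.2 ?_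
  obtain ⟨p, hp, hsum⟩ := hτ.exists_isPerfect hP'.isLinkage
  have hA : ∀ a ∈ I.arcsOf P, I.tgt a ≠ I.root ∧ pin (I.tgt a : ℕ) = arcIndex a := fun a ha => by
    obtain ⟨k, hk⟩ := mem_arcsOf.1 ha
    exact hPpin k a hk
  calc ∑ a ∈ I.arcsOf P, I.scaledLen a.1
      = ∑ z ∈ (I.arcsOf P).image fun a => ((I.tgt a : ℕ) : ℤ),
          hτ.assignment.len (pin z) := by
        rw [Finset.sum_image]
        · refine Finset.sum_congr rfl fun a ha => ?_
          rw [(hA a ha).2]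
          exact (hτ.len_arc a).symm
        · intro a ha d hd had
          have had' : ((I.tgt a : ℕ) : ℤ) = (I.tgt d : ℕ) := had
          exact hP.isLinkage.in_unique a ha d hd (Fin.ext (by exact_mod_cast had'))
    _ ≤ ∑ z ∈ hτ.assignment.cols, hτ.assignment.len (pin z) := by
        refine Finset.sum_le_sum_of_subset_of_nonneg (fun z hz => ?_) fun z hz _ => ?_
        · obtain ⟨a, ha, rfl⟩ := Finset.mem_image.1 hz
          exact Assignment.mem_cols.2 (hτ.isCol_iff.2 ⟨_, (hA a ha).1, rfl⟩)
        · have := hτ.isPotential_zero.le _ (hM.tight z (Assignment.mem_cols.1 hz)).1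
          simpa using this
    _ ≤ ∑ z ∈ hτ.assignment.cols, hτ.assignment.len (p z) := hM.sum_len_le hbc hp
    _ = ∑ a ∈ I.arcsOf P', I.scaledLen a.1 := hsum

end IsPrepared

end Inst

/-! ### The output of the program -/

namespace Prog

/-- Mark all arcs on the way back from the `k`-th terminal to the root. -/
def markPath : Prog :=
  assign vCol inTerm ;;
  .loop (differ (var vCol) inRoot)
    (assign vE (.get PIN (var vCol)) ;;
      .set OUT (var vE + 2) 1 ;;
      assign vCol (.get SRC (var vE)))

/-- Write the answer. -/
def output : Prog :=
  .cond (var vFail) (.set OUT 0 1)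
    (.set OUT 0 (1 + inM + inM) ;; .set OUT 1 1 ;; forLoop vK inK markPath)

/-- The algorithm for unit capacities. -/
def main : Prog := prepare ;; stages ;; output

theorem tame_main : main.tame = true := by decide

end Prog

namespace Inst

variable {I : Inst} {X : ℕ} {σ τ : Mem}

theorem IsWalk.of_concat {u v : Fin I.n} {L : List I.Arc} {a : I.Arc}
    (h : I.IsWalk u v (L ++ [a])) : I.IsWalk u (I.src a) L ∧ I.tgt a = v := by
  induction L generalizing u with
  | nil => exact ⟨h.2.1.symm, h.2.2⟩
  | cons b L ih =>
    obtain ⟨h1, h2⟩ := ih h.2.2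
    exact ⟨⟨h.1, h.2.1, h1⟩, h2⟩

/-- The output holds the number of its entries, the entry `1`, and the indicator vector of `p`. -/
def Marked (I : Inst) (p : I.Arc → Prop) (τ : Mem) : Prop :=
  τ OUT 0 = 1 + I.m + I.m ∧ τ OUT 1 = 1 ∧
    ∀ a : I.Arc, (p a → τ OUT (arcIndex a + 2) = 1) ∧ (¬ p a → τ OUT (arcIndex a + 2) = 0)

theorem Marked.congr {p q : I.Arc → Prop} (h : I.Marked p σ) (hσ : τ OUT = σ OUT)
    (hpq : ∀ a, p a ↔ q a) : I.Marked q τ := by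
  rw [Marked, hσ]
  exact ⟨h.1, h.2.1, fun a => ⟨fun ha => (h.2.2 a).1 ((hpq a).2 ha),
    fun ha => (h.2.2 a).2 fun h' => ha ((hpq a).1 h')⟩⟩

theorem Marked.mark {p : I.Arc → Prop} (h : I.Marked p σ) {a : I.Arc}
    (hσ : τ OUT = Function.update (σ OUT) (arcIndex a + 2) 1) :
    I.Marked (fun b => p b ∨ b = a) τ := by
  have h0 := arcIndex_nonneg a
  rw [Marked, hσ]
  refine ⟨?_, ?_, fun b => ?_⟩
  · rw [Function.update_of_ne (by omega), h.1]
  · rw [Function.update_of_ne (by omega), h.2.1]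
  · obtain rfl | hne := eq_or_ne b a
    · simp
    · rw [Function.update_of_ne fun h => hne (arcIndex_injective (add_right_cancel h))]
      simpa [hne] using h.2.2 b

theorem wp_markPath (h : I.IsHeld σ) (hX : I.n ≤ X) {L : List I.Arc} {k : Fin I.K}
    (hk : σ vK 0 = (k : ℕ)) (hL : I.IsWalk I.root (I.terminal k) L) (hn : (I.verts L).Nodup)
    (hpin : ∀ a ∈ L, σ PIN (I.tgt a : ℕ) = arcIndex a)
    (hsrc : ∀ a : I.Arc, σ SRC (arcIndex a) = (I.src a : ℕ)) {p : I.Arc → Prop}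
    (hp : I.Marked p σ) :
    wp X Prog.markPath σ fun τ => Frame [OUT, vCol, vE] σ τ ∧
      I.Marked (fun a => p a ∨ a ∈ L) τ := by
  obtain ⟨hr, hn'⟩ := List.nodup_cons.1 hn
  refine wp_seq (R := fun τ => Frame [OUT, vCol, vE] σ τ ∧ I.Marked p τ ∧
    τ vCol 0 = (I.terminal k : ℕ)) ?_ ?_
  · refine ⟨by simp [Frame.refl], hp.congr (by simp) fun _ => Iff.rfl, ?_⟩
    simp [hk, h.terminal]
  rintro τ ⟨hF, hM, hv⟩
  refine wp_loop (fun j τ => Frame [OUT, vCol, vE] σ τ ∧ ∃ (L₁ L₂ : List I.Arc) (v : Fin I.n),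
    L = L₁ ++ L₂ ∧ L₁.length = j ∧ I.IsWalk I.root v L₁ ∧ τ vCol 0 = (v : ℕ) ∧
      I.Marked (fun a => p a ∨ a ∈ L₂) τ) L.length ?_ ?_ ?_ ?_
  · refine le_trans ?_ hX
    simpa using hn'.length_le_card
  · exact ⟨hF, L, [], _, by simp, rfl, hL, hv, hM.congr rfl (by simp)⟩
  · rintro j τ ⟨hF, L₁, L₂, v, rfl, hj, hw, hv, hM⟩ hpos
    obtain rfl | ⟨L₁, a, rfl⟩ := L₁.eq_nil_or_concat
    · obtain rfl : I.root = v := hw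
      simp [hv, hF IN (by decide), h.root] at hpos
    · rw [List.concat_eq_append] at *
      obtain ⟨hw', rfl⟩ := hw.of_concat
      have ha := hpin a (by simp)
      refine ⟨L₁.length, by simp [← hj], ?_, L₁, a :: L₂, I.src a, by simp, rfl, hw', ?_, ?_⟩
      · simp [hF]
      · simp [hv, hF PIN (by decide), hF SRC (by decide), ha, hsrc]
      · refine (hM.mark (a := a) (by simp [hv, hF PIN (by decide), ha])).congr rfl fun b => ?_
        simp only [List.mem_cons]
        tauto
  · rintro j τ ⟨hF, L₁, L₂, v, rfl, hj, hw, hv, hM⟩ hpos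
    obtain rfl | ⟨L₁, a, rfl⟩ := L₁.eq_nil_or_concat
    · exact ⟨hF, hM⟩
    · rw [List.concat_eq_append] at *
      obtain ⟨-, rfl⟩ := hw.of_concat
      have hv' : I.tgt a = I.root := by
        simp only [Expr.eval_mul, Expr.eval_sub, Expr.eval_get, Expr.eval_zero, Expr.eval_ofNat,
          Nat.cast_ofNat, hv, hF IN (by decide), h.root, mul_self_pos, sub_eq_zero, ne_eq,
          not_not] at hpos
        exact Fin.ext (by exact_mod_cast hpos)
      exact absurd (hv' ▸ List.mem_map_of_mem (by simp)) hr

theorem wp_output_none (hf : σ vFail 0 = 1) (h1 : σ OUT 1 = 0) :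
    wp X Prog.output σ fun τ => HasOutput τ (I.encodeAnswer none) := by
  refine ⟨fun _ => ⟨by simp [encodeAnswer], fun j hj => ?_⟩, fun h => by simp [hf] at h⟩
  obtain rfl : j = 0 := by simpa [encodeAnswer] using hj
  simp [encodeAnswer, h1]

end Inst

/-- An entry of a concatenation of blocks of equal lengths. -/
theorem getElem?_flatMap {α β : Type*} {c : ℕ} (f : α → List β) (hf : ∀ x, (f x).length = c)
    (L : List α) {k i : ℕ} (hk : k < L.length) (hi : i < c) :
    (L.flatMap f)[c * k + i]? = (f L[k])[i]? := by
  induction L generalizing k with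
  | nil => simp at hk
  | cons x L ih =>
    rw [List.flatMap_cons]
    cases k with
    | zero => rw [mul_zero, zero_add, List.getElem?_append_left (by simpa [hf] using hi)]; rfl
    | succ k =>
      rw [List.getElem?_append_right (by rw [hf]; nlinarith), hf,
        show c * (k + 1) + i - c = c * k + i by rw [mul_add]; omega, ih (by simpa using hk)]
      rfl

namespace Inst

variable {I : Inst} {X : ℕ} {σ τ : Mem}

theorem Marked.hasOutput {A : Finset I.Arc} (h : I.Marked (· ∈ A) τ) :
    HasOutput τ (I.encodeAnswer (some A)) := by
  have hlen : (I.encodeAnswer (some A)).length = 1 + I.m + I.m := by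
    simp [encodeAnswer, List.length_flatMap]
    omega
  refine ⟨by rw [h.1, hlen]; push_cast; rfl, fun j hj => ?_⟩
  rw [hlen] at hj
  cases j with
  | zero => simpa [encodeAnswer] using h.2.1
  | succ j =>
    obtain ⟨a, ha⟩ | ⟨v, hv⟩ := index_cases (I := I) (e := j) (by omega) (by omega)
    · have hblock := getElem?_flatMap (c := 2) (fun e : Fin I.m =>
          [if (e, true) ∈ A then (1 : ℤ) else 0, if (e, false) ∈ A then 1 else 0]) (fun _ => rfl)
          (List.finRange I.m) (k := a.1) (i := if a.2 then 0 else 1) (by simp)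
          (by split <;> omega)
      have hj' : 2 * (a.1 : ℕ) + (if a.2 then 0 else 1) = j := by
        rw [arcIndex] at ha
        split at ha <;> simp_all <;> omega
      rw [hj'] at hblock
      have hj'' : (I.encodeAnswer (some A))[j + 1]? = some (if a ∈ A then 1 else 0) := by
        rw [encodeAnswer, List.getElem?_cons_succ, hblock]
        obtain ⟨e, b⟩ := a
        cases b <;> simp
      rw [(List.getElem?_eq_some_iff.1 hj'').2]
      have := h.2.2 a
      rw [← ha] at this
      push_cast
      rw [add_assoc]
      split <;> simp_all
    · omega

theorem wp_output_some (h : I.IsHeld σ) (hX : I.n ≤ X) (hK : I.K ≤ X) (hf : σ vFail 0 = 0)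
    (hout : σ OUT = 0) {P : Fin I.K → List I.Arc} (hP : I.IsDisjointPaths P)
    (hpin : ∀ k, ∀ a ∈ P k, σ PIN (I.tgt a : ℕ) = arcIndex a)
    (hsrc : ∀ a : I.Arc, σ SRC (arcIndex a) = (I.src a : ℕ)) :
    wp X Prog.output σ fun τ => HasOutput τ (I.encodeAnswer (some (I.arcsOf P))) := by
  refine ⟨fun h => by simp [hf] at h, fun _ => ?_⟩
  refine wp_seq (R := fun τ => Frame [OUT] σ τ ∧ τ OUT 0 = 1 + I.m + I.m ∧
    ∀ i ≠ 0, τ OUT i = 0) ?_ ?_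
  · refine ⟨by simp [Frame.refl], by simp [h.m], fun i hi => ?_⟩
    simp [hi, hout]
  rintro τ₁ ⟨hF₁, h0, h1⟩
  refine wp_seq (R := fun τ => Frame [OUT] σ τ ∧ I.Marked (fun _ => False) τ) ?_ ?_
  · refine ⟨by simp [hF₁], by simp [h0], by simp, fun a => ⟨False.elim, fun _ => ?_⟩⟩
    have := arcIndex_nonneg a
    simp only [Expr.eval_one, Mem.store_self]
    rw [Function.update_of_ne (by omega), h1 _ (by omega)]
  rintro τ₂ ⟨hF₂, hM₂⟩
  refine wp_forLoop (fun k τ => Frame [OUT, vCol, vE, vK] σ τ ∧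
    I.Marked (fun a => ∃ i : Fin I.K, (i : ℕ) < k ∧ a ∈ P i) τ) I.K hK ?_ ?_ ?_ ?_
  · refine ⟨?_, hM₂.congr (by simp) (by simp)⟩
    rw [frame_store_iff (by decide)]
    exact hF₂.mono (by decide)
  · rintro k τ - ⟨hF, -⟩
    simp [hF IN (by decide), h.K]
  · rintro k τ hk ⟨hF, hM⟩ hv
    refine wp_mono (wp_markPath (k := ⟨k, hk⟩) (h.frame hF (by decide)) hX hv (hP.1 _).1
      (hP.1 _).2 ?_ ?_ hM) ?_
    · rw [hF PIN (by decide)]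
      exact hpin _
    · rw [hF SRC (by decide)]
      exact hsrc
    · rintro τ' ⟨hF', hM'⟩
      refine ⟨by rw [hF' _ (by decide), hv], ?_, hM'.congr (by simp) fun a => ?_⟩
      · rw [frame_store_iff (by decide)]
        exact hF.trans hF' (by decide)
      · constructor
        · rintro (⟨i, hi, ha⟩ | ha)
          · exact ⟨i, by omega, ha⟩
          · exact ⟨⟨k, hk⟩, by simp, ha⟩
        · rintro ⟨i, hi, ha⟩
          obtain hik | hik := lt_or_eq_of_le (Nat.lt_succ_iff.1 hi)
          · exact .inl ⟨i, hik, ha⟩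
          · obtain rfl : i = ⟨k, hk⟩ := Fin.ext hik
            exact .inr ha
  · rintro τ ⟨hF, hM⟩
    refine (hM.congr rfl fun a => ?_).hasOutput
    rw [mem_arcsOf]
    exact exists_congr fun k => and_iff_right k.2

end Inst

/-! ### The input -/

theorem bits_le_wordSize {w : List ℤ} {z : ℤ} (hz : z ∈ w) : bits z ≤ wordSize w :=
  List.single_le_sum (by simp) _ (List.mem_map_of_mem hz)

theorem length_le_wordSize (w : List ℤ) : w.length ≤ wordSize w := by
  have := List.length_le_sum_of_one_le (w.map bits) (by simp [one_le_bits])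
  rwa [List.length_map] at this

theorem bits_natCast_le (k : ℕ) : bits k ≤ k + 1 :=
  bits_le_iff.2 (by simpa using Nat.lt_two_pow_self)

theorem initMem_of_ne (w : List ℤ) {a : ℕ} (ha : a ≠ 0) : initMem w a = 0 := by
  funext i
  simp [initMem, ha]

theorem initMem_eq_of_getElem? {w : List ℤ} {k : ℕ} {z : ℤ} (h : w[k]? = some z) :
    initMem w IN ((k : ℤ) + 1) = z := by
  rw [initMem, if_pos rfl, if_neg (by omega), if_pos (by omega),
    show ((k : ℤ) + 1).toNat - 1 = k by omega, List.getD_eq_getElem?_getD, h]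
  rfl

theorem bits_initMem_le (w : List ℤ) (a : ℕ) (i : ℤ) :
    bits (initMem w a i) ≤ wordSize w + 1 := by
  have h0 : bits 0 ≤ wordSize w + 1 := by simp [bits]
  unfold initMem
  split
  · split
    · exact (bits_natCast_le _).trans (by have := length_le_wordSize w; omega)
    · split
      · by_cases h : i.toNat - 1 < w.length
        · rw [List.getD_eq_getElem _ _ h]
          exact (bits_le_wordSize (List.getElem_mem h)).trans (by omega)
        · rw [List.getD_eq_default _ _ (by omega)]
          exact h0
      · exact h0
  · exact h0

namespace Inst

variable (I : Inst)

theorem isHeld_initMem : I.IsHeld (initMem I.encode) := by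
  have hterm : ∀ k : Fin I.K, I.encode[5 + (k : ℕ)]? = some ((I.terminal k : ℕ) : ℤ) := fun k => by
    rw [encode, List.append_assoc, List.getElem?_append_right (by simp),
      List.getElem?_append_left (by simp)]
    simp
  have hedge : ∀ (e : Fin I.m) {i : ℕ}, i < 5 → I.encode[5 + I.K + (5 * (e : ℕ) + i)]? =
      [((I.fst e : ℕ) : ℤ), ((I.snd e : ℕ) : ℤ), ((I.len e).num : ℤ), ((I.len e).den : ℤ),
        (I.cap e : ℤ)][i]? := fun e i hi => by
    have := getElem?_flatMap (c := 5) (fun e : Fin I.m => [((I.fst e : ℕ) : ℤ),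
      ((I.snd e : ℕ) : ℤ), ((I.len e).num : ℤ), ((I.len e).den : ℤ), (I.cap e : ℤ)])
      (fun _ => rfl) (List.finRange I.m) (k := e) (by simp) hi
    rw [List.getElem_finRange] at this
    rw [encode, List.getElem?_append_right (by simp; omega)]
    refine Eq.trans (congrArg _ ?_) this
    simp
    omega
  have edge : ∀ (e : Fin I.m) {i : ℕ} {z : ℤ}, i < 5 → [((I.fst e : ℕ) : ℤ), ((I.snd e : ℕ) : ℤ),
      ((I.len e).num : ℤ), ((I.len e).den : ℤ), (I.cap e : ℤ)][i]? = some z →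
      initMem I.encode IN (6 + i + I.K + 5 * (e : ℕ)) = z := fun e i z hi hz => by
    rw [← initMem_eq_of_getElem? ((hedge e hi).trans hz)]
    congr 1
    push_cast
    ring
  constructor
  · exact initMem_eq_of_getElem? (k := 0) (by simp [encode])
  · exact initMem_eq_of_getElem? (k := 1) (by simp [encode])
  · exact initMem_eq_of_getElem? (k := 2) (by simp [encode])
  · exact initMem_eq_of_getElem? (k := 3) (by simp [encode])
  · exact initMem_eq_of_getElem? (k := 4) (by simp [encode])
  · intro k
    rw [← initMem_eq_of_getElem? (hterm k)]
    congr 1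
    push_cast
    ring
  · exact fun e => edge e (i := 0) (by omega) rfl
  · exact fun e => edge e (i := 1) (by omega) rfl
  · exact fun e => edge e (i := 2) (by omega) rfl
  · exact fun e => edge e (i := 3) (by omega) rfl

/-- Every vertex other than the root is the end of an arc, so the number of vertices, which is
encoded in binary, is bounded by the size of the encoding nevertheless. -/
theorem n_le : I.n ≤ I.m + I.m + 1 := by
  have hsub : (Finset.univ.erase I.root : Finset (Fin I.n)) ⊆ Finset.univ.image I.tgt := by
    intro v hv
    obtain h | ⟨u, -, a, -, -, h⟩ := Relation.ReflTransGen.cases_tail (I.reach_root v)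
    · exact absurd h (Finset.ne_of_mem_erase hv)
    · exact Finset.mem_image.2 ⟨a, Finset.mem_univ _, h⟩
  have h1 := (Finset.card_le_card hsub).trans Finset.card_image_le
  rw [Finset.card_erase_of_mem (Finset.mem_univ _)] at h1
  simp at h1
  omega

theorem le_wordSize_encode : 5 + I.K + 5 * I.m ≤ wordSize I.encode := by
  refine le_trans (le_of_eq ?_) (length_le_wordSize _)
  simp [encode, List.length_flatMap]
  omega

/-! ### Correctness of the algorithm -/

/-- The size of the encoding bounds the numbers of iterations of all loops. -/
theorem wp_main (hI : I.UnitCapacities) {X : ℕ} (hX : wordSize I.encode ≤ X) :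
    wp X Prog.main (initMem I.encode) fun τ =>
      ∃ y, HasOutput τ (I.encodeAnswer y) ∧ I.IsAnswer y := by
  have hn := I.n_le
  have hsize := I.le_wordSize_encode
  have h := I.isHeld_initMem
  unfold Prog.main
  refine wp_seq (wp_prepare h (by omega) (by omega) (by simp [initMem_of_ne])) ?_
  rintro σ ⟨hF, hσ⟩
  have h' := h.frame hF (by decide)
  have hz : ∀ a, a ∉ [SRC, TGT, LEN, TERM, PIN, MATE, vE, vF, vV, vK, vAcc] → a ≠ 0 → σ a = 0 :=
    fun a ha h0 => (hF a ha).trans (initMem_of_ne _ h0)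
  have hG : hσ.assignment.Describes I.m σ :=
    ⟨rfl, rfl, rfl, h'.n, h'.m, h'.root, by simp [IsPrepared.assignment]⟩
  let term : ℕ → ℤ := fun k => if hk : k < I.K then ((I.terminal ⟨k, hk⟩ : ℕ) : ℤ) else 0
  have term_eq : ∀ k : Fin I.K, term k = ((I.terminal k : ℕ) : ℤ) := fun k => dif_pos k.2
  have hE : hσ.assignment.E = I.m + I.m + I.n := rfl
  have hn' : hσ.assignment.n = I.n := rfl
  refine wp_seq (Assignment.wp_stages (K := I.K) (term := term) hG (by omega) (by omega) (by omega)
    h'.K ?_ ?_ ?_ ?_ ?_ (by rw [hz _ (by decide) (by decide)]; rfl)) ?_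
  · exact fun k hk => (h'.terminal ⟨k, hk⟩).trans (term_eq ⟨k, hk⟩).symm
  · exact fun k hk => hσ.isCol_iff.2 ⟨_, I.root_ne_terminal ⟨k, hk⟩, term_eq ⟨k, hk⟩⟩
  · intro j hj k hk hjk
    rw [term_eq ⟨j, hj⟩, term_eq ⟨k, hk⟩] at hjk
    exact congrArg Fin.val (I.terminal_injective (Fin.ext (by exact_mod_cast hjk)))
  · rw [Assignment.Valid, hz ROWPOT (by decide) (by decide), hz COLPOT (by decide) (by decide)]
    refine ⟨hσ.isPotential_zero, hσ.isMatching_loops fun z => ?_⟩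
    rw [hσ.isCol_iff]
    constructor
    · rintro ⟨⟨v, hv, rfl⟩, ht⟩
      exact ⟨v, ⟨hv, fun k hk => ht k k.2 (by rw [term_eq, hk])⟩, rfl⟩
    · rintro ⟨v, ⟨hv, ht⟩, rfl⟩
      refine ⟨⟨v, hv, rfl⟩, fun k hk h => ht ⟨k, hk⟩ (Fin.ext ?_)⟩
      rw [term_eq ⟨k, hk⟩] at h
      exact_mod_cast h
  · simp [Assignment.Clean, hz ROWS (by decide) (by decide), hz COLS (by decide) (by decide)]
  rintro ρ ⟨hF', ⟨hf, hno⟩ | ⟨hf, hV⟩⟩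
  · have hout : ρ OUT 1 = 0 := by
      rw [hF' OUT (by decide), hz OUT (by decide) (by decide)]
      rfl
    refine wp_mono (wp_output_none hf hout) fun τ hτ => ⟨none, hτ, fun A hA => ?_⟩
    obtain ⟨P, hP, -⟩ := hA.exists_disjointPaths hI
    obtain ⟨p, hp, -⟩ := hσ.exists_isPerfect hP.isLinkage
    exact hno p hp
  · obtain ⟨P, hP, hPpin⟩ := (hσ.isTraceable hV.2).exists_disjointPaths
    refine wp_mono (wp_output_some (h'.frame hF' (by decide)) (by omega) (by omega) hf ?_ hP
      (fun k a ha => (hPpin k a ha).2) ?_) fun τ hτ =>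
      ⟨some (I.arcsOf P), hτ, hσ.isOptimal hI hV.1 hV.2 hP hPpin⟩
    · rw [hF' OUT (by decide), hz OUT (by decide) (by decide)]
    · rw [hF' SRC (by decide)]
      exact hσ.src_arc

end Inst

/-- The program `main` makes polynomially many steps, on numbers of polynomial bit length. The
second factor of the polynomial bounds the cost of one step: `X + 1` bounds the bit lengths in the
initial memory, and `W * (X + 1)` their growth in one step. -/
theorem polyTimeSolvable_unitCapacities :
    PolyTimeSolvable Inst.encode Inst.encodeAnswer Inst.UnitCapacities Inst.IsAnswer := by
  let W : ℕ := Prog.main.weight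
  refine ⟨Prog.main, Prog.main.steps * ((2 * Polynomial.C W ^ 2 + 1) *
    ((Polynomial.X + 1) + Polynomial.C W * (Polynomial.X + 1) * Prog.main.steps)), fun I hI => ?_⟩
  obtain ⟨t, τ, hexec, ⟨y, hout, hy⟩, -, -, ht⟩ :=
    exec_of_wp (W := W) Prog.main Prog.tame_main le_rfl
      (fun i => bits_initMem_le I.encode 0 i) (bits_initMem_le I.encode) le_rfl
      (I.wp_main hI le_rfl)
  exact ⟨t, τ, y, hexec, by simpa using ht, hout, hy⟩

end CapSteiner

theorem mainTheorem1 :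
    -- Unit-capacity instances are solvable in polynomial time.
    CapSteiner.PolyTimeSolvable CapSteiner.Inst.encode CapSteiner.Inst.encodeAnswer
      CapSteiner.Inst.UnitCapacities CapSteiner.Inst.IsAnswer ∧
    ∀ I : CapSteiner.Inst, I.UnitCapacities →
      -- Every feasible solution contains `K` internally disjoint paths from root to terminals,
      -- and consists of exactly these if it is minimal with respect to inclusion.
      (∀ A : Finset I.Arc, I.IsFeasible A →
        ∃ P : Fin I.K → List I.Arc, I.IsDisjointPaths P ∧ I.arcsOf P ⊆ A ∧
          ((∀ B ⊆ A, I.IsFeasible B → B = A) → I.arcsOf P = A)) ∧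
      -- Conversely, such paths form a feasible solution, of the same total length.
      (∀ P : Fin I.K → List I.Arc, I.IsDisjointPaths P →
        I.IsFeasible (I.arcsOf P) ∧
          I.length (I.arcsOf P) = ∑ k, ((P k).map fun a => I.len a.1).sum) ∧
      -- There is a feasible solution if and only if there is a flow of `K` units.
      ((∃ A : Finset I.Arc, I.IsFeasible A) ↔
        ∃ f : I.splitNetwork.Edge → ℕ, I.splitNetwork.IsFlow I.K f) ∧
      -- A minimum-cost flow of `K` units yields an optimal solution, of length equal to its cost.
      (∀ f : I.splitNetwork.Edge → ℕ, I.splitNetwork.IsMinCostFlow I.K f →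
        ∃ A : Finset I.Arc, I.IsOptimal A ∧ (A : Set I.Arc) ⊆ I.flowSupport f ∧
          I.length A = I.splitNetwork.flowCost f) :=
  ⟨CapSteiner.polyTimeSolvable_unitCapacities, fun _ hI =>
    ⟨fun _ hA => CapSteiner.Inst.exists_disjointPaths_of_isFeasible hI hA,
      fun _ hP => ⟨hP.isFeasible hI, hP.length_eq⟩, CapSteiner.Inst.feasible_iff_flow hI,
      fun _ hf => CapSteiner.Inst.exists_isOptimal_of_isMinCostFlow hI hf⟩⟩
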